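/- **Setting.** Let $q=e^{2\pi i/8}$, $q^x=e^{2\pi i x/8}$ for $x\in\mathbb R$, $\{x\}=q^x-q^{-x}$, $[x]=\{x\}/\{1\}$, $\{k\}!=\{1\}\cdots\{k\}$. Let $\alpha\in\mathbb R\setminus\mathbb Z$. For $\beta\in\mathbb R$ let $V_\beta$ be the weight module of the unrolled quantum group $\overline U_q^H(\mathfrak{sl}_2)$ with basis $v_0,\dots,v_3$ and $Hv_i=(\beta+3-2i)v_i$, $Ev_i=[i][i-\beta]v_{i-1}$, $Fv_i=v_{i+1}$ (with $v_{-1}=v_4=0$), $K=q^H$; let $S_1$ be the module with basis $s_0,s_1$ of weights $1,-1$ and $Es_1=s_0$, $Es_0=0$, $Fs_0=s_1$, $Fs_1=0$. Tensor products are formed with $\Delta E=1\otimes E+E\otimes K$, $\Delta F=K^{-1}\otimes F+F\otimes1$, $\Delta H=H\otimes1+1\otimes H$, and the braiding $c_{V,W}:V\otimes W\to W\otimes V$ is the flip composed with $R=q^{H\otimes H/2}\sum_{k=0}^{3}\frac{\{1\}^{2k}}{\{k\}!}q^{k(k-1)/2}E^k\otimes F^k$. Let $\mathcal H_n=\mathrm{Hom}(V_\alpha,V_\alpha\otimes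 S_1^{\otimes 2n})$. The affine braid group $\mathrm{Br}^{\mathrm{aff}}_{2n}$, generated by $\mathsf b_1^2$ (the first strand winds around a fixed pole) and the elementary braids $\mathsf b_2,\dots,\mathsf b_{2n}$, acts on $\mathcal H_n$ by composition: $\mathsf b_1^2$ acts by the double braiding $c_{S_1,V_\alpha}c_{V_\alpha,S_1}$ of $V_\alpha$ with the first factor $S_1$, and $\mathsf b_{i+1}$ by $c_{S_1,S_1}$ on the $i$-th and $(i+1)$-st factors $S_1$. For $x\in\{0,1\}^n$ let $|x\rangle\in\mathcal H_n$ be the left-hanging fusion tree whose successive charges are $\alpha,\ v_1,\ \alpha,\ v_2,\ \alpha,\dots,v_n,\ \alpha$, where $v_i=\alpha+1$ if $x_i=0$ and $v_i=\alpha-1$ if $x_i=1$; its vertices $V_{\beta\pm1}\to V_\beta\otimes S_1$ are the homomorphisms that send $v_0$ to $v_0\otimes s_0$ (sign $+$), respectively to $v_0\otimes s_1-\frac{q^{-1}}{[1-\beta]}v_1\otimes s_0$ (sign $-$). Let $\mathcal H_n^{\mathrm{comp}}$ be the span of the $|x\rangle$. It carries the Hermitian form $\langle x|y\rangle=\mathsf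 t(|x\rangle^\dagger|y\rangle)$, where $\mathsf t(\lambda\,\mathrm{Id}_{V_\alpha})=-4\frac{\{\alpha\}}{\{4\alpha\}}\lambda$ is the modified trace and $\dagger$ is formed vertex by vertex from the invariant Hermitian forms: on $V_\beta$ the form with $v_i$ orthogonal and $\langle v_i,v_i\rangle=\prod_{j=1}^{i}[j][j-\beta]$; on $S_1$ the form with $s_0,s_1$ orthonormal; on $V_\beta\otimes S_1$ the form $\langle\,\cdot\,,\tau X\,\cdot\,\rangle$, with $\langle\cdot,\cdot\rangle$ the product form, $\tau$ the flip, and $X=\sqrt\theta_{S_1\otimes V_\beta}^{\,-1}\,c_{V_\beta,S_1}\,(\sqrt\theta_{V_\beta}\otimes\sqrt\theta_{S_1})$, where $\sqrt\theta$ is the scalar $q^{(\gamma^2-9)/4}$ on each $V_\gamma$ (in particular on the summands of $S_1\otimes V_\beta\cong V_{\beta+1}\oplus V_{\beta-1}$) and $q^{-5/4}$ on $S_1$. **Theorem (multiqubit density).** Let $n\ge0$ and let $\alpha\in\mathbb R\setminus\mathbb Z$ with $\alpha\in(2-\tfrac13,2+\tfrac13)\bmod 4$. Then the Hermitian form on $\mathcal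 H_n^{\mathrm{comp}}$ is (positive or negative) definite, and the image of $\mathrm{Br}_{2n}^{\mathrm{aff}}$ acting on $\mathcal H_n$ is dense in $\mathrm{PSU}(\mathcal H_n^{\mathrm{comp}})$, up to arbitrarily small leakage: for every $U$ in the special unitary group $\mathrm{SU}(\mathcal H_n^{\mathrm{comp}})$ of that form there is a phase $c\in\mathbb C$, $|c|=1$, such that $cU$, regarded as a linear map $\mathcal H_n^{\mathrm{comp}}\to\mathcal H_n$, lies in the closure of the set of restrictions to $\mathcal H_n^{\mathrm{comp}}$ of the operators by which the braids $\mathsf b\in\mathrm{Br}_{2n}^{\mathrm{aff}}$ act on $\mathcal H_n$. -/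

import Mathlib

namespace Neglecton

noncomputable section

open scoped Kronecker Matrix ComplexOrder

set_option linter.unusedSimpArgs false
set_option linter.unusedSectionVars false
set_option linter.unreachableTactic false
set_option linter.unusedTactic false
set_option linter.unnecessarySeqFocus false

/-- `q ^ x` for real `x`, where `q = exp (2 π i / 8)`. -/
def qpow (x : ℝ) : ℂ := Complex.exp ((Real.pi * x / 4 : ℝ) * Complex.I)

/-- `{x} = q ^ x - q ^ (-x)`. -/
def qbr (x : ℝ) : ℂ := qpow x - qpow (-x)

/-- The quantum number `[x] = {x} / {1}`. -/
def qint (x : ℝ) : ℂ := qbr x / qbr 1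

/-- `{k}! = {1} {2} ⋯ {k}`. -/
def qbrFactorial (k : ℕ) : ℂ := ∏ i ∈ Finset.range k, qbr (i + 1)

/-- A weight module over the unrolled quantum group of `sl_2` at `q`, given by the matrices of `E`
and `F` in a basis of weight vectors, with the weights (the eigenvalues of `H`) of that basis. -/
structure QModule (ι : Type) where
  E : Matrix ι ι ℂ
  F : Matrix ι ι ℂ
  wt : ι → ℝ

namespace QModule

variable {ι κ : Type} [Fintype ι] [DecidableEq ι] [Fintype κ] [DecidableEq κ]

/-- The matrix of `H`. -/
def H (A : QModule ι) : Matrix ι ι ℂ := Matrix.diagonal fun i => (A.wt i : ℂ)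
/-- The matrix of `K = q ^ H`. -/
def K (A : QModule ι) : Matrix ι ι ℂ := Matrix.diagonal fun i => qpow (A.wt i)
/-- The matrix of the inverse of `K`. -/
def Kinv (A : QModule ι) : Matrix ι ι ℂ := Matrix.diagonal fun i => qpow (-A.wt i)

/-- The tensor product, with the coproduct `Δ E = 1 ⊗ E + E ⊗ K`, `Δ F = K⁻¹ ⊗ F + F ⊗ 1`,
`Δ H = H ⊗ 1 + 1 ⊗ H`. -/
def tensor (A : QModule ι) (B : QModule κ) : QModule (ι × κ) where
  E := (1 : Matrix ι ι ℂ) ⊗ₖ B.E + A.E ⊗ₖ B.K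
  F := A.Kinv ⊗ₖ B.F + A.F ⊗ₖ (1 : Matrix κ κ ℂ)
  wt := fun x => A.wt x.1 + B.wt x.2

/-- The R-matrix `q ^ (H ⊗ H / 2) ∑ₖ {1} ^ (2 k) / {k}! q ^ (k (k - 1) / 2) E ^ k ⊗ F ^ k`. -/
def rMatrix (A : QModule ι) (B : QModule κ) : Matrix (ι × κ) (ι × κ) ℂ :=
  Matrix.diagonal (fun x => qpow (A.wt x.1 * B.wt x.2 / 2)) *
    ∑ k ∈ Finset.range 4,
      (qbr 1 ^ (2 * k) / qbrFactorial k * qpow ((k : ℝ) * (k - 1) / 2)) • ((A.E ^ k) ⊗ₖ (B.F ^ k))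

/-- The braiding `A ⊗ B → B ⊗ A`: the R-matrix followed by the flip. -/
def braiding (A : QModule ι) (B : QModule κ) : Matrix (κ × ι) (ι × κ) ℂ :=
  (A.rMatrix B).submatrix Prod.swap id

/-- `f` is the matrix of a module homomorphism from `A` to `B`. (Commuting with `K = q ^ H` and
its inverse follows from commuting with `H`.) -/
def IsHom (A : QModule ι) (B : QModule κ) (f : Matrix κ ι ℂ) : Prop :=
  f * A.E = B.E * f ∧ f * A.F = B.F * f ∧ f * A.H = B.H * f

end QModule

open QModule

/-- The typical module `V_β`, with basis `v_0, …, v_3`: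
`H v_i = (β + 3 - 2 i) v_i`, `E v_i = [i] [i - β] v_(i - 1)`, `F v_i = v_(i + 1)`. -/
def typical (β : ℝ) : QModule (Fin 4) where
  E := Matrix.of fun i j => if (j : ℕ) = i + 1 then qint j * qint (j - β) else 0
  F := Matrix.of fun i j => if (i : ℕ) = j + 1 then 1 else 0
  wt := fun i => β + 3 - 2 * i

/-- The Ising module `S_1`, with basis `s_0`, `s_1` of weights `1`, `-1`. -/
def ising : QModule (Fin 2) where
  E := Matrix.of fun i j => if (j : ℕ) = i + 1 then 1 else 0
  F := Matrix.of fun i j => if (i : ℕ) = j + 1 then 1 else 0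
  wt := fun i => 1 - 2 * i

/-- The index set of the basis of `V_α ⊗ S_1 ^ (⊗ m)`. -/
abbrev Idx : ℕ → Type
  | 0 => Fin 4
  | m + 1 => Idx m × Fin 2

instance Idx.fintype : (m : ℕ) → Fintype (Idx m)
  | 0 => inferInstanceAs (Fintype (Fin 4))
  | m + 1 => @instFintypeProd _ _ (Idx.fintype m) _
instance Idx.decEq : (m : ℕ) → DecidableEq (Idx m)
  | 0 => inferInstanceAs (DecidableEq (Fin 4))
  | m + 1 => @instDecidableEqProd _ _ (Idx.decEq m) _

/-- The module `V_α ⊗ S_1 ^ (⊗ m)`, bracketed to the left. -/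
def tensorPower (α : ℝ) : (m : ℕ) → QModule (Idx m)
  | 0 => typical α
  | m + 1 => (tensorPower α m).tensor ising

/-- The braiding of the last two factors of `(W ⊗ S_1) ⊗ S_1`. -/
def crossing (ι : Type) [DecidableEq ι] :
    Matrix ((ι × Fin 2) × Fin 2) ((ι × Fin 2) × Fin 2) ℂ :=
  ((1 : Matrix ι ι ℂ) ⊗ₖ ising.braiding ising).submatrix
    (Equiv.prodAssoc ι (Fin 2) (Fin 2)) (Equiv.prodAssoc ι (Fin 2) (Fin 2))

/-- The double braiding of `V_α` with `S_1`: the Ising anyon is wound once around the pole `V_α`. -/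
def poleBraid (α : ℝ) : Matrix (Fin 4 × Fin 2) (Fin 4 × Fin 2) ℂ :=
  ising.braiding (typical α) * (typical α).braiding ising

/-- The action of the generators of the affine braid group on `V_α ⊗ S_1 ^ (⊗ m)`: number `0`
winds the first Ising factor around `V_α`, and number `i ≥ 1` braids the Ising factors `i` and
`i + 1` (counted from `1`). -/
def braidMatrix (α : ℝ) : (m : ℕ) → ℕ → Matrix (Idx m) (Idx m) ℂ
  | 0, _ => 1
  | 1, _ => poleBraid α
  | m + 2, i =>
    if i = m + 1 then crossing (Idx m) else braidMatrix α (m + 1) i ⊗ₖ (1 : Matrix (Fin 2) (Fin 2) ℂ)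


theorem qpow_zero : qpow 0 = 1 := by simp [qpow]

theorem qpow_add (x y : ℝ) : qpow (x + y) = qpow x * qpow y := by
  rw [qpow, qpow, qpow, ← Complex.exp_add]; push_cast; ring_nf

theorem qpow_ne_zero (x : ℝ) : qpow x ≠ 0 := Complex.exp_ne_zero _

theorem qpow_neg (x : ℝ) : qpow (-x) = (qpow x)⁻¹ := by
  rw [qpow, qpow, ← Complex.exp_neg]; push_cast; ring_nf

theorem qpow_four : qpow 4 = -1 := by
  rw [qpow, show (Real.pi * 4 / 4 : ℝ) = Real.pi by ring]; exact Complex.exp_pi_mul_I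

theorem qpow_nat_mul (n : ℕ) (x : ℝ) : qpow (n * x) = qpow x ^ n := by
  rw [qpow, qpow, ← Complex.exp_nat_mul]; push_cast; ring_nf

theorem qpow_one_pow_four : qpow 1 ^ 4 = -1 := by
  rw [← qpow_nat_mul, ← qpow_four]; norm_num

theorem qbr_one_ne_zero : qbr 1 ≠ 0 := by
  intro h
  have h1 := qpow_ne_zero 1
  rw [qbr, qpow_neg, sub_eq_zero] at h
  have h2 : qpow 1 ^ 2 = 1 := by
    rw [sq]; nth_rw 1 [h]; exact inv_mul_cancel₀ h1
  have h3 := qpow_one_pow_four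
  rw [show (4 : ℕ) = 2 * 2 from rfl, pow_mul, h2] at h3
  norm_num at h3

variable {ι κ : Type} [Fintype ι] [DecidableEq ι] [Fintype κ] [DecidableEq κ]

theorem ising_E_sq : ising.E * ising.E = 0 := by
  ext i j; fin_cases i <;> fin_cases j <;> simp [ising, Matrix.mul_apply]

theorem ising_F_sq : ising.F * ising.F = 0 := by
  ext i j; fin_cases i <;> fin_cases j <;> simp [ising, Matrix.mul_apply]

theorem rMatrix_of_nil (A : QModule ι) (B : QModule κ) (h : A.E * A.E = 0 ∨ B.F * B.F = 0) :
    A.rMatrix B = Matrix.diagonal (fun x => qpow (A.wt x.1 * B.wt x.2 / 2)) *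
      (1 + qbr 1 • (A.E ⊗ₖ B.F)) := by
  have h2 : (A.E ^ 2) ⊗ₖ (B.F ^ 2) = 0 := by
    rcases h with h | h <;> simp [sq, h]
  have h3 : (A.E ^ 3) ⊗ₖ (B.F ^ 3) = 0 := by
    rcases h with h | h <;> simp [pow_succ, h]
  rw [rMatrix]
  congr 1
  simp only [Finset.sum_range_succ, Finset.sum_range_zero, h2, h3, smul_zero, add_zero, zero_add]
  have : qbr 1 ≠ 0 := qbr_one_ne_zero
  simp [qbrFactorial, qpow_zero, sq, this]

/-- The braiding of `S_1` with itself, with `s = q ^ (1 / 2)`. -/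
def isingCross (s : ℂ) : Matrix (Fin 2 × Fin 2) (Fin 2 × Fin 2) ℂ
  | (0, 0), (0, 0) => s
  | (0, 1), (1, 0) => s⁻¹
  | (1, 0), (0, 1) => s⁻¹
  | (1, 0), (1, 0) => s - s⁻¹ ^ 3
  | (1, 1), (1, 1) => s
  | _, _ => 0

/-- The inverse of `isingCross s`. -/
def isingCrossInv (s : ℂ) : Matrix (Fin 2 × Fin 2) (Fin 2 × Fin 2) ℂ
  | (0, 0), (0, 0) => s⁻¹
  | (0, 1), (1, 0) => s
  | (1, 0), (0, 1) => s
  | (0, 1), (0, 1) => s⁻¹ - s ^ 3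
  | (1, 1), (1, 1) => s⁻¹
  | _, _ => 0

theorem qpow_half_sq : qpow (1 / 2) ^ 2 = qpow 1 := by
  rw [← qpow_nat_mul]; norm_num

theorem ising_braiding : ising.braiding ising = isingCross (qpow (1 / 2)) := by
  have h1 := qpow_half_sq
  have h0 := qpow_ne_zero (1 / 2)
  rw [braiding, rMatrix_of_nil _ _ (Or.inl ising_E_sq)]
  ext ⟨a, b⟩ ⟨c, d⟩
  have e1 : qpow (-1 / 2) = (qpow (1 / 2))⁻¹ := by rw [← qpow_neg]; norm_num
  fin_cases a <;> fin_cases b <;> fin_cases c <;> fin_cases d <;>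
    simp [isingCross, ising, Matrix.mul_apply, Matrix.one_apply, Fintype.sum_prod_type,
      Matrix.diagonal_apply, Matrix.kroneckerMap_apply, qbr] <;> norm_num [e1, qpow_neg, ← h1] <;>
      field_simp <;> try ring


theorem isingCross_entries (s : ℂ) :
    isingCross s (0, 0) (0, 0) = s ∧
    isingCross s (0, 0) (0, 1) = 0 ∧
    isingCross s (0, 0) (1, 0) = 0 ∧
    isingCross s (0, 0) (1, 1) = 0 ∧
    isingCross s (0, 1) (0, 0) = 0 ∧
    isingCross s (0, 1) (0, 1) = 0 ∧
    isingCross s (0, 1) (1, 0) = s⁻¹ ∧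
    isingCross s (0, 1) (1, 1) = 0 ∧
    isingCross s (1, 0) (0, 0) = 0 ∧
    isingCross s (1, 0) (0, 1) = s⁻¹ ∧
    isingCross s (1, 0) (1, 0) = s - s⁻¹ ^ 3 ∧
    isingCross s (1, 0) (1, 1) = 0 ∧
    isingCross s (1, 1) (0, 0) = 0 ∧
    isingCross s (1, 1) (0, 1) = 0 ∧
    isingCross s (1, 1) (1, 0) = 0 ∧
    isingCross s (1, 1) (1, 1) = s :=
  ⟨rfl, rfl, rfl, rfl, rfl, rfl, rfl, rfl, rfl, rfl, rfl, rfl, rfl, rfl, rfl, rfl⟩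

theorem isingCross_mul_inv {s : ℂ} (hs : s ≠ 0) : isingCross s * isingCrossInv s = 1 := by
  ext ⟨a, b⟩ ⟨c, d⟩
  fin_cases a <;> fin_cases b <;> fin_cases c <;> fin_cases d <;>
    simp [isingCross, isingCrossInv, Matrix.mul_apply, Matrix.one_apply,
      Fintype.sum_prod_type, hs] <;> field_simp <;> ring

theorem isingCross_inv_mul {s : ℂ} (hs : s ≠ 0) : isingCrossInv s * isingCross s = 1 :=
  mul_eq_one_comm.mp (isingCross_mul_inv hs)

theorem isingCross_comm_E {s : ℂ} (hs : s ≠ 0) (h : s ^ 2 = qpow 1) :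
    isingCross s * (ising.tensor ising).E = (ising.tensor ising).E * isingCross s := by
  ext ⟨a, b⟩ ⟨c, d⟩
  fin_cases a <;> fin_cases b <;> fin_cases c <;> fin_cases d <;>
    simp [isingCross_entries s, QModule.tensor, QModule.K, ising, Matrix.mul_apply, Matrix.one_apply,
      Fintype.sum_prod_type] <;> norm_num [qpow_neg, ← h] <;> field_simp <;> ring

theorem isingCross_comm_F {s : ℂ} (hs : s ≠ 0) (h : s ^ 2 = qpow 1) :
    isingCross s * (ising.tensor ising).F = (ising.tensor ising).F * isingCross s := by
  ext ⟨a, b⟩ ⟨c, d⟩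
  fin_cases a <;> fin_cases b <;> fin_cases c <;> fin_cases d <;>
    simp [isingCross_entries s, QModule.tensor, QModule.Kinv, ising, Matrix.mul_apply, Matrix.one_apply,
      Fintype.sum_prod_type] <;> norm_num [qpow_neg, ← h] <;> field_simp <;> ring

theorem isingCross_comm_H (s : ℂ) :
    isingCross s * (ising.tensor ising).H = (ising.tensor ising).H * isingCross s := by
  ext ⟨a, b⟩ ⟨c, d⟩
  fin_cases a <;> fin_cases b <;> fin_cases c <;> fin_cases d <;>
    simp [isingCross_entries s, QModule.tensor, QModule.H, ising] <;> ring

theorem isingCross_comm_K (s : ℂ) :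
    isingCross s * (ising.K ⊗ₖ ising.K) = (ising.K ⊗ₖ ising.K) * isingCross s := by
  ext ⟨a, b⟩ ⟨c, d⟩
  fin_cases a <;> fin_cases b <;> fin_cases c <;> fin_cases d <;>
    simp [isingCross_entries s, QModule.K, ising, Matrix.mul_apply, Fintype.sum_prod_type] <;> ring

theorem isingCross_comm_Kinv (s : ℂ) :
    isingCross s * (ising.Kinv ⊗ₖ ising.Kinv) = (ising.Kinv ⊗ₖ ising.Kinv) * isingCross s := by
  ext ⟨a, b⟩ ⟨c, d⟩
  fin_cases a <;> fin_cases b <;> fin_cases c <;> fin_cases d <;>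
    simp [isingCross_entries s, QModule.Kinv, ising, Matrix.mul_apply, Fintype.sum_prod_type] <;> ring


theorem yang_entry_left (M : Matrix (Fin 2 × Fin 2) (Fin 2 × Fin 2) ℂ) (a b c a' b' c' : Fin 2) :
    ((M ⊗ₖ (1 : Matrix (Fin 2) (Fin 2) ℂ)).submatrix
      (Equiv.prodAssoc _ _ _).symm (Equiv.prodAssoc _ _ _).symm *
      ((1 : Matrix (Fin 2) (Fin 2) ℂ) ⊗ₖ M) * (M ⊗ₖ (1 : Matrix (Fin 2) (Fin 2) ℂ)).submatrix
      (Equiv.prodAssoc _ _ _).symm (Equiv.prodAssoc _ _ _).symm) (a, b, c) (a', b', c') =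
    ∑ y, ∑ z, (∑ x, M (a, b) (y, x) * M (x, c) (z, c')) * M (y, z) (a', b') := by
  simp [Matrix.mul_apply, Matrix.one_apply, Fintype.sum_prod_type, Finset.sum_ite_eq]

theorem yang_entry_right (M : Matrix (Fin 2 × Fin 2) (Fin 2 × Fin 2) ℂ) (a b c a' b' c' : Fin 2) :
    (((1 : Matrix (Fin 2) (Fin 2) ℂ) ⊗ₖ M) * (M ⊗ₖ (1 : Matrix (Fin 2) (Fin 2) ℂ)).submatrix
      (Equiv.prodAssoc _ _ _).symm (Equiv.prodAssoc _ _ _).symm *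
      ((1 : Matrix (Fin 2) (Fin 2) ℂ) ⊗ₖ M)) (a, b, c) (a', b', c') =
    ∑ y, ∑ z, (∑ x, M (b, c) (x, z) * M (a, x) (a', y)) * M (y, z) (b', c') := by
  simp [Matrix.mul_apply, Matrix.one_apply, Fintype.sum_prod_type, Finset.sum_ite_eq]

set_option maxHeartbeats 1000000 in
theorem isingCross_yangBaxter {s : ℂ} (hs : s ≠ 0) :
    (isingCross s ⊗ₖ (1 : Matrix (Fin 2) (Fin 2) ℂ)).submatrix
      (Equiv.prodAssoc _ _ _).symm (Equiv.prodAssoc _ _ _).symm *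
      ((1 : Matrix (Fin 2) (Fin 2) ℂ) ⊗ₖ isingCross s) *
      (isingCross s ⊗ₖ (1 : Matrix (Fin 2) (Fin 2) ℂ)).submatrix
      (Equiv.prodAssoc _ _ _).symm (Equiv.prodAssoc _ _ _).symm =
    ((1 : Matrix (Fin 2) (Fin 2) ℂ) ⊗ₖ isingCross s) *
      (isingCross s ⊗ₖ (1 : Matrix (Fin 2) (Fin 2) ℂ)).submatrix
      (Equiv.prodAssoc _ _ _).symm (Equiv.prodAssoc _ _ _).symm *
      ((1 : Matrix (Fin 2) (Fin 2) ℂ) ⊗ₖ isingCross s) := by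
  ext ⟨a, b, c⟩ ⟨a', b', c'⟩
  rw [yang_entry_left, yang_entry_right]
  fin_cases a <;> fin_cases b <;> fin_cases c <;> fin_cases a' <;> fin_cases b' <;> fin_cases c' <;>
    simp [isingCross_entries s, Fin.sum_univ_two] <;> field_simp <;> ring

/-- Elementary matrices. -/
abbrev unitMat (i j : Fin 2) : Matrix (Fin 2) (Fin 2) ℂ := Matrix.single i j 1

theorem hex_K {s : ℂ} (hs : s ≠ 0) (h : s ^ 2 = qpow 1) :
    isingCross s * (unitMat 0 0 ⊗ₖ (1 : Matrix (Fin 2) (Fin 2) ℂ)) * isingCross s =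
      ising.K ⊗ₖ unitMat 0 0 := by
  ext ⟨a, b⟩ ⟨c, d⟩
  fin_cases a <;> fin_cases b <;> fin_cases c <;> fin_cases d <;>
    simp [isingCross_entries s, QModule.K, ising, Matrix.mul_apply, Matrix.single_apply, Matrix.one_apply,
      Fintype.sum_prod_type] <;> norm_num [qpow_neg, ← h] <;> field_simp

theorem hex_F {s : ℂ} (hs : s ≠ 0) (h : s ^ 2 = qpow 1) :
    isingCross s * (unitMat 0 1 ⊗ₖ (1 : Matrix (Fin 2) (Fin 2) ℂ)) * isingCross s =
      qbr 1 • (ising.E ⊗ₖ unitMat 0 0) + 1 ⊗ₖ unitMat 0 1 := by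
  ext ⟨a, b⟩ ⟨c, d⟩
  fin_cases a <;> fin_cases b <;> fin_cases c <;> fin_cases d <;>
    simp [isingCross_entries s, qbr, ising, Matrix.mul_apply, Matrix.single_apply, Matrix.one_apply,
      Fintype.sum_prod_type] <;> norm_num [qpow_neg, ← h] <;> field_simp

theorem hex_E {s : ℂ} (hs : s ≠ 0) (h : s ^ 2 = qpow 1) :
    isingCross s * (unitMat 1 0 ⊗ₖ (1 : Matrix (Fin 2) (Fin 2) ℂ)) * isingCross s =
      (qbr 1 * qpow (-1)) • ((ising.F * ising.K) ⊗ₖ unitMat 0 0) + 1 ⊗ₖ unitMat 1 0 := by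
  ext ⟨a, b⟩ ⟨c, d⟩
  fin_cases a <;> fin_cases b <;> fin_cases c <;> fin_cases d <;>
    simp [isingCross_entries s, qbr, ising, QModule.K, Matrix.mul_apply, Matrix.single_apply, Matrix.one_apply,
      Fintype.sum_prod_type] <;> norm_num [qpow_neg, ← h] <;> field_simp

theorem hex_Kinv {s : ℂ} (hs : s ≠ 0) (h : s ^ 2 = qpow 1) :
    isingCross s * (unitMat 1 1 ⊗ₖ (1 : Matrix (Fin 2) (Fin 2) ℂ)) * isingCross s =
      (qbr 1 ^ 2 * qpow (-1)) • ((ising.F * ising.E) ⊗ₖ unitMat 0 0) +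
      (qbr 1 * qpow (-1)) • (ising.F ⊗ₖ unitMat 0 1) +
      qbr 1 • ((ising.Kinv * ising.E) ⊗ₖ unitMat 1 0) + ising.Kinv ⊗ₖ unitMat 1 1 := by
  ext ⟨a, b⟩ ⟨c, d⟩
  fin_cases a <;> fin_cases b <;> fin_cases c <;> fin_cases d <;>
    simp [isingCross_entries s, qbr, ising, QModule.Kinv, Matrix.mul_apply, Matrix.single_apply, Matrix.one_apply,
      Fintype.sum_prod_type] <;> norm_num [qpow_neg, ← h] <;> field_simp <;> ring

/-- The double braiding of a module with `ising`, in closed form. -/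
def blockD (A : QModule ι) : Matrix (ι × Fin 2) (ι × Fin 2) ℂ :=
  A.K ⊗ₖ unitMat 0 0 + (qbr 1 ^ 2 * qpow (-1)) • ((A.F * A.E) ⊗ₖ unitMat 0 0) +
    (qbr 1 * qpow (-1)) • (A.F ⊗ₖ unitMat 0 1) + qbr 1 • ((A.Kinv * A.E) ⊗ₖ unitMat 1 0) +
    A.Kinv ⊗ₖ unitMat 1 1

theorem tensor_K (A : QModule ι) (B : QModule κ) : (A.tensor B).K = A.K ⊗ₖ B.K := by
  ext ⟨a, b⟩ ⟨c, d⟩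
  simp only [QModule.K, QModule.tensor, Matrix.diagonal_apply, Matrix.kroneckerMap_apply, Prod.mk.injEq]
  split_ifs <;> simp_all [qpow_add]

theorem tensor_Kinv (A : QModule ι) (B : QModule κ) : (A.tensor B).Kinv = A.Kinv ⊗ₖ B.Kinv := by
  ext ⟨a, b⟩ ⟨c, d⟩
  simp only [QModule.Kinv, QModule.tensor, Matrix.diagonal_apply, Matrix.kroneckerMap_apply, Prod.mk.injEq]
  split_ifs <;> simp_all [neg_add_rev, qpow_add, mul_comm]

/-- `X ⊗ M` on `(W ⊗ S_1) ⊗ S_1`. -/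
def onLast (X : Matrix ι ι ℂ) (M : Matrix (Fin 2 × Fin 2) (Fin 2 × Fin 2) ℂ) :
    Matrix ((ι × Fin 2) × Fin 2) ((ι × Fin 2) × Fin 2) ℂ :=
  (X ⊗ₖ M).submatrix (Equiv.prodAssoc ι (Fin 2) (Fin 2)) (Equiv.prodAssoc ι (Fin 2) (Fin 2))

theorem onLast_mul (X Y : Matrix ι ι ℂ) (M N : Matrix (Fin 2 × Fin 2) (Fin 2 × Fin 2) ℂ) :
    onLast X M * onLast Y N = onLast (X * Y) (M * N) := by
  rw [onLast, onLast, onLast, Matrix.submatrix_mul_equiv, Matrix.mul_kronecker_mul]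

theorem onLast_add (X : Matrix ι ι ℂ) (M N : Matrix (Fin 2 × Fin 2) (Fin 2 × Fin 2) ℂ) :
    onLast X (M + N) = onLast X M + onLast X N := by
  ext; simp [onLast, mul_add]

theorem onLast_smul (X : Matrix ι ι ℂ) (c : ℂ) (M : Matrix (Fin 2 × Fin 2) (Fin 2 × Fin 2) ℂ) :
    onLast X (c • M) = c • onLast X M := by
  ext; simp [onLast]; ring

theorem kron_kron (X : Matrix ι ι ℂ) (M N : Matrix (Fin 2) (Fin 2) ℂ) :
    (X ⊗ₖ M) ⊗ₖ N = onLast X (M ⊗ₖ N) := by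
  ext ⟨⟨a, b⟩, c⟩ ⟨⟨a', b'⟩, c'⟩; simp [onLast, mul_assoc]

theorem kron_add (X Y : Matrix ι ι ℂ) (N : Matrix κ κ ℂ) : (X + Y) ⊗ₖ N = X ⊗ₖ N + Y ⊗ₖ N :=
  Matrix.add_kronecker ..

theorem kron_smul (c : ℂ) (X : Matrix ι ι ℂ) (N : Matrix κ κ ℂ) : (c • X) ⊗ₖ N = c • (X ⊗ₖ N) :=
  Matrix.smul_kronecker ..

theorem crossing_eq : crossing ι = onLast 1 (isingCross (qpow (1 / 2))) := by
  rw [crossing, ising_braiding, onLast]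

theorem hexagon (A : QModule ι) :
    crossing ι * (blockD A ⊗ₖ (1 : Matrix (Fin 2) (Fin 2) ℂ)) * crossing ι =
      blockD (A.tensor ising) := by
  have h0 := qpow_ne_zero (1 / 2)
  have h1 := qpow_half_sq
  have key : ∀ (X : Matrix ι ι ℂ) (M : Matrix (Fin 2) (Fin 2) ℂ),
      crossing ι * ((X ⊗ₖ M) ⊗ₖ (1 : Matrix (Fin 2) (Fin 2) ℂ)) * crossing ι =
        onLast X (isingCross (qpow (1 / 2)) * (M ⊗ₖ 1) * isingCross (qpow (1 / 2))) := by
    intro X M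
    rw [kron_kron, crossing_eq, onLast_mul, onLast_mul, one_mul, mul_one]
  have e1 : (A.tensor ising).F * (A.tensor ising).E =
      A.Kinv ⊗ₖ (ising.F * ising.E) + (A.Kinv * A.E) ⊗ₖ (ising.F * ising.K) + A.F ⊗ₖ ising.E +
        (A.F * A.E) ⊗ₖ ising.K := by
    simp only [QModule.tensor, mul_add, add_mul, ← Matrix.mul_kronecker_mul, mul_one, one_mul]
    abel
  have hKK : ising.Kinv * ising.K = 1 := by
    rw [QModule.Kinv, QModule.K, Matrix.diagonal_mul_diagonal, ← Matrix.diagonal_one]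
    congr 1; funext i; rw [← qpow_add, neg_add_cancel, qpow_zero]
  have e2 : (A.tensor ising).Kinv * (A.tensor ising).E =
      A.Kinv ⊗ₖ (ising.Kinv * ising.E) + (A.Kinv * A.E) ⊗ₖ 1 := by
    rw [tensor_Kinv]
    simp only [QModule.tensor, mul_add, ← Matrix.mul_kronecker_mul, mul_one, hKK]
  rw [blockD, blockD, e1, e2, tensor_K, tensor_Kinv]
  simp only [kron_add, kron_smul, mul_add, add_mul, Matrix.mul_smul, Matrix.smul_mul, key,
    hex_K h0 h1, hex_F h0 h1, hex_E h0 h1, hex_Kinv h0 h1, onLast_add, onLast_smul]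
  simp only [QModule.tensor, kron_add, kron_smul, kron_kron, smul_add, smul_smul]
  ring_nf
  abel

theorem isingE_eq : ising.E = unitMat 0 1 := by
  ext i j; fin_cases i <;> fin_cases j <;> simp [ising]

theorem isingF_eq : ising.F = unitMat 1 0 := by
  ext i j; fin_cases i <;> fin_cases j <;> simp [ising]

theorem isingK_eq : ising.K = qpow 1 • unitMat 0 0 + (qpow 1)⁻¹ • unitMat 1 1 := by
  ext i j; fin_cases i <;> fin_cases j <;> simp [ising, QModule.K] <;> norm_num [qpow_neg]

theorem isingKinv_eq : ising.Kinv = (qpow 1)⁻¹ • unitMat 0 0 + qpow 1 • unitMat 1 1 := by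
  ext i j; fin_cases i <;> fin_cases j <;> simp [ising, QModule.Kinv, qpow_neg] <;> norm_num

theorem isingH_eq : ising.H = unitMat 0 0 + (-1 : ℂ) • unitMat 1 1 := by
  ext i j; fin_cases i <;> fin_cases j <;> simp [ising, QModule.H] <;> norm_num

theorem one_eq : (1 : Matrix (Fin 2) (Fin 2) ℂ) = unitMat 0 0 + unitMat 1 1 := by
  ext i j; fin_cases i <;> fin_cases j <;> simp

theorem unit_mul (i j k l : Fin 2) :
    unitMat i j * unitMat k l = if j = k then unitMat i l else 0 := by
  split_ifs with h
  · subst h; simp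
  · simp [h]

/-- `E` raises the weight by `2` and `F` lowers it by `2`. -/
def IsGraded (A : QModule ι) : Prop :=
  (∀ i j, A.E i j ≠ 0 → A.wt i = A.wt j + 2) ∧ (∀ i j, A.F i j ≠ 0 → A.wt i = A.wt j - 2)

theorem diag_shift (w : ι → ℝ) (φ : ℝ → ℂ) (X : Matrix ι ι ℂ) (d : ℝ)
    (h : ∀ i j, X i j ≠ 0 → w i = w j + d) :
    Matrix.diagonal (fun i => φ (w i)) * X = X * Matrix.diagonal (fun i => φ (w i + d)) := by
  ext i j
  rw [Matrix.diagonal_mul, Matrix.mul_diagonal]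
  by_cases hX : X i j = 0
  · simp [hX]
  · rw [h i j hX]; ring

theorem diag_qpow_shift (w : ι → ℝ) (a d : ℝ) (X : Matrix ι ι ℂ)
    (h : ∀ i j, X i j ≠ 0 → w i = w j + d) :
    X * Matrix.diagonal (fun i => qpow (a * w i)) =
      qpow (-(a * d)) • (Matrix.diagonal (fun i => qpow (a * w i)) * X) := by
  ext i j
  rw [Matrix.smul_apply, Matrix.diagonal_mul, Matrix.mul_diagonal]
  by_cases hX : X i j = 0
  · simp [hX]
  · rw [h i j hX, smul_eq_mul, ← mul_assoc, ← qpow_add, mul_comm]; congr 2; ring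

theorem K_eq (A : QModule ι) : A.K = Matrix.diagonal (fun i => qpow (1 * A.wt i)) := by
  simp [QModule.K]
theorem Kinv_eq (A : QModule ι) : A.Kinv = Matrix.diagonal (fun i => qpow (-1 * A.wt i)) := by
  simp [QModule.Kinv]

variable {A : QModule ι}

theorem E_K (h : IsGraded A) : A.E * A.K = (qpow 1)⁻¹ ^ 2 • (A.K * A.E) := by
  rw [K_eq, diag_qpow_shift _ 1 2 _ h.1, ← qpow_neg, ← qpow_nat_mul]; norm_num

theorem E_Kinv (h : IsGraded A) : A.E * A.Kinv = qpow 1 ^ 2 • (A.Kinv * A.E) := by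
  rw [Kinv_eq, diag_qpow_shift _ (-1) 2 _ h.1, ← qpow_nat_mul]; norm_num

theorem F_K (h : IsGraded A) : A.F * A.K = qpow 1 ^ 2 • (A.K * A.F) := by
  rw [K_eq, diag_qpow_shift _ 1 (-2) _ (by simpa [sub_eq_add_neg] using h.2), ← qpow_nat_mul]
  norm_num

theorem F_Kinv (h : IsGraded A) : A.F * A.Kinv = (qpow 1)⁻¹ ^ 2 • (A.Kinv * A.F) := by
  rw [Kinv_eq, diag_qpow_shift _ (-1) (-2) _ (by simpa [sub_eq_add_neg] using h.2), ← qpow_neg,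
    ← qpow_nat_mul]
  norm_num

theorem K_Kinv (A : QModule ι) : A.K * A.Kinv = 1 := by
  rw [QModule.Kinv, QModule.K, Matrix.diagonal_mul_diagonal, ← Matrix.diagonal_one]
  congr 1; funext i; rw [← qpow_add, add_neg_cancel, qpow_zero]

theorem Kinv_K (A : QModule ι) : A.Kinv * A.K = 1 := mul_eq_one_comm.mp (K_Kinv A)

theorem H_E (h : IsGraded A) : A.H * A.E = A.E * A.H + (2 : ℂ) • A.E := by
  ext i j
  simp only [QModule.H, Matrix.diagonal_mul, Matrix.mul_diagonal, Matrix.add_apply, Matrix.smul_apply, smul_eq_mul]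
  by_cases hX : A.E i j = 0
  · simp [hX]
  · rw [h.1 i j hX]; push_cast; ring

theorem H_F (h : IsGraded A) : A.H * A.F = A.F * A.H - (2 : ℂ) • A.F := by
  ext i j
  simp only [QModule.H, Matrix.diagonal_mul, Matrix.mul_diagonal, Matrix.sub_apply, Matrix.smul_apply, smul_eq_mul]
  by_cases hX : A.F i j = 0
  · simp [hX]
  · rw [h.2 i j hX]; push_cast; ring

theorem H_K (A : QModule ι) : A.H * A.K = A.K * A.H := by
  simp [QModule.H, QModule.K, mul_comm]
theorem H_Kinv (A : QModule ι) : A.H * A.Kinv = A.Kinv * A.H := by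
  simp [QModule.H, QModule.Kinv, mul_comm]

theorem isGraded_tensor {A : QModule ι} {B : QModule κ} (hA : IsGraded A) (hB : IsGraded B) :
    IsGraded (A.tensor B) := by
  constructor
  · rintro ⟨i, k⟩ ⟨j, l⟩ h
    simp only [QModule.tensor, QModule.K, Matrix.add_apply, Matrix.kroneckerMap_apply,
      Matrix.one_apply, Matrix.diagonal_apply] at h ⊢
    by_cases h1 : i = j
    · subst h1
      by_cases h2 : B.E k l = 0
      · by_cases h3 : k = l
        · subst h3
          have : A.E i i ≠ 0 := by intro h4; simp [h2, h4] at h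
          linarith [hA.1 _ _ this]
        · simp [h2, h3] at h
      · linarith [hB.1 _ _ h2]
    · by_cases h3 : k = l
      · subst h3
        have : A.E i j ≠ 0 := by intro h4; simp [h1, h4] at h
        linarith [hA.1 _ _ this]
      · simp [h1, h3] at h
  · rintro ⟨i, k⟩ ⟨j, l⟩ h
    simp only [QModule.tensor, QModule.Kinv, Matrix.add_apply, Matrix.kroneckerMap_apply,
      Matrix.one_apply, Matrix.diagonal_apply] at h ⊢
    by_cases h1 : k = l
    · subst h1
      by_cases h2 : A.F i j = 0
      · by_cases h3 : i = j
        · subst h3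
          have : B.F k k ≠ 0 := by intro h4; simp [h2, h4] at h
          linarith [hB.2 _ _ this]
        · simp [h2, h3] at h
      · linarith [hA.2 _ _ h2]
    · by_cases h3 : i = j
      · subst h3
        have : B.F k l ≠ 0 := by intro h4; simp [h1, h4] at h
        linarith [hB.2 _ _ this]
      · simp [h1, h3] at h

theorem isGraded_typical (β : ℝ) : IsGraded (typical β) := by
  constructor
  · intro i j h
    by_cases hij : (j : ℕ) = i + 1
    · simp only [typical, hij]; push_cast; ring
    · simp [typical, hij] at h
  · intro i j h
    by_cases hij : (i : ℕ) = j + 1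
    · simp only [typical, hij]; push_cast; ring
    · simp [typical, hij] at h

/-- The relation `E F - F E = (K - K⁻¹) / (q - q⁻¹)`. -/
def HasComm (A : QModule ι) : Prop :=
  A.E * A.F = A.F * A.E + (qbr 1)⁻¹ • (A.K - A.Kinv)

theorem kron_sub (X Y : Matrix ι ι ℂ) (N : Matrix κ κ ℂ) : (X - Y) ⊗ₖ N = X ⊗ₖ N - Y ⊗ₖ N := by
  ext; simp [sub_mul]

theorem blockD_comm_E (h : IsGraded A) (hc : HasComm A) :
    blockD A * (A.tensor ising).E = (A.tensor ising).E * blockD A := by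
  have hq := qpow_ne_zero 1
  have ht := qbr_one_ne_zero
  have hqt : qbr 1 = qpow 1 - (qpow 1)⁻¹ := by rw [qbr, qpow_neg]
  have e1 : A.E * (A.F * A.E) = A.F * (A.E * A.E) + (qbr 1)⁻¹ • (A.K * A.E - A.Kinv * A.E) := by
    rw [← mul_assoc, hc, add_mul, mul_assoc, Matrix.smul_mul, sub_mul]
  have e2 : A.E * (A.Kinv * A.E) = qpow 1 ^ 2 • (A.Kinv * (A.E * A.E)) := by
    rw [← mul_assoc, E_Kinv h, Matrix.smul_mul, mul_assoc]
  have e3 : A.E * A.F = A.F * A.E + (qbr 1)⁻¹ • (A.K - A.Kinv) := hc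
  simp only [blockD, QModule.tensor, isingE_eq, isingK_eq, mul_add, add_mul, Matrix.mul_smul, Matrix.smul_mul,
    ← Matrix.mul_kronecker_mul, Matrix.kronecker_add, Matrix.kronecker_smul, unit_mul, mul_assoc,
    mul_one, one_mul, smul_add, E_K h, E_Kinv h, e1, e2, e3, kron_add, kron_sub,
    kron_smul, smul_smul, smul_sub]
  simp only [reduceIte, one_ne_zero, zero_ne_one, Matrix.kronecker_zero, smul_zero, add_zero, zero_add,
    qpow_neg]
  match_scalars
  all_goals first | (field_simp; done) | (field_simp; ring1) | (field_simp; rw [hqt]; ring1) |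
    (field_simp; rw [hqt]; field_simp; done) | (field_simp; rw [hqt]; field_simp; ring1)

theorem blockD_comm_F (h : IsGraded A) (hc : HasComm A) :
    blockD A * (A.tensor ising).F = (A.tensor ising).F * blockD A := by
  have hq := qpow_ne_zero 1
  have ht := qbr_one_ne_zero
  have hqt : qbr 1 = qpow 1 - (qpow 1)⁻¹ := by rw [qbr, qpow_neg]
  have e3 : A.E * A.F = A.F * A.E + (qbr 1)⁻¹ • (A.K - A.Kinv) := hc
  have e4 : A.E * A.Kinv = qpow 1 ^ 2 • (A.Kinv * A.E) := E_Kinv h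
  have e5 : A.F * (A.Kinv * A.E) = (qpow 1)⁻¹ ^ 2 • (A.Kinv * (A.F * A.E)) := by
    rw [← mul_assoc, F_Kinv h, Matrix.smul_mul, mul_assoc]
  simp only [blockD, QModule.tensor, isingF_eq, mul_add, add_mul, Matrix.mul_smul, Matrix.smul_mul,
    ← Matrix.mul_kronecker_mul, Matrix.kronecker_add, Matrix.kronecker_smul, unit_mul, mul_assoc,
    mul_one, one_mul, smul_add, F_K h, F_Kinv h, e3, e4, e5, kron_add, kron_sub, mul_sub, K_Kinv, Kinv_K,
    kron_smul, smul_smul, smul_sub]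
  simp only [reduceIte, one_ne_zero, zero_ne_one, Matrix.kronecker_zero, smul_zero, add_zero, zero_add,
    qpow_neg]
  match_scalars
  all_goals first | (field_simp; done) | (field_simp; ring1) | (field_simp; rw [hqt]; ring1) |
    (field_simp; rw [hqt]; field_simp; done) | (field_simp; rw [hqt]; field_simp; ring1)

theorem tensor_H (A : QModule ι) (B : QModule κ) :
    (A.tensor B).H = A.H ⊗ₖ (1 : Matrix κ κ ℂ) + (1 : Matrix ι ι ℂ) ⊗ₖ B.H := by
  ext ⟨a, b⟩ ⟨c, d⟩
  by_cases h1 : a = c <;> by_cases h2 : b = d <;>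
    simp [QModule.H, QModule.tensor, Matrix.diagonal_apply, h1, h2]

theorem blockD_comm_H (h : IsGraded A) :
    blockD A * (A.tensor ising).H = (A.tensor ising).H * blockD A := by
  have e1 : A.H * (A.F * A.E) = A.F * (A.E * A.H) := by
    rw [← mul_assoc, H_F h, sub_mul, mul_assoc, H_E h, mul_add, Matrix.smul_mul, Matrix.mul_smul]
    abel
  have e2 : A.H * (A.Kinv * A.E) = A.Kinv * (A.E * A.H) + (2 : ℂ) • (A.Kinv * A.E) := by
    rw [← mul_assoc, H_Kinv, mul_assoc, H_E h, mul_add, Matrix.mul_smul]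
  have e3 : A.H * A.F = A.F * A.H + (-2 : ℂ) • A.F := by rw [H_F h]; module
  rw [tensor_H]
  simp only [blockD, isingH_eq, one_eq, mul_add, add_mul, Matrix.mul_smul,
    Matrix.smul_mul, ← Matrix.mul_kronecker_mul, Matrix.kronecker_add,
    Matrix.kronecker_smul, unit_mul, mul_assoc, mul_one, one_mul, smul_add, e1, e2, e3, H_K,
    H_Kinv, kron_add, kron_smul, smul_smul]
  simp only [reduceIte, one_ne_zero, zero_ne_one, Matrix.kronecker_zero, smul_zero, add_zero, zero_add]
  module


theorem qpow_neg_one : qpow (-1) = -qpow 1 ^ 3 := by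
  have h := qpow_one_pow_four
  rw [qpow_neg, inv_eq_iff_eq_inv, eq_comm, inv_eq_of_mul_eq_one_right]
  linear_combination -h

theorem qbr_one_inv : (qbr 1)⁻¹ = -(qpow 1 + qpow 1 ^ 3) / 2 := by
  have h := qpow_one_pow_four
  apply inv_eq_of_mul_eq_one_right
  rw [qbr, qpow_neg_one]
  linear_combination (-1 - qpow 1 ^ 2 / 2) * h

theorem qint_eq (x : ℝ) : qint x = (qpow x - qpow (-x)) * (-(qpow 1 + qpow 1 ^ 3) / 2) := by
  rw [qint, div_eq_mul_inv, qbr_one_inv, qbr]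

theorem hasComm_typical (β : ℝ) : HasComm (typical β) := by
  have h4 := qpow_one_pow_four
  have n1 := qpow_neg_one
  have n2 : qpow 2 = qpow 1 ^ 2 := by rw [← qpow_nat_mul]; norm_num
  have n3 : qpow 3 = qpow 1 ^ 3 := by rw [← qpow_nat_mul]; norm_num
  have m2 : qpow (-2) = (-qpow 1 ^ 3) ^ 2 := by rw [← n1, ← qpow_nat_mul]; norm_num
  have m3 : qpow (-3) = (-qpow 1 ^ 3) ^ 3 := by rw [← n1, ← qpow_nat_mul]; norm_num
  rw [HasComm]
  ext i j
  fin_cases i <;> fin_cases j <;>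
    simp [typical, QModule.K, QModule.Kinv, Matrix.mul_apply, Fin.sum_univ_four, Matrix.smul_apply]
  ·
    simp only [qint_eq, neg_add, neg_neg, sub_eq_add_neg, qpow_add, n1, n2, n3, m2, m3, qbr_one_inv]
    grind
  · rw [show β + 3 - 2 = β + 1 by ring, show 2 - (β + 3) = -β + -1 by ring]
    simp only [qint_eq, neg_add, neg_neg, sub_eq_add_neg, qpow_add, n1, n2, n3, m2, m3, qbr_one_inv]
    grind
  · rw [show β + 3 - 2 * 2 = β + -1 by ring, show 2 * 2 - (β + 3) = -β + 1 by ring]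
    simp only [qint_eq, neg_add, neg_neg, sub_eq_add_neg, qpow_add, n1, n2, n3, m2, m3, qbr_one_inv]
    grind
  · rw [show β + 3 - 2 * 3 = β + -3 by ring, show 2 * 3 - (β + 3) = -β + 3 by ring]
    simp only [qint_eq, neg_add, neg_neg, sub_eq_add_neg, qpow_add, n1, n2, n3, m2, m3, qbr_one_inv]
    grind

theorem swap_isingR (A : QModule ι) :
    (ising.rMatrix A).submatrix Prod.swap Prod.swap =
      Matrix.diagonal (fun x : ι × Fin 2 => qpow (A.wt x.1 * ising.wt x.2 / 2)) *
        (1 + qbr 1 • (A.F ⊗ₖ ising.E)) := by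
  rw [rMatrix_of_nil _ _ (Or.inl ising_E_sq)]
  ext ⟨a, b⟩ ⟨c, d⟩
  simp only [Matrix.submatrix_apply, Matrix.diagonal_mul, Prod.swap, Matrix.add_apply,
    Matrix.smul_apply, Matrix.kroneckerMap_apply, Matrix.one_apply, Prod.mk.injEq, and_comm]
  rw [mul_comm (ising.wt b), mul_comm (ising.E b d)]

theorem doubleBraiding_eq (A : QModule ι) :
    ising.braiding A * A.braiding ising =
      (Matrix.diagonal (fun x : ι × Fin 2 => qpow (A.wt x.1 * ising.wt x.2 / 2)) *
        (1 + qbr 1 • (A.F ⊗ₖ ising.E))) *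
      (Matrix.diagonal (fun x : ι × Fin 2 => qpow (A.wt x.1 * ising.wt x.2 / 2)) *
        (1 + qbr 1 • (A.E ⊗ₖ ising.F))) := by
  rw [← swap_isingR, ← rMatrix_of_nil _ _ (Or.inr ising_F_sq)]
  have := Matrix.submatrix_mul_equiv ((ising.rMatrix A).submatrix Prod.swap Prod.swap)
    (A.rMatrix ising) id (Equiv.prodComm (Fin 2) ι) id
  simpa [QModule.braiding] using this

theorem isUnit_one_add {N : Matrix ι ι ℂ} (h : N * N = 0) : IsUnit (1 + N) := by
  refine ⟨⟨1 + N, 1 - N, ?_, ?_⟩, rfl⟩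
  · rw [add_mul, mul_sub, mul_sub, h]; simp
  · rw [sub_mul, mul_add, mul_add, h]; simp

theorem isUnit_diagonal_qpow (f : ι → ℝ) : IsUnit (Matrix.diagonal fun i => qpow (f i)) := by
  refine ⟨⟨Matrix.diagonal fun i => qpow (f i), Matrix.diagonal fun i => qpow (-f i), ?_, ?_⟩,
    rfl⟩ <;>
  · rw [Matrix.diagonal_mul_diagonal, ← Matrix.diagonal_one]
    congr 1; funext i; rw [← qpow_add]; simp [qpow_zero]

theorem isUnit_doubleBraiding (A : QModule ι) :
    IsUnit (ising.braiding A * A.braiding ising) := by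
  rw [doubleBraiding_eq]
  refine ((isUnit_diagonal_qpow _).mul (isUnit_one_add ?_)).mul
    ((isUnit_diagonal_qpow _).mul (isUnit_one_add ?_)) <;>
  simp [← Matrix.mul_kronecker_mul, ising_E_sq, ising_F_sq]

theorem doubleBraiding_eq_blockD (h : IsGraded A) :
    ising.braiding A * A.braiding ising = blockD A := by
  set P : Matrix ι ι ℂ := Matrix.diagonal fun i => qpow (1 / 2 * A.wt i) with hP
  set M : Matrix ι ι ℂ := Matrix.diagonal fun i => qpow (-1 / 2 * A.wt i) with hM
  have hD : Matrix.diagonal (fun x : ι × Fin 2 => qpow (A.wt x.1 * ising.wt x.2 / 2)) =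
      P ⊗ₖ unitMat 0 0 + M ⊗ₖ unitMat 1 1 := by
    ext ⟨a, b⟩ ⟨c, d⟩
    by_cases h1 : a = c
    · subst h1
      fin_cases b <;> fin_cases d <;> simp [hP, hM, ising] <;> ring_nf
    · fin_cases b <;> fin_cases d <;> simp [hP, hM, ising, h1]
  have hPP : P * P = A.K := by
    rw [hP, Matrix.diagonal_mul_diagonal, QModule.K]; congr 1; funext i; rw [← qpow_add]; ring_nf
  have hMM : M * M = A.Kinv := by
    rw [hM, Matrix.diagonal_mul_diagonal, QModule.Kinv]; congr 1; funext i; rw [← qpow_add]; ring_nf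
  have hPM : P * M = 1 := by
    rw [hP, hM, Matrix.diagonal_mul_diagonal, ← Matrix.diagonal_one]; congr 1; funext i
    rw [← qpow_add, ← qpow_zero]; ring_nf
  have hFM : P * (A.F * M) = qpow (-1) • A.F := by
    rw [diag_qpow_shift _ _ (-2) _ (by simpa [sub_eq_add_neg] using h.2), Matrix.mul_smul, ← mul_assoc, hPM, one_mul]
    norm_num
  have hFM' : P * (A.F * (M * A.E)) = qpow (-1) • (A.F * A.E) := by
    rw [← Matrix.smul_mul, ← hFM]; simp only [mul_assoc]
  have hMM' : M * (M * A.E) = A.Kinv * A.E := by rw [← mul_assoc, hMM]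
  rw [doubleBraiding_eq, hD, blockD]
  simp only [isingE_eq, isingF_eq, mul_add, add_mul, Matrix.mul_smul, Matrix.smul_mul, mul_one,
    ← Matrix.mul_kronecker_mul, unit_mul, mul_assoc, smul_add, hPP, hMM, hPM, hFM, hFM', hMM']
  simp only [reduceIte, one_ne_zero, zero_ne_one, Matrix.kronecker_zero, smul_zero, add_zero, zero_add,
    kron_smul, smul_smul, unit_mul, zero_mul, mul_zero]
  module

theorem poleBraid_eq (α : ℝ) : poleBraid α = blockD (typical α) :=
  doubleBraiding_eq_blockD (isGraded_typical α)

/-- Endomorphisms of a module. -/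
abbrev IsEndo (A : QModule ι) (f : Matrix ι ι ℂ) : Prop := IsHom A A f

theorem comm_diagonal {f : Matrix ι ι ℂ} (h : IsEndo A f) (φ : ℝ → ℂ) :
    f * Matrix.diagonal (fun i => φ (A.wt i)) = Matrix.diagonal (fun i => φ (A.wt i)) * f := by
  have h3 := h.2.2
  ext i j
  have h4 := congrFun (congrFun h3 i) j
  simp only [QModule.H, Matrix.mul_diagonal, Matrix.diagonal_mul] at h4 ⊢
  by_cases hf : f i j = 0
  · simp [hf]
  · rw [mul_comm] at h4
    have h5 : (A.wt j : ℂ) = A.wt i := mul_right_cancel₀ hf h4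
    rw [Complex.ofReal_inj.mp h5, mul_comm]

theorem comm_K {f : Matrix ι ι ℂ} (h : IsEndo A f) : f * A.K = A.K * f := comm_diagonal h qpow
theorem comm_Kinv {f : Matrix ι ι ℂ} (h : IsEndo A f) : f * A.Kinv = A.Kinv * f :=
  comm_diagonal h fun x => qpow (-x)

theorem IsHom.mul {f g : Matrix ι ι ℂ} (hf : IsEndo A f) (hg : IsEndo A g) : IsEndo A (f * g) :=
  ⟨by rw [mul_assoc, hg.1, ← mul_assoc, hf.1, mul_assoc],
   by rw [mul_assoc, hg.2.1, ← mul_assoc, hf.2.1, mul_assoc],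
   by rw [mul_assoc, hg.2.2, ← mul_assoc, hf.2.2, mul_assoc]⟩

theorem isHom_one : IsEndo A (1 : Matrix ι ι ℂ) := by simp [IsEndo, IsHom]

theorem isHom_kron_one (B : QModule κ) {f : Matrix ι ι ℂ} (h : IsEndo A f) :
    IsEndo (A.tensor B) (f ⊗ₖ (1 : Matrix κ κ ℂ)) := by
  refine ⟨?_, ?_, ?_⟩
  · simp only [QModule.tensor, mul_add, add_mul, ← Matrix.mul_kronecker_mul, mul_one, one_mul, h.1]
  · simp only [QModule.tensor, mul_add, add_mul, ← Matrix.mul_kronecker_mul, mul_one, one_mul, h.2.1,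
      comm_Kinv h]
  · simp only [tensor_H, mul_add, add_mul, ← Matrix.mul_kronecker_mul, mul_one, one_mul, h.2.2]

theorem kron_one_comm_blockD {f : Matrix ι ι ℂ} (h : IsEndo A f) :
    (f ⊗ₖ (1 : Matrix (Fin 2) (Fin 2) ℂ)) * blockD A =
      blockD A * (f ⊗ₖ (1 : Matrix (Fin 2) (Fin 2) ℂ)) := by
  have h1 : f * (A.F * A.E) = A.F * (A.E * f) := by rw [← mul_assoc, h.2.1, mul_assoc, h.1]
  have h2 : f * (A.Kinv * A.E) = A.Kinv * (A.E * f) := by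
    rw [← mul_assoc, comm_Kinv h, mul_assoc, h.1]
  simp only [blockD, mul_add, add_mul, Matrix.mul_smul, Matrix.smul_mul, ← Matrix.mul_kronecker_mul,
    mul_one, one_mul, mul_assoc, h.2.1, comm_K h, comm_Kinv h, h1, h2]

theorem isHom_poleBraid (α : ℝ) : IsEndo ((typical α).tensor ising) (poleBraid α) := by
  rw [poleBraid_eq]
  exact ⟨blockD_comm_E (isGraded_typical α) (hasComm_typical α),
    blockD_comm_F (isGraded_typical α) (hasComm_typical α), blockD_comm_H (isGraded_typical α)⟩

theorem isUnit_poleBraid (α : ℝ) : IsUnit (poleBraid α) := isUnit_doubleBraiding _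

theorem isUnit_crossing : IsUnit (crossing ι) := by
  have h0 := qpow_ne_zero (1 / 2)
  have h1 : onLast (1 : Matrix ι ι ℂ) 1 = 1 := by simp [onLast]
  rw [crossing_eq]
  refine ⟨⟨onLast 1 (isingCross (qpow (1 / 2))), onLast 1 (isingCrossInv (qpow (1 / 2))), ?_, ?_⟩, rfl⟩
  · rw [onLast_mul, isingCross_mul_inv h0, one_mul, h1]
  · rw [onLast_mul, isingCross_inv_mul h0, one_mul, h1]

theorem kron_onLast_H (A : QModule ι) : ((A.tensor ising).tensor ising).H =
    onLast A.H 1 + onLast 1 (ising.tensor ising).H := by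
  rw [tensor_H, tensor_H, tensor_H, onLast_add, kron_add, kron_kron, kron_kron,
    ← Matrix.one_kronecker_one (m := ι) (n := Fin 2), kron_kron, Matrix.one_kronecker_one]
  abel

theorem isHom_crossing (A : QModule ι) :
    IsEndo ((A.tensor ising).tensor ising) (crossing ι) := by
  have h0 := qpow_ne_zero (1 / 2)
  have h1 := qpow_half_sq
  have hone : (1 : Matrix (ι × Fin 2) (ι × Fin 2) ℂ) = 1 ⊗ₖ 1 := by simp
  refine ⟨?_, ?_, ?_⟩
  · have : ((A.tensor ising).tensor ising).E =
        onLast 1 (ising.tensor ising).E + onLast A.E (ising.K ⊗ₖ ising.K) := by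
      simp only [QModule.tensor]
      rw [hone, kron_kron, kron_add, kron_kron, kron_kron, onLast_add]
      abel
    rw [this, crossing_eq]
    simp only [mul_add, add_mul, onLast_mul, one_mul, mul_one, isingCross_comm_E h0 h1,
      isingCross_comm_K]
  · have : ((A.tensor ising).tensor ising).F =
        onLast A.Kinv (ising.tensor ising).F + onLast A.F 1 := by
      rw [← Matrix.one_kronecker_one]
      conv_lhs => rw [QModule.tensor]
      simp only [tensor_Kinv]
      simp only [QModule.tensor]
      rw [kron_kron, kron_add, kron_kron, kron_kron, onLast_add]
      abel
    rw [this, crossing_eq]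
    simp only [mul_add, add_mul, onLast_mul, one_mul, mul_one, isingCross_comm_F h0 h1]
  · rw [kron_onLast_H, crossing_eq]
    simp only [mul_add, add_mul, onLast_mul, one_mul, mul_one, isingCross_comm_H]

theorem crossing_comm (X : Matrix ι ι ℂ) :
    crossing ι * ((X ⊗ₖ (1 : Matrix (Fin 2) (Fin 2) ℂ)) ⊗ₖ (1 : Matrix (Fin 2) (Fin 2) ℂ)) =
      ((X ⊗ₖ (1 : Matrix (Fin 2) (Fin 2) ℂ)) ⊗ₖ (1 : Matrix (Fin 2) (Fin 2) ℂ)) * crossing ι := by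
  rw [kron_kron, crossing_eq, onLast_mul, onLast_mul]; simp

theorem crossing_typeB (α : ℝ) :
    (poleBraid α ⊗ₖ (1 : Matrix (Fin 2) (Fin 2) ℂ)) * crossing (Fin 4) *
      (poleBraid α ⊗ₖ (1 : Matrix (Fin 2) (Fin 2) ℂ)) * crossing (Fin 4) =
    crossing (Fin 4) * (poleBraid α ⊗ₖ (1 : Matrix (Fin 2) (Fin 2) ℂ)) * crossing (Fin 4) *
      (poleBraid α ⊗ₖ (1 : Matrix (Fin 2) (Fin 2) ℂ)) := by
  have h := hexagon (typical α)
  rw [← poleBraid_eq] at h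
  rw [h, ← kron_one_comm_blockD (isHom_poleBraid α), ← h]
  simp only [mul_assoc]

theorem crossing_yangBaxter :
    (crossing ι ⊗ₖ (1 : Matrix (Fin 2) (Fin 2) ℂ)) * crossing (ι × Fin 2) *
      (crossing ι ⊗ₖ (1 : Matrix (Fin 2) (Fin 2) ℂ)) =
    crossing (ι × Fin 2) * (crossing ι ⊗ₖ (1 : Matrix (Fin 2) (Fin 2) ℂ)) * crossing (ι × Fin 2) := by
  have h0 := qpow_ne_zero (1 / 2)
  let e : ((ι × Fin 2) × Fin 2) × Fin 2 ≃ ι × (Fin 2 × Fin 2 × Fin 2) :=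
    ⟨fun x => (x.1.1.1, x.1.1.2, x.1.2, x.2), fun x => (((x.1, x.2.1), x.2.2.1), x.2.2.2),
      fun _ => rfl, fun _ => rfl⟩
  set M := isingCross (qpow (1 / 2)) with hM
  have e1 : crossing ι ⊗ₖ (1 : Matrix (Fin 2) (Fin 2) ℂ) =
      ((1 : Matrix ι ι ℂ) ⊗ₖ ((M ⊗ₖ (1 : Matrix (Fin 2) (Fin 2) ℂ)).submatrix
      (Equiv.prodAssoc _ _ _).symm (Equiv.prodAssoc _ _ _).symm)).submatrix e e := by
    rw [crossing_eq]
    ext ⟨⟨⟨a, b⟩, c⟩, d⟩ ⟨⟨⟨a', b'⟩, c'⟩, d'⟩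
    simp [onLast, e, mul_assoc, hM]
  have e2 : crossing (ι × Fin 2) =
      ((1 : Matrix ι ι ℂ) ⊗ₖ ((1 : Matrix (Fin 2) (Fin 2) ℂ) ⊗ₖ M)).submatrix e e := by
    rw [crossing_eq]
    ext ⟨⟨⟨a, b⟩, c⟩, d⟩ ⟨⟨⟨a', b'⟩, c'⟩, d'⟩
    simp only [onLast, e, hM, Matrix.submatrix_apply, Matrix.kroneckerMap_apply, Matrix.one_apply,
      Equiv.prodAssoc_apply, Prod.mk.injEq, Equiv.coe_fn_mk]
    by_cases h1 : a = a' <;> by_cases h2 : b = b' <;> simp [h1, h2]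
  rw [e1, e2]
  simp only [Matrix.submatrix_mul_equiv, ← Matrix.mul_kronecker_mul, isingCross_yangBaxter h0, hM]

theorem isHom_braidMatrix (α : ℝ) : (m i : ℕ) → IsEndo (tensorPower α m) (braidMatrix α m i)
  | 0, _ => isHom_one
  | 1, _ => isHom_poleBraid α
  | m + 2, i => by
    rw [braidMatrix]
    split_ifs with h
    · exact isHom_crossing (tensorPower α m)
    · exact isHom_kron_one ising (isHom_braidMatrix α (m + 1) i)

theorem isUnit_kron_one {X : Matrix ι ι ℂ} (h : IsUnit X) :
    IsUnit (X ⊗ₖ (1 : Matrix κ κ ℂ)) := by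
  obtain ⟨⟨u, v, h1, h2⟩, rfl⟩ := h
  exact ⟨⟨u ⊗ₖ 1, v ⊗ₖ 1, by simp [← Matrix.mul_kronecker_mul, h1],
    by simp [← Matrix.mul_kronecker_mul, h2]⟩, rfl⟩

theorem isUnit_braidMatrix (α : ℝ) : (m i : ℕ) → IsUnit (braidMatrix α m i)
  | 0, _ => isUnit_one
  | 1, _ => isUnit_poleBraid α
  | m + 2, i => by
    rw [braidMatrix]
    split_ifs with h
    · exact isUnit_crossing
    · exact isUnit_kron_one (isUnit_braidMatrix α (m + 1) i)

theorem braidMatrix_top (α : ℝ) (m : ℕ) : braidMatrix α (m + 2) (m + 1) = crossing (Idx m) := by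
  rw [braidMatrix, if_pos rfl]

theorem braidMatrix_lower (α : ℝ) (m : ℕ) {i : ℕ} (h : i ≠ m + 1) :
    braidMatrix α (m + 2) i = braidMatrix α (m + 1) i ⊗ₖ (1 : Matrix (Fin 2) (Fin 2) ℂ) := by
  rw [braidMatrix, if_neg h]

theorem braidMatrix_comm (α : ℝ) : (m i j : ℕ) → j < m → i + 2 ≤ j →
    braidMatrix α m i * braidMatrix α m j = braidMatrix α m j * braidMatrix α m i
  | 0, _, _, h, _ => by omega
  | 1, _, _, h, h' => by omega
  | m + 2, i, j, h, h' => by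
    by_cases hj : j = m + 1
    · obtain ⟨k, rfl⟩ : ∃ k, m = k + 1 := ⟨m - 1, by omega⟩
      subst hj
      rw [braidMatrix_top, braidMatrix_lower α (k + 1) (by omega), braidMatrix_lower α k (by omega)]
      exact (crossing_comm (ι := Idx (k + 1)) _).symm
    · rw [braidMatrix_lower α m hj, braidMatrix_lower α m (by omega), ← Matrix.mul_kronecker_mul,
        ← Matrix.mul_kronecker_mul, braidMatrix_comm α (m + 1) i j (by omega) h']

theorem braidMatrix_braid (α : ℝ) : (m i : ℕ) → 1 ≤ i → i + 1 < m →
    braidMatrix α m i * braidMatrix α m (i + 1) * braidMatrix α m i =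
      braidMatrix α m (i + 1) * braidMatrix α m i * braidMatrix α m (i + 1)
  | 0, _, _, h => by omega
  | 1, _, _, h => by omega
  | m + 2, i, h, h' => by
    by_cases hi : i = m
    · obtain ⟨k, rfl⟩ : ∃ k, m = k + 1 := ⟨m - 1, by omega⟩
      subst hi
      rw [braidMatrix_top, braidMatrix_lower α (k + 1) (by omega), braidMatrix_top]
      exact crossing_yangBaxter (ι := Idx k)
    · rw [braidMatrix_lower α m (by omega), braidMatrix_lower α m (by omega)]
      simp only [← Matrix.mul_kronecker_mul]
      rw [braidMatrix_braid α (m + 1) i h (by omega)]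

theorem braidMatrix_typeB (α : ℝ) : (m : ℕ) → 2 ≤ m →
    braidMatrix α m 0 * braidMatrix α m 1 * braidMatrix α m 0 * braidMatrix α m 1 =
      braidMatrix α m 1 * braidMatrix α m 0 * braidMatrix α m 1 * braidMatrix α m 0
  | 0, h => by omega
  | 1, h => by omega
  | 2, _ => by
    rw [braidMatrix_top, braidMatrix_lower α 0 (by omega)]
    exact crossing_typeB α
  | m + 3, _ => by
    rw [braidMatrix_lower α (m + 1) (by omega), braidMatrix_lower α (m + 1) (by omega)]
    simp only [← Matrix.mul_kronecker_mul]
    rw [braidMatrix_typeB α (m + 2) (by omega)]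

/-- The relations of the affine braid group on the generators `0, …, m - 1`: distant generators
commute, `i` and `i + 1` satisfy the braid relation for `i ≥ 1`, and `0 1 0 1 = 1 0 1 0`. -/
def affineBraidRels (m : ℕ) : Set (FreeGroup (Fin m)) :=
  {r | ∃ i j : Fin m, (i : ℕ) + 2 ≤ j ∧
      r = (FreeGroup.of i * FreeGroup.of j) * (FreeGroup.of j * FreeGroup.of i)⁻¹} ∪
  {r | ∃ i j : Fin m, 1 ≤ (i : ℕ) ∧ (j : ℕ) = i + 1 ∧
      r = (FreeGroup.of i * FreeGroup.of j * FreeGroup.of i) *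
        (FreeGroup.of j * FreeGroup.of i * FreeGroup.of j)⁻¹} ∪
  {r | ∃ i j : Fin m, (i : ℕ) = 0 ∧ (j : ℕ) = 1 ∧
      r = (FreeGroup.of i * FreeGroup.of j * FreeGroup.of i * FreeGroup.of j) *
        (FreeGroup.of j * FreeGroup.of i * FreeGroup.of j * FreeGroup.of i)⁻¹}

/-- The affine braid group on `m` strands (braids that may also wind around a fixed pole), through
its standard presentation: generator `0` winds the first strand around the pole, and generator
`i ≥ 1` is the elementary braid of the strands `i` and `i + 1`. In terms of braids on `m + 1`
strands these are `b_1 ^ 2` and `b_(i + 1)`. -/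
abbrev AffineBraidGroup (m : ℕ) : Type := PresentedGroup (affineBraidRels m)

/-- `braidMatrix` as an invertible matrix. -/
def braidUnit (α : ℝ) (m i : ℕ) : (Matrix (Idx m) (Idx m) ℂ)ˣ := (isUnit_braidMatrix α m i).unit

theorem braidUnit_val (α : ℝ) (m i : ℕ) : (braidUnit α m i : Matrix (Idx m) (Idx m) ℂ) =
    braidMatrix α m i := rfl

theorem braidUnit_rels (α : ℝ) (m : ℕ) : ∀ r ∈ affineBraidRels m,
    FreeGroup.lift (fun i : Fin m => braidUnit α m i) r = 1 := by
  rintro r ((⟨i, j, h, rfl⟩ | ⟨i, j, h, h', rfl⟩) | ⟨i, j, h, h', rfl⟩)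
  · rw [map_mul, map_inv, mul_inv_eq_one]
    simp only [map_mul, FreeGroup.lift_apply_of]
    exact Units.ext (braidMatrix_comm α m i j j.2 h)
  · rw [map_mul, map_inv, mul_inv_eq_one]
    simp only [map_mul, FreeGroup.lift_apply_of, h']
    exact Units.ext (braidMatrix_braid α m i h (h' ▸ j.2))
  · rw [map_mul, map_inv, mul_inv_eq_one]
    simp only [map_mul, FreeGroup.lift_apply_of, h, h']
    exact Units.ext (braidMatrix_typeB α m (by have := j.2; omega))

/-- The action of the affine braid group on `V_α ⊗ S_1^{⊗ m}`. -/
def braidAction (α : ℝ) (m : ℕ) : AffineBraidGroup m →* (Matrix (Idx m) (Idx m) ℂ)ˣ :=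
  PresentedGroup.toGroup (braidUnit_rels α m)

/-- The automorphism group of a module. -/
def autGroup (A : QModule ι) : Subgroup (Matrix ι ι ℂ)ˣ where
  carrier := {u | IsEndo A u}
  one_mem' := isHom_one
  mul_mem' := fun ha hb => IsHom.mul ha hb
  inv_mem' := by
    rintro u ⟨h1, h2, h3⟩
    have key : ∀ X : Matrix ι ι ℂ, (u : Matrix ι ι ℂ) * X = X * u →
        ((u⁻¹ : (Matrix ι ι ℂ)ˣ) : Matrix ι ι ℂ) * X = X * (u⁻¹ : (Matrix ι ι ℂ)ˣ) := by
      intro X h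
      rw [Units.inv_mul_eq_iff_eq_mul, ← mul_assoc, h, mul_assoc, Units.mul_inv, mul_one]
    exact ⟨key _ h1, key _ h2, key _ h3⟩

theorem braidAction_isEndo (α : ℝ) (m : ℕ) (b : AffineBraidGroup m) :
    IsEndo (tensorPower α m) (braidAction α m b : Matrix (Idx m) (Idx m) ℂ) := by
  have : (braidAction α m).range ≤ autGroup (tensorPower α m) := by
    rw [MonoidHom.range_eq_map, ← PresentedGroup.closure_range_of, MonoidHom.map_closure,
      Subgroup.closure_le]
    rintro _ ⟨_, ⟨i, rfl⟩, rfl⟩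
    rw [braidAction, PresentedGroup.toGroup.of]
    exact isHom_braidMatrix α m i
  exact this ⟨b, rfl⟩

/-- The space of module homomorphisms `A → B`. -/
def homSpace (A : QModule ι) (B : QModule κ) : Submodule ℂ (Matrix κ ι ℂ) where
  carrier := {f | IsHom A B f}
  zero_mem' := by simp [IsHom]
  add_mem' := fun ha hb => by
    obtain ⟨a1, a2, a3⟩ := ha
    obtain ⟨b1, b2, b3⟩ := hb
    simp only [Set.mem_ofPred_eq, IsHom, Matrix.add_mul, Matrix.mul_add, a1, b1, a2, b2, a3, b3,
      true_and]
  smul_mem' := fun c f hf => by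
    obtain ⟨a1, a2, a3⟩ := hf
    simp only [Set.mem_ofPred_eq, IsHom, Matrix.smul_mul, Matrix.mul_smul, a1, a2, a3, true_and]

theorem IsHom.comp {μ : Type} [Fintype μ] [DecidableEq μ] {A : QModule ι} {B : QModule κ}
    {C : QModule μ} {g : Matrix μ κ ℂ} {f : Matrix κ ι ℂ}
    (hg : IsHom B C g) (hf : IsHom A B f) : IsHom A C (g * f) :=
  ⟨by rw [Matrix.mul_assoc, hf.1, ← Matrix.mul_assoc, hg.1, Matrix.mul_assoc],
   by rw [Matrix.mul_assoc, hf.2.1, ← Matrix.mul_assoc, hg.2.1, Matrix.mul_assoc],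
   by rw [Matrix.mul_assoc, hf.2.2, ← Matrix.mul_assoc, hg.2.2, Matrix.mul_assoc]⟩

/-- Automorphisms of `B` act on homomorphisms `A → B` by composition. -/
def postcomp (A : QModule ι) (B : QModule κ) :
    autGroup B →* Module.End ℂ (homSpace A B) where
  toFun g :=
    { toFun := fun f => ⟨(g.1 : Matrix κ κ ℂ) * f.1, IsHom.comp g.2 f.2⟩
      map_add' := fun _ _ => Subtype.ext (Matrix.mul_add _ _ _)
      map_smul' := fun _ _ => Subtype.ext (Matrix.mul_smul _ _ _) }
  map_one' := LinearMap.ext fun f => Subtype.ext (Matrix.one_mul f.1)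
  map_mul' a b := LinearMap.ext fun f => Subtype.ext (Matrix.mul_assoc a.1.1 b.1.1 f.1)

/-- The Hilbert space `H_n = Hom (V_α, V_α ⊗ S_1 ^ (⊗ 2 n))` of `n` qubits. -/
abbrev qubitSpace (n : ℕ) (α : ℝ) : Submodule ℂ (Matrix (Idx (2 * n)) (Fin 4) ℂ) :=
  homSpace (typical α) (tensorPower α (2 * n))

/-- The representation of the affine braid group on `H_n`. -/
def braidRep (n : ℕ) (α : ℝ) : AffineBraidGroup (2 * n) →* Module.End ℂ (qubitSpace n α) :=
  (postcomp (typical α) (tensorPower α (2 * n))).comp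
    ((braidAction α (2 * n)).codRestrict (autGroup (tensorPower α (2 * n)))
      (braidAction_isEndo α (2 * n)))


theorem IsHom.comm_Kinv {B : QModule κ} {f : Matrix κ ι ℂ} (h : IsHom A B f) :
    f * A.Kinv = B.Kinv * f := by
  ext i j
  have h4 := congrFun (congrFun h.2.2 i) j
  simp only [QModule.H, QModule.Kinv, Matrix.mul_diagonal, Matrix.diagonal_mul] at h4 ⊢
  by_cases hf : f i j = 0
  · simp [hf]
  · rw [mul_comm] at h4
    have h5 : (A.wt j : ℂ) = B.wt i := mul_right_cancel₀ hf h4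
    rw [Complex.ofReal_inj.mp h5, mul_comm]

theorem IsHom.kron_one {B : QModule κ} {f : Matrix κ ι ℂ} (h : IsHom A B f) :
    IsHom (A.tensor ising) (B.tensor ising) (f ⊗ₖ (1 : Matrix (Fin 2) (Fin 2) ℂ)) := by
  refine ⟨?_, ?_, ?_⟩
  · simp only [QModule.tensor, Matrix.mul_add, Matrix.add_mul, ← Matrix.mul_kronecker_mul,
      Matrix.mul_one, Matrix.one_mul, h.1]
  · simp only [QModule.tensor, Matrix.mul_add, Matrix.add_mul, ← Matrix.mul_kronecker_mul,
      Matrix.mul_one, Matrix.one_mul, h.2.1, IsHom.comm_Kinv h]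
  · simp only [tensor_H, Matrix.mul_add, Matrix.add_mul, ← Matrix.mul_kronecker_mul,
      Matrix.mul_one, Matrix.one_mul, h.2.2]

/-- The linear map from a typical module with `v_j ↦ F ^ j w`. -/
def hwMap (A : QModule ι) (w : ι → ℂ) : Matrix ι (Fin 4) ℂ :=
  Matrix.of fun x j => (A.F ^ (j : ℕ) *ᵥ w) x

theorem hwMap_mulVec (A : QModule ι) (w : ι → ℂ) (j : Fin 4) :
    hwMap A w *ᵥ Pi.single j 1 = A.F ^ (j : ℕ) *ᵥ w := by
  ext x; simp [hwMap]

theorem typical_F_single (β : ℝ) (j : Fin 4) (k : Fin 4) (h : (k : ℕ) = j + 1) :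
    (typical β).F *ᵥ Pi.single j 1 = Pi.single k 1 := by
  ext x
  by_cases hx : x = k
  · subst hx; simp [typical, h]
  · have : (x : ℕ) ≠ j + 1 := fun h' => hx (Fin.ext (h'.trans h.symm))
    simp [typical, this, hx]

theorem typical_F_last (β : ℝ) : (typical β).F *ᵥ Pi.single 3 1 = 0 := by
  ext x; fin_cases x <;> simp [typical]

theorem hwMap_F (A : QModule ι) (w : ι → ℂ) (β : ℝ) (hF : A.F ^ 4 = 0) :
    hwMap A w * (typical β).F = A.F * hwMap A w := by
  refine Matrix.ext_of_mulVec_single fun j => ?_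
  rw [← Matrix.mulVec_mulVec, ← Matrix.mulVec_mulVec, hwMap_mulVec]
  by_cases h : (j : ℕ) + 1 < 4
  · rw [typical_F_single β j ⟨j + 1, h⟩ rfl, hwMap_mulVec, Matrix.mulVec_mulVec, ← pow_succ']
  · have hj : j = 3 := Fin.ext (by have := j.2; show (j : ℕ) = 3; omega)
    subst hj
    rw [typical_F_last, Matrix.mulVec_zero, Matrix.mulVec_mulVec, ← pow_succ']
    show 0 = A.F ^ 4 *ᵥ w
    rw [hF, Matrix.zero_mulVec]

/-- A matrix intertwining `F` is determined by its column at the highest weight vector. -/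
theorem eq_zero_of_F {D : Matrix ι (Fin 4) ℂ} (β : ℝ) (h : D * (typical β).F = A.F * D)
    (h0 : D *ᵥ Pi.single 0 1 = 0) : D = 0 := by
  have key : ∀ k : ℕ, ∀ hk : k < 4, D *ᵥ Pi.single ⟨k, hk⟩ 1 = 0 := by
    intro k
    induction k with
    | zero => exact fun _ => h0
    | succ k ih =>
      intro hk
      have hk' : k < 4 := by omega
      rw [← typical_F_single β ⟨k, hk'⟩ ⟨k + 1, hk⟩ rfl, Matrix.mulVec_mulVec, h,
        ← Matrix.mulVec_mulVec, ih hk', Matrix.mulVec_zero]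
  refine Matrix.ext_of_mulVec_single fun j => ?_
  rw [key j j.2, Matrix.zero_mulVec]

theorem isHom_hwMap (hA : IsGraded A) (hc : HasComm A) (hF : A.F ^ 4 = 0) (w : ι → ℂ) (β : ℝ)
    (hE : A.E *ᵥ w = 0) (hH : ∀ x, w x ≠ 0 → A.wt x = β + 3) :
    IsHom (typical β) A (hwMap A w) := by
  have f2 := hwMap_F A w β hF
  have hwd : ∀ φ : ℝ → ℂ, (Matrix.diagonal fun i => φ (A.wt i)) *ᵥ w = φ (β + 3) • w := by
    intro φ; ext x
    rw [Matrix.mulVec_diagonal, Pi.smul_apply, smul_eq_mul]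
    by_cases hx : w x = 0
    · simp [hx]
    · rw [hH x hx]
  have h00 : hwMap A w *ᵥ Pi.single 0 1 = w := by
    rw [hwMap_mulVec]; simp
  have f3 : hwMap A w * (typical β).H = A.H * hwMap A w := by
    rw [← sub_eq_zero]
    apply eq_zero_of_F (A := A) β
    · have e1 := H_F hA
      have e2 := H_F (isGraded_typical β)
      rw [Matrix.sub_mul, Matrix.mul_sub, Matrix.mul_assoc, e2, Matrix.mul_assoc, f2,
        ← Matrix.mul_assoc A.H, e1, Matrix.mul_sub, ← Matrix.mul_assoc, f2, Matrix.mul_smul, f2,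
        Matrix.sub_mul, Matrix.smul_mul, Matrix.mul_assoc, Matrix.mul_assoc]
      abel
    · have : (typical β).H *ᵥ Pi.single 0 1 = ((β + 3 : ℝ) : ℂ) • Pi.single 0 1 := by
        ext x; fin_cases x <;> simp [QModule.H, typical]
      rw [Matrix.sub_mulVec, ← Matrix.mulVec_mulVec, ← Matrix.mulVec_mulVec, this, Matrix.mulVec_smul,
        h00, QModule.H, hwd fun x => (x : ℂ), sub_self]
  refine ⟨?_, f2, f3⟩
  rw [← sub_eq_zero]
  have gK : hwMap A w * (typical β).K = A.K * hwMap A w := by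
    ext i j
    have h4 := congrFun (congrFun f3 i) j
    simp only [QModule.H, QModule.K, Matrix.mul_diagonal, Matrix.diagonal_mul] at h4 ⊢
    by_cases hf : hwMap A w i j = 0
    · simp [hf]
    · rw [mul_comm] at h4
      have h5 := mul_right_cancel₀ hf h4
      rw [Complex.ofReal_inj.mp h5, mul_comm]
  have gKinv : hwMap A w * (typical β).Kinv = A.Kinv * hwMap A w := by
    ext i j
    have h4 := congrFun (congrFun f3 i) j
    simp only [QModule.H, QModule.Kinv, Matrix.mul_diagonal, Matrix.diagonal_mul] at h4 ⊢
    by_cases hf : hwMap A w i j = 0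
    · simp [hf]
    · rw [mul_comm] at h4
      have h5 := mul_right_cancel₀ hf h4
      rw [Complex.ofReal_inj.mp h5, mul_comm]
  apply eq_zero_of_F (A := A) β
  · have e1 : A.E * A.F = A.F * A.E + (qbr 1)⁻¹ • (A.K - A.Kinv) := hc
    have e2 : (typical β).E * (typical β).F = (typical β).F * (typical β).E +
      (qbr 1)⁻¹ • ((typical β).K - (typical β).Kinv) := hasComm_typical β
    rw [Matrix.sub_mul, Matrix.mul_sub, Matrix.mul_assoc, e2, Matrix.mul_assoc, f2,
      ← Matrix.mul_assoc A.E, e1, Matrix.mul_add, ← Matrix.mul_assoc, f2, Matrix.mul_smul,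
      Matrix.mul_sub, gK, gKinv, Matrix.add_mul, Matrix.smul_mul, Matrix.sub_mul, Matrix.mul_assoc,
      Matrix.mul_assoc]
    abel
  · have : (typical β).E *ᵥ Pi.single 0 1 = 0 := by
      ext x; fin_cases x <;> simp [typical]
    rw [Matrix.sub_mulVec, ← Matrix.mulVec_mulVec, ← Matrix.mulVec_mulVec, this, Matrix.mulVec_zero,
      h00, hE, sub_self]

theorem hasComm_tensor {B : QModule κ} (hA : IsGraded A) (hB : IsGraded B) (cA : HasComm A)
    (cB : HasComm B) : HasComm (A.tensor B) := by
  have hq := qpow_ne_zero 1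
  rw [HasComm] at cA cB ⊢
  rw [tensor_K, tensor_Kinv]
  simp only [QModule.tensor, mul_add, add_mul, ← Matrix.mul_kronecker_mul, mul_one, one_mul, cA, cB,
    E_Kinv hA, F_K hB, kron_add, kron_smul, kron_sub, Matrix.kronecker_add, Matrix.kronecker_smul,
    smul_smul, smul_sub, sub_eq_add_neg, smul_add, smul_neg, neg_smul]
  have e1 : ∀ X : Matrix κ κ ℂ, A.Kinv ⊗ₖ (-X) = -(A.Kinv ⊗ₖ X) := by
    intro X; ext; simp
  have e2 : ∀ X : Matrix ι ι ℂ, (-X) ⊗ₖ B.K = -(X ⊗ₖ B.K) := by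
    intro X; ext; simp
  simp only [e1, e2, kron_smul, Matrix.kronecker_smul]
  module

theorem isGraded_ising : IsGraded ising := by
  constructor
  · intro i j h
    fin_cases i <;> fin_cases j <;> simp [ising] at h ⊢
  · intro i j h
    fin_cases i <;> fin_cases j <;> simp [ising] at h ⊢

theorem hasComm_ising : HasComm ising := by
  have ht := qbr_one_ne_zero
  rw [HasComm]
  ext i j
  fin_cases i <;> fin_cases j <;> simp [ising, QModule.K, QModule.Kinv, Matrix.mul_apply]
  · rw [← qbr, inv_mul_cancel₀ ht]
  · norm_num
    have : qpow (-1) - qpow 1 = -qbr 1 := by rw [qbr]; ring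
    rw [this]; field_simp; ring

theorem typical_F_pow (β : ℝ) : (typical β).F * ((typical β).F * ((typical β).F * (typical β).F)) = 0 := by
  refine Matrix.ext_of_mulVec_single fun j => ?_
  simp only [← Matrix.mulVec_mulVec, Matrix.zero_mulVec]
  fin_cases j <;> simp only [Fin.zero_eta, Fin.mk_one, Fin.reduceFinMk, Fin.isValue,
      typical_F_single β 0 1 rfl, typical_F_single β 1 2 rfl, typical_F_single β 2 3 rfl,
      typical_F_last, Matrix.mulVec_zero]

theorem tensor_F_pow (β : ℝ) : ((typical β).tensor ising).F ^ 4 = 0 := by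
  have hg := isGraded_typical β
  have h4 := qpow_one_pow_four
  have hq := qpow_ne_zero 1
  have e1 : (typical β).F * (typical β).Kinv = (qpow 1)⁻¹ ^ 2 • ((typical β).Kinv * (typical β).F) :=
    F_Kinv hg
  have e2 : ∀ X, (typical β).F * ((typical β).Kinv * X) =
      (qpow 1)⁻¹ ^ 2 • ((typical β).Kinv * ((typical β).F * X)) := by
    intro X; rw [← mul_assoc, e1, Matrix.smul_mul, mul_assoc]
  have h5 : (qpow 1)⁻¹ ^ 4 = -1 := by rw [inv_pow, h4]; norm_num
  simp only [QModule.tensor, pow_succ, pow_zero, one_mul, mul_add, add_mul,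
    ← Matrix.mul_kronecker_mul, mul_one, mul_assoc, e1, e2, ising_F_sq, mul_zero, zero_mul, smul_zero,
    Matrix.kronecker_zero, add_zero, zero_add, kron_smul, Matrix.mul_smul, Matrix.smul_mul, smul_add, smul_smul,
    typical_F_pow,
    Matrix.zero_kronecker]
  match_scalars <;> linear_combination (1 + (qpow 1)⁻¹ ^ 2) * h5

/-- Highest weight vectors of `V_β ⊗ S_1`, of weights `(β ± 1) + 3`. -/
def hwVec (β : ℝ) : Fin 2 → Fin 4 × Fin 2 → ℂ
  | 0 => Pi.single (0, 0) 1
  | 1 => Pi.single (0, 1) 1 - (qpow (-1) / qint (1 - β)) • Pi.single (1, 0) 1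

/-- The trivalent vertex `V_(β ± 1) → V_β ⊗ S_1`, with `+` for `s = 0` and `-` for `s = 1`. -/
def vertex (β : ℝ) (s : Fin 2) : Matrix (Fin 4 × Fin 2) (Fin 4) ℂ :=
  hwMap ((typical β).tensor ising) (hwVec β s)

theorem qbr_ne_zero {x : ℝ} (h : ∀ k : ℤ, x ≠ k) : qbr x ≠ 0 := by
  rw [qbr, qpow, qpow, sub_ne_zero]
  intro h1
  rw [Complex.exp_eq_exp_iff_exists_int] at h1
  obtain ⟨m, hm⟩ := h1
  have h2 := congrArg Complex.im hm
  simp at h2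
  have hpi := Real.pi_ne_zero
  have : x = ((4 * m : ℤ) : ℝ) := by
    push_cast
    have : Real.pi * (x - 4 * m) = 0 := by linarith
    rcases mul_eq_zero.mp this with h | h
    · exact absurd h hpi
    · linarith
  exact h _ this

theorem hwVec_E (β : ℝ) (hβ : ∀ k : ℤ, β ≠ k) (s : Fin 2) :
    ((typical β).tensor ising).E *ᵥ hwVec β s = 0 := by
  have h0 : qint (1 - β) ≠ 0 := by
    refine div_ne_zero (qbr_ne_zero fun k hk => hβ (1 - k) ?_) qbr_one_ne_zero
    push_cast; linarith
  have h1 : qint 1 = 1 := div_self qbr_one_ne_zero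
  have hq := qpow_ne_zero 1
  fin_cases s
  · ext ⟨x, y⟩
    fin_cases x <;> fin_cases y <;> simp [hwVec, QModule.tensor, typical, ising]
  · ext ⟨x, y⟩
    fin_cases x <;> fin_cases y <;>
      simp [hwVec, QModule.tensor, typical, ising, Matrix.mulVec_sub, Matrix.mulVec_smul, QModule.K, h1,
        qpow_neg]
    field_simp
    ring

theorem isHom_vertex (β : ℝ) (hβ : ∀ k : ℤ, β ≠ k) (s : Fin 2) :
    IsHom (typical (β + ising.wt s)) ((typical β).tensor ising) (vertex β s) := by
  refine isHom_hwMap (isGraded_tensor (isGraded_typical β) isGraded_ising)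
    (hasComm_tensor (isGraded_typical β) isGraded_ising (hasComm_typical β) hasComm_ising)
    (tensor_F_pow β) _ _ (hwVec_E β hβ s) ?_
  rintro ⟨x, y⟩ h
  fin_cases s <;> fin_cases x <;> fin_cases y <;>
    simp [hwVec, QModule.tensor, typical, ising] at h ⊢ <;> ring

/-- The charge reached from `α` after the first `k` fusions with Ising anyons, where `s` lists
the fusion channels (`0` raises the charge by `1`, and `1` lowers it by `1`). -/
def charge (α : ℝ) (s : ℕ → Fin 2) : ℕ → ℝ
  | 0 => α
  | k + 1 => charge α s k + ising.wt (s k)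

/-- The left-hanging fusion tree with channels `s`, as a matrix from `V_(charge α s m)` to
`V_α ⊗ S_1 ^ (⊗ m)`. -/
def ket (α : ℝ) (s : ℕ → Fin 2) : (m : ℕ) → Matrix (Idx m) (Fin 4) ℂ
  | 0 => (1 : Matrix (Fin 4) (Fin 4) ℂ)
  | m + 1 => (ket α s m ⊗ₖ (1 : Matrix (Fin 2) (Fin 2) ℂ)) * vertex (charge α s m) (s m)

theorem charge_ne_int (α : ℝ) (hα : ∀ k : ℤ, α ≠ k) (s : ℕ → Fin 2) :
    ∀ m : ℕ, ∀ k : ℤ, charge α s m ≠ k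
  | 0 => hα
  | m + 1 => by
    intro k hk
    rw [charge] at hk
    refine charge_ne_int α hα s m (k - (1 - 2 * ((s m : ℕ) : ℤ))) ?_
    push_cast
    rw [← hk]
    simp [ising]

theorem isHom_ket (α : ℝ) (hα : ∀ k : ℤ, α ≠ k) (s : ℕ → Fin 2) :
    (m : ℕ) → IsHom (typical (charge α s m)) (tensorPower α m) (ket α s m)
  | 0 => isHom_one
  | m + 1 => IsHom.comp (IsHom.kron_one (isHom_ket α hα s m))
      (isHom_vertex (charge α s m) (charge_ne_int α hα s m) (s m))

/-- Highest weight vectors of `S_1 ⊗ V_β`, of weights `(β ± 1) + 3`. -/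
def hwVecSwap (β : ℝ) : Fin 2 → Fin 2 × Fin 4 → ℂ
  | 0 => Pi.single (0, 0) 1
  | 1 => Pi.single (0, 1) 1 - (qint (1 - β) * qpow (-β - 3)) • Pi.single (1, 0) 1

/-- The square root of the twist on `V_β`. -/
def sqrtTwist (β : ℝ) : ℂ := qpow ((β ^ 2 - 9) / 4)

/-- The isomorphism from `V_(β + 1) ⊕ V_(β - 1)` to `S_1 ⊗ V_β`. -/
def decomp (β : ℝ) : Matrix (Fin 2 × Fin 4) (Fin 2 × Fin 4) ℂ :=
  Matrix.of fun x y => hwMap (ising.tensor (typical β)) (hwVecSwap β y.1) x y.2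

/-- The square root of the twist on `S_1 ⊗ V_β`. -/
def sqrtTwistTensor (β : ℝ) : Matrix (Fin 2 × Fin 4) (Fin 2 × Fin 4) ℂ :=
  decomp β * Matrix.diagonal (fun y => sqrtTwist (β + ising.wt y.1)) * (decomp β)⁻¹

/-- The diagonal entries of the invariant Hermitian form on `V_β`, in the basis `v_0, …, v_3`. -/
def normSq (β : ℝ) (i : Fin 4) : ℂ :=
  ∏ j ∈ Finset.range i, qint (j + 1) * qint (j + 1 - β)

/-- The matrix of the invariant Hermitian form on `V_β ⊗ S_1`: the product form, twisted by the flip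
of `X = (√θ_(S_1 ⊗ V_β))⁻¹ c (√θ_(V_β) ⊗ √θ_(S_1))`, where `√θ_(S_1) = q ^ (-5 / 4)`. -/
def tensorForm (β : ℝ) : Matrix (Fin 4 × Fin 2) (Fin 4 × Fin 2) ℂ :=
  Matrix.diagonal (fun x => normSq β x.1) *
    ((sqrtTwistTensor β)⁻¹ * (typical β).braiding ising *
      Matrix.diagonal (fun _ => sqrtTwist β * qpow (-5 / 4))).submatrix Prod.swap id

/-- The adjoint of `vertex β s` for the invariant Hermitian forms. -/
def vertexAdj (β : ℝ) (s : Fin 2) : Matrix (Fin 4) (Fin 4 × Fin 2) ℂ :=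
  Matrix.diagonal (fun i => (normSq (β + ising.wt s) i)⁻¹) * (vertex β s)ᴴ * tensorForm β

/-- The adjoint of the fusion tree `ket α s m`. -/
def bra (α : ℝ) (s : ℕ → Fin 2) : (m : ℕ) → Matrix (Fin 4) (Idx m) ℂ
  | 0 => (1 : Matrix (Fin 4) (Fin 4) ℂ)
  | m + 1 => vertexAdj (charge α s m) (s m) * (bra α s m ⊗ₖ (1 : Matrix (Fin 2) (Fin 2) ℂ))

/-- The fusion channels of the computational basis vector `|x⟩`: for each qubit `i`, the charge goes
from `α` to `α + 1` if `x i = 0`, or to `α - 1` if `x i = 1`, and then back to `α`. -/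
def compChannels {n : ℕ} (x : Fin n → Fin 2) (k : ℕ) : Fin 2 :=
  if h : k / 2 < n then (if k % 2 = 0 then x ⟨k / 2, h⟩ else 1 - x ⟨k / 2, h⟩) else 0

theorem charge_comp (α : ℝ) {n : ℕ} (x : Fin n → Fin 2) :
    ∀ k ≤ n, charge α (compChannels x) (2 * k) = α := by
  intro k
  induction k with
  | zero => exact fun _ => rfl
  | succ k ih =>
    intro hk
    have h1 : 2 * k / 2 = k := by omega
    have h2 : (2 * k + 1) / 2 = k := by omega
    have h3 : (2 * k + 1) % 2 = 1 := by omega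
    have h4 : k < n := hk
    rw [show 2 * (k + 1) = 2 * k + 1 + 1 by ring, charge, charge, ih (by omega)]
    simp only [compChannels, h1, h2, h3, h4, dite_true, Nat.mul_mod_right, if_true]
    generalize x ⟨k, _⟩ = y
    fin_cases y <;> simp [ising] <;> norm_num

/-- The computational basis vector `|x⟩` of `H_n`. -/
def compKet {n : ℕ} {α : ℝ} (hα : ∀ k : ℤ, α ≠ k) (x : Fin n → Fin 2) : qubitSpace n α :=
  ⟨ket α (compChannels x) (2 * n), by
    have h := isHom_ket α hα (compChannels x) (2 * n)
    rw [charge_comp α x n le_rfl] at h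
    exact h⟩

/-- The modified dimension `-4 {α} / {4 α}` of `V_α`. -/
def modDim (α : ℝ) : ℂ := -4 * qbr α / qbr (4 * α)

/-- The modified trace of an endomorphism of `V_α`, which is a scalar matrix since `V_α` is
simple. -/
def modTrace (α : ℝ) (f : Matrix (Fin 4) (Fin 4) ℂ) : ℂ := modDim α * f 0 0

/-- The matrix `⟨x|y⟩` of the Hermitian form on the computational subspace of `H_n`, in the
computational basis. -/
def gram (n : ℕ) (α : ℝ) : Matrix (Fin n → Fin 2) (Fin n → Fin 2) ℂ :=
  Matrix.of fun x y => modTrace α (bra α (compChannels x) (2 * n) * ket α (compChannels y) (2 * n))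

/-- The special unitary group of the computational subspace, for the form `gram n α`, as matrices in
the computational basis. -/
def compSU (n : ℕ) (α : ℝ) : Set (Matrix (Fin n → Fin 2) (Fin n → Fin 2) ℂ) :=
  {U | Uᴴ * gram n α * U = gram n α ∧ U.det = 1}

/-- The Hermitian form on the computational subspace is positive or negative definite. -/
def FormDefinite (n : ℕ) (α : ℝ) : Prop :=
  (gram n α).PosDef ∨ (-gram n α).PosDef

end

end Neglecton

/-!
The proof computes the Lie algebra of the closure of the image of the braid group.

Only braids that act on the anyons of one or of two neighbouring qubits are used. Winding the first
anyon of a qubit around the pole is diagonal in the computational basis, and the braiding of the two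
anyons of a qubit mixes the states `0` and `1`. Both preserve the computational space; in the basis
normalized for the Hermitian form they are, up to phases, `J = diag(1, w)` with `w = q ^ (-2 α)`, and
a rotation `S` by `π / 2` (`windMatrix_mul_normKet`, `braidMatrix_mul_normKet`). For `α` within
`1 / 3` of `2` mod `4`, the square of `J` is a rotation by less than `π / 3`, that is
`‖w ^ 2 - 1‖ < 1`. Hence the iterated commutators of `J ^ 2` with `S` tend to `1`, and they do not
reach it. A limit of their rescaled differences from `1` generates a one-parameter group in the
closure of the braids (`exists_oneParam_ne_zero`), and conjugation by `J` and `S` turns it into all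
of `SU(2)` (`su2_mem_oneParam`).

The braiding of the second anyon of a qubit with the first anyon of the next one leaks: it preserves
the planes spanned by `|00⟩` and a leakage state, and by `|11⟩` and a leakage state, and fixes `|01⟩`
and `|10⟩`. Its square is a reflection in each plane. Conjugating the one-qubit rotation of
`|00⟩` against `|11⟩` by these reflections, the two planes have different invariants (they have
opposite signs), so that iterated brackets separate them (`rotation_mem_of_two_blocks`), and the
closure contains rotations that act on the plane of `|00⟩` only, by `e^(± i t)` on `|00⟩` and on its
leakage state. On the computational space these are controlled phases without leakage
(`controlledPhase_mem`). Leakage states are not part of the space on which density is claimed, but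
the operators are approximated on the larger family of vectors `pairFamily`; `reach` records the
coefficient matrices which limits of braids realize on a given family of vectors.

Together with the one-qubit rotations, the controlled phases generate all skew-Hermitian matrices
(`I_smul_mem_of_qubits`), and every unitary matrix is the exponential of one of them, up to a phase
(`exists_phase_smul_exp`).

The Hermitian form is diagonal in the computational basis, since the adjoint of a vertex pairs the
vertices by Schur's lemma (`vertex_conjTranspose_mul`, `vertexAdj_mul_vertex`); its diagonal entries
have the same sign for all bit strings exactly when `[α + 1] [α - 1] > 0`, and the ratios of the
diagonal entries are the squares of the weights by which the computational basis was normalized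
(`gram_eq`).
-/

open Filter Topology

namespace Neglecton

noncomputable section

attribute [local instance] LieRing.ofAssociativeRing
attribute [local instance] Matrix.linftyOpNormedRing Matrix.linftyOpNormedAlgebra
open scoped Kronecker Matrix ComplexOrder

/-! ### One-parameter groups in a closed submonoid -/

section OneParameter
variable {A : Type*} [NormedRing A] [NormedAlgebra ℝ A] [CompleteSpace A]

/-- If `f → 1` and `m • (f - 1) → Z`, then `f ^ m → exp Z`: the local inverse `log` of `exp` satisfies
`log f = (f - 1) + o(f - 1)`, so `m • log f → Z`. -/
theorem tendsto_pow_exp {J : Type*} {l : Filter J} {f : J → A} {m : J → ℕ} {Z : A}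
    (hf : Tendsto f l (𝓝 1)) (hm : Tendsto (fun j => (m j : ℝ) • (f j - 1)) l (𝓝 Z)) :
    Tendsto (fun j => f j ^ m j) l (𝓝 (NormedSpace.exp Z)) := by
  let _ : NormedAlgebra ℚ A := NormedAlgebra.restrictScalars ℚ ℝ A
  have hs : HasStrictFDerivAt (NormedSpace.exp : A → A)
      ((ContinuousLinearEquiv.refl ℝ A : A ≃L[ℝ] A) : A →L[ℝ] A) 0 := hasStrictFDerivAt_exp_zero
  set lg : A → A := hs.localInverse _ _ _ with hlg
  have h1 : NormedSpace.exp (0 : A) = 1 := NormedSpace.exp_zero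
  have hd : HasFDerivAt lg (ContinuousLinearMap.id ℝ A) 1 := by
    have := hs.to_localInverse.hasFDerivAt
    rw [h1] at this
    exact this
  have h0 : lg 1 = 0 := by
    have := hs.localInverse_apply_image
    rwa [h1] at this
  have hr : ∀ᶠ y in 𝓝 (1 : A), NormedSpace.exp (lg y) = y := by
    have := hs.eventually_right_inverse
    rwa [h1] at this
  have ho : (fun j => lg (f j) - (f j - 1)) =o[l] fun j => f j - 1 := by
    have := (hasFDerivAt_iff_isLittleO.mp hd).comp_tendsto hf
    simpa [Function.comp_def, h0] using this
  have ho2 : (fun j => (m j : ℝ) • (lg (f j) - (f j - 1))) =o[l]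
      fun j => (m j : ℝ) • (f j - 1) := (Asymptotics.isBigO_refl (fun j => (m j : ℝ)) l).smul_isLittleO ho
  have h3 : Tendsto (fun j => (m j : ℝ) • (lg (f j) - (f j - 1))) l (𝓝 0) :=
    (Asymptotics.isLittleO_one_iff ℝ).mp (ho2.trans_isBigO (hm.isBigO_one ℝ))
  have h4 : Tendsto (fun j => (m j : ℝ) • lg (f j)) l (𝓝 Z) := by
    have := h3.add hm
    simpa [← smul_add] using this
  have h5 := (NormedSpace.exp_continuous (𝔸 := A)).continuousAt.tendsto.comp h4
  refine h5.congr' ?_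
  filter_upwards [hf.eventually hr] with j hj
  simp only [Function.comp]
  rw [Nat.cast_smul_eq_nsmul, NormedSpace.exp_nsmul, hj]

variable (G : Submonoid A)

/-- The exponential of the velocity at `1` of a curve in a closed submonoid is in the submonoid. -/
theorem exp_mem_of_hasDerivAt (hG : IsClosed (G : Set A)) {γ : ℝ → A} {Z : A} (h0 : γ 0 = 1)
    (hd : HasDerivAt γ Z 0) (hγ : ∀ s, γ s ∈ G) :
    NormedSpace.exp Z ∈ G := by
  have hs : Tendsto (fun n : ℕ => ((n : ℝ) + 1)⁻¹) atTop (𝓝[≠] 0) :=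
    tendsto_nhdsWithin_iff.mpr ⟨by simpa using tendsto_one_div_add_atTop_nhds_zero_nat (𝕜 := ℝ),
      Eventually.of_forall fun n => (inv_pos.mpr (by positivity)).ne'⟩
  have h1 := (hasDerivAt_iff_tendsto_slope_zero.mp hd).comp hs
  have h2 : Tendsto (fun n : ℕ => γ ((n : ℝ) + 1)⁻¹) atTop (𝓝 1) := by
    have := hd.continuousAt.tendsto.comp (tendsto_nhdsWithin_iff.mp hs).1
    rwa [h0] at this
  have h3 := tendsto_pow_exp (m := fun n => n + 1) h2 (Z := Z) (by simpa [Function.comp_def, h0] using h1)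
  exact hG.mem_of_tendsto h3 (Eventually.of_forall fun n => pow_mem (hγ _) _)

/-- The generators of the one-parameter groups contained in a closed submonoid of a Banach
algebra, as a real subspace. -/
def oneParamSubmodule (hG : IsClosed (G : Set A)) : Submodule ℝ A where
  carrier := {X | ∀ t : ℝ, NormedSpace.exp (t • X) ∈ G}
  zero_mem' t := by simp
  smul_mem' c X hX t := by rw [smul_smul]; exact hX _
  add_mem' {X Y} hX hY t := by
    have hd : HasDerivAt (fun s : ℝ => NormedSpace.exp (s • t • X) * NormedSpace.exp (s • t • Y))
        (t • (X + Y)) 0 := by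
      have := (hasDerivAt_exp_smul_const (t • X) (0 : ℝ)).mul
        (hasDerivAt_exp_smul_const (t • Y) (0 : ℝ))
      simpa [smul_add, Pi.mul_def] using this
    refine exp_mem_of_hasDerivAt G hG (by simp) hd fun s => G.mul_mem ?_ ?_
    · rw [smul_smul]; exact hX _
    · rw [smul_smul]; exact hY _

theorem isClosed_oneParamSubmodule (hG : IsClosed (G : Set A)) :
    IsClosed (oneParamSubmodule G hG : Set A) := by
  have : (oneParamSubmodule G hG : Set A) =
      ⋂ t : ℝ, (fun X : A => NormedSpace.exp (t • X)) ⁻¹' G := by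
    ext X; simp [oneParamSubmodule]
  rw [this]
  let _ : NormedAlgebra ℚ A := NormedAlgebra.restrictScalars ℚ ℝ A
  exact isClosed_iInter fun t => hG.preimage
    ((NormedSpace.exp_continuous (𝔸 := A)).comp (continuous_const_smul t))

theorem conj_mem_oneParamSubmodule (hG : IsClosed (G : Set A)) (u : Aˣ) (hu : (u : A) ∈ G)
    (hu' : (↑u⁻¹ : A) ∈ G) {X : A} (hX : X ∈ oneParamSubmodule G hG) : (u * X * ↑u⁻¹ : A) ∈ oneParamSubmodule G hG := by
  let _ : NormedAlgebra ℚ A := NormedAlgebra.restrictScalars ℚ ℝ A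
  intro t
  rw [show t • (u * X * ↑u⁻¹ : A) = u * (t • X) * ↑u⁻¹ by simp, NormedSpace.exp_units_conj]
  exact G.mul_mem (G.mul_mem hu (hX t)) hu'

/-- The Lie algebra of a closed submonoid of a Banach algebra. -/
def oneParam (hG : IsClosed (G : Set A)) : LieSubalgebra ℝ A where
  __ := oneParamSubmodule G hG
  lie_mem' {X Y} hX hY := by
    let _ : NormedAlgebra ℚ A := NormedAlgebra.restrictScalars ℚ ℝ A
    have hd : HasDerivAt
        (fun s : ℝ => NormedSpace.exp (s • X) * Y * NormedSpace.exp (s • (-X))) ⁅X, Y⁆ 0 := by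
      have := ((hasDerivAt_exp_smul_const X (0 : ℝ)).mul_const Y).mul
        (hasDerivAt_exp_smul_const (-X) (0 : ℝ))
      simpa [Ring.lie_def, sub_eq_add_neg, Pi.mul_def] using this
    refine (isClosed_oneParamSubmodule G hG).mem_of_tendsto
      (hasDerivAt_iff_tendsto_slope_zero.mp hd) (Eventually.of_forall fun s => ?_)
    refine (oneParamSubmodule G hG).smul_mem _ ((oneParamSubmodule G hG).sub_mem ?_ (by simpa using hY))
    have hinv : ∀ r : ℝ, NormedSpace.exp (r • X) * NormedSpace.exp (r • (-X)) = 1 := by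
      intro r
      rw [← NormedSpace.exp_add_of_commute (by simp), smul_neg, add_neg_cancel,
        NormedSpace.exp_zero]
    have hinv' : ∀ r : ℝ, NormedSpace.exp (r • (-X)) * NormedSpace.exp (r • X) = 1 := by
      intro r
      rw [← NormedSpace.exp_add_of_commute (by simp), smul_neg, neg_add_cancel,
        NormedSpace.exp_zero]
    exact conj_mem_oneParamSubmodule G hG ⟨_, _, hinv (0 + s), hinv' (0 + s)⟩ (hX _)
      ((oneParamSubmodule G hG).neg_mem hX _) hY

theorem mem_oneParam (hG : IsClosed (G : Set A)) {X : A} :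
    X ∈ oneParam G hG ↔ ∀ t : ℝ, NormedSpace.exp (t • X) ∈ G := Iff.rfl

theorem conj_mem_oneParam (hG : IsClosed (G : Set A)) (u : Aˣ) (hu : (u : A) ∈ G)
    (hu' : (↑u⁻¹ : A) ∈ G) {X : A} (hX : X ∈ oneParam G hG) : (u * X * ↑u⁻¹ : A) ∈ oneParam G hG :=
  conj_mem_oneParamSubmodule G hG u hu hu' hX

/-- A closed submonoid that contains invertible elements `g k ≠ 1` (and their inverses) tending to
`1` contains a nontrivial one-parameter group; its generator is a limit of rescaled `g k - 1`. It
lies in every closed subspace `W` that contains all `g k - (g k)⁻¹`, since these differ from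
`2 • (g k - 1)` in second order. -/
theorem exists_oneParam_ne_zero [ProperSpace A] (hG : IsClosed (G : Set A)) (W : Submodule ℝ A)
    (hW : IsClosed (W : Set A))
    (g : ℕ → Aˣ) (hg : ∀ k, (g k : A) ∈ G) (hg' : ∀ k, (↑(g k)⁻¹ : A) ∈ G)
    (h1 : Tendsto (fun k => (g k : A)) atTop (𝓝 1)) (hne : ∀ k, (g k : A) ≠ 1)
    (hgW : ∀ k, (g k : A) - ↑(g k)⁻¹ ∈ W) : ∃ X ∈ W, X ≠ 0 ∧ X ∈ oneParam G hG := by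
  set d : ℕ → ℝ := fun k => ‖(g k : A) - 1‖ with hd
  have hdpos : ∀ k, 0 < d k := fun k => norm_pos_iff.mpr (sub_ne_zero.mpr (hne k))
  have hd0 : Tendsto d atTop (𝓝 0) := by
    have := (h1.sub_const 1).norm
    simpa using this
  have hsph : ∀ k, (d k)⁻¹ • ((g k : A) - 1) ∈ Metric.sphere (0 : A) 1 := by
    intro k
    rw [mem_sphere_zero_iff_norm, norm_smul, norm_inv, Real.norm_of_nonneg (hdpos k).le]
    exact inv_mul_cancel₀ (hdpos k).ne'
  obtain ⟨X, hX, φ, hφ, hlim⟩ := (isCompact_sphere (0 : A) 1).tendsto_subseq hsph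
  have hφ' := hφ.tendsto_atTop
  have g1 : Tendsto (fun k => (g (φ k) : A)) atTop (𝓝 1) := h1.comp hφ'
  have ginv : Tendsto (fun k => (↑(g (φ k))⁻¹ : A)) atTop (𝓝 1) := by
    have := (NormedRing.inverse_continuousAt (1 : Aˣ)).tendsto.comp g1
    simpa [Function.comp_def] using this
  have hlim' : Tendsto (fun k => (d (φ k))⁻¹ • ((↑(g (φ k))⁻¹ : A) - 1)) atTop (𝓝 (-X)) := by
    have := (ginv.mul hlim).neg
    simp only [one_mul] at this
    refine this.congr fun k => ?_
    simp [mul_sub, ← smul_neg]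
  -- the powers of `f k` with exponent `⌊t / d k⌋` converge to `exp (t • Y)`
  have key : ∀ (f : ℕ → A) (Y : A), (∀ k, f k ∈ G) → Tendsto f atTop (𝓝 1) →
      Tendsto (fun k => (d (φ k))⁻¹ • (f k - 1)) atTop (𝓝 Y) → ∀ t : ℝ, 0 ≤ t →
      NormedSpace.exp (t • Y) ∈ G := by
    intro f Y hf hf1 hfY t ht
    have hm : Tendsto (fun k => (⌊t / d (φ k)⌋₊ : ℝ) * d (φ k)) atTop (𝓝 t) := by
      have hdφ := hd0.comp hφ'
      refine tendsto_of_tendsto_of_tendsto_of_le_of_le (g := fun k => t - d (φ k)) (h := fun _ => t)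
        ?_ tendsto_const_nhds ?_ ?_
      · simpa using (tendsto_const_nhds (x := t)).sub hdφ
      · intro k
        have := Nat.lt_floor_add_one (t / d (φ k))
        rw [div_lt_iff₀ (hdpos _)] at this
        simp only; linarith
      · intro k
        have := Nat.floor_le (div_nonneg ht (hdpos (φ k)).le)
        rwa [le_div_iff₀ (hdpos _)] at this
    have h2 := hm.smul hfY
    refine hG.mem_of_tendsto (tendsto_pow_exp (m := fun k => ⌊t / d (φ k)⌋₊) hf1 (Z := t • Y) ?_)
      (Eventually.of_forall fun k => pow_mem (hf k) _)
    refine h2.congr fun k => ?_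
    rw [smul_smul, mul_assoc, mul_inv_cancel₀ (hdpos _).ne', mul_one]
  refine ⟨X, ?_, ?_, ?_⟩
  · have h2 : Tendsto (fun k => (2 : ℝ)⁻¹ • (d (φ k))⁻¹ • ((g (φ k) : A) - ↑(g (φ k))⁻¹)) atTop
        (𝓝 X) := by
      have := (hlim.sub hlim').const_smul (2 : ℝ)⁻¹
      rw [sub_neg_eq_add, ← two_smul ℝ X, smul_smul, inv_mul_cancel₀ two_ne_zero, one_smul] at this
      refine this.congr fun k => ?_
      simp [← smul_sub]
    exact hW.mem_of_tendsto h2 (Eventually.of_forall fun k => W.smul_mem _ (W.smul_mem _ (hgW _)))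
  · rintro rfl; simp at hX
  · intro t
    rcases le_total 0 t with ht | ht
    · exact key _ X (fun k => hg _) g1 hlim t ht
    · have := key _ (-X) (fun k => hg' _) ginv hlim' (-t) (by linarith)
      simpa using this

end OneParameter

/-! ### Two non-commuting rotations and `SU(2)` -/

section OneQubit
open Complex ComplexConjugate

/-- The elements of the Lie algebra `su(2)`, parametrized by a real and a complex number. -/
def su2Mat (z : ℝ) (b : ℂ) : Matrix (Fin 2) (Fin 2) ℂ := !![I * z, -conj b; b, -(I * z)]

/-- The elements of `SU(2)` are the matrices `su2Group u v` with `|u|² + |v|² = 1`. -/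
def su2Group (u v : ℂ) : Matrix (Fin 2) (Fin 2) ℂ := !![u, -conj v; v, conj u]

/-- The parametrization of `su(2)` as a real linear map. -/
def su2Lin : ℝ × ℂ →ₗ[ℝ] Matrix (Fin 2) (Fin 2) ℂ where
  toFun p := su2Mat p.1 p.2
  map_add' p r := by
    ext i j; fin_cases i <;> fin_cases j <;> simp [su2Mat] <;> ring
  map_smul' c p := by
    ext i j; fin_cases i <;> fin_cases j <;> simp [su2Mat] <;> ring

/-- The diagonal matrix with entries `1`, `w`: winding the first Ising anyon around the pole. -/
def windMat (w : ℂ) : Matrix (Fin 2) (Fin 2) ℂ := !![1, 0; 0, w]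

/-- The rotation by `π / 2` about the axis `(y, 0, x)`: braiding the two Ising anyons of a qubit. -/
def quarterTurn (x y : ℝ) : Matrix (Fin 2) (Fin 2) ℂ :=
  su2Group ((1 + I * x) / (√2 : ℝ)) (I * y / (√2 : ℝ))

theorem windMat_mul_windMat (w w' : ℂ) : windMat w * windMat w' = windMat (w * w') := by
  simp [windMat]

theorem windMat_one : windMat 1 = 1 := by
  ext i j; fin_cases i <;> fin_cases j <;> simp [windMat]

theorem su2Group_mul_conj {u v : ℂ} (h : u * conj u + v * conj v = 1) :
    su2Group u v * su2Group (conj u) (-v) = 1 := by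
  ext i j
  fin_cases i <;> fin_cases j <;> simp [su2Group, Matrix.mul_apply, Fin.sum_univ_two]
  · linear_combination h
  · ring
  · ring
  · linear_combination h

theorem windMat_conj_su2Mat {w : ℂ} (hw : w * conj w = 1) (z : ℝ) (b : ℂ) :
    windMat w * su2Mat z b * windMat (conj w) = su2Mat z (w * b) := by
  ext i j
  fin_cases i <;> fin_cases j <;> simp [su2Mat, windMat, Matrix.mul_apply, Fin.sum_univ_two]
  · ring
  · linear_combination (I * z) * hw

theorem quarterTurn_norm {x y : ℝ} (h : x ^ 2 + y ^ 2 = 1) :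
    ((1 + I * x) / (√2 : ℝ)) * conj ((1 + I * x) / (√2 : ℝ)) +
      (I * y / (√2 : ℝ)) * conj (I * y / (√2 : ℝ)) = 1 := by
  have h2 : ((√2 : ℝ) : ℂ) ^ 2 = 2 := by norm_cast; simp
  have h0 : ((√2 : ℝ) : ℂ) ≠ 0 := by norm_cast; simp
  have h' : (x : ℂ) ^ 2 + y ^ 2 = 1 := by exact_mod_cast h
  simp only [map_div₀, map_add, map_mul, map_one, conj_I, conj_ofReal]
  field_simp
  linear_combination h' - h2 - (x ^ 2 + y ^ 2) * I_sq

theorem quarterTurn_conj_Z {x y : ℝ} (h : x ^ 2 + y ^ 2 = 1) :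
    quarterTurn x y * su2Mat 1 0 = su2Mat (x ^ 2) (y * (I * x - 1)) * quarterTurn x y := by
  have h2 : ((√2 : ℝ) : ℂ) ^ 2 = 2 := by norm_cast; simp
  have h0 : ((√2 : ℝ) : ℂ) ≠ 0 := by norm_cast; simp
  have h' : (x : ℂ) ^ 2 + y ^ 2 = 1 := by exact_mod_cast h
  ext i j
  fin_cases i <;> fin_cases j <;>
    simp [su2Mat, quarterTurn, su2Group, Matrix.mul_apply, Fin.sum_univ_two] <;> field_simp <;>
    ring_nf
  · linear_combination -(1 + I * x) * h'
  · linear_combination -(y : ℂ) * I_sq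
  · linear_combination (y : ℂ) * I_sq
  · linear_combination (1 - I * x) * h'

/-- A nonzero real Lie subalgebra of `su(2)` that is invariant under a rotation about the `z` axis
by an angle not divisible by `π` and under a quarter turn about another axis is all of `su(2)`. -/
theorem su2_le_of_invariant {B : Type*} [LieRing B] [LieAlgebra ℝ B] (L : LieSubalgebra ℝ B)
    (f : ℝ × ℂ →ₗ[ℝ] B) (hbr : ∀ p r, ⁅f (0, p), f (0, r)⁆ = f (2 * (p * conj r).im, 0))
    {w : ℂ} (hw : w * conj w = 1) (hw' : w.im ≠ 0) {x y : ℝ} (hy : y ≠ 0)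
    (hJ : ∀ z b, f (z, b) ∈ L → f (z, w * b) ∈ L)
    (hS : f (1, 0) ∈ L → f (x ^ 2, y * (I * x - 1)) ∈ L)
    (hne : ∃ p ≠ 0, f p ∈ L) (p : ℝ × ℂ) : f p ∈ L := by
  have hsm : ∀ (c : ℝ) (p : ℝ × ℂ), f p ∈ L → f (c • p) ∈ L := fun c p h => by
    rw [map_smul]; exact L.smul_mem c h
  have hadd : ∀ p r : ℝ × ℂ, f p ∈ L → f r ∈ L → f (p + r) ∈ L := fun p r h h' => by
    rw [map_add]; exact L.add_mem h h'
  have hre : w.re * w.re + w.im * w.im = 1 := by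
    have := congrArg re hw
    simpa using this
  -- `b` and `w b` span the plane of off-diagonal matrices
  have hplane : ∀ b : ℂ, b ≠ 0 → f (0, b) ∈ L → ∀ r, f (0, r) ∈ L := by
    intro b hb h r
    obtain ⟨r', rfl⟩ : ∃ r', r = r' * b := ⟨r / b, by field_simp⟩
    have h2 := hadd _ _ (hsm (r'.re - r'.im / w.im * w.re) _ h) (hsm (r'.im / w.im) _ (hJ _ _ h))
    convert h2 using 2
    ext
    · simp
    · apply Complex.ext <;> simp <;> field_simp <;> ring
  have hz : f (1, 0) ∈ L := by
    obtain ⟨⟨z, b⟩, hp, h⟩ := hne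
    by_cases hz : z = 0
    · subst hz
      have hb : b ≠ 0 := by rintro rfl; exact hp rfl
      have h1 := L.lie_mem (hplane b hb h 1) (hplane b hb h I)
      rw [hbr] at h1
      have h2 := hsm (-1 / 2) _ h1
      simpa using h2
    · have h1 := hJ _ _ h
      have h2 := hJ _ _ h1
      have h3 := hadd _ _ (hadd _ _ h2 (hsm (-(2 * w.re)) _ h1)) h
      have hc : 2 - 2 * w.re ≠ 0 := by
        intro hc
        have : w.re = 1 := by linarith
        rw [this] at hre
        exact hw' (by nlinarith)
      have h4 := hsm (((2 - 2 * w.re) * z)⁻¹) _ h3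
      convert h4 using 2
      ext
      · change (1 : ℝ) = ((2 - 2 * w.re) * z)⁻¹ * (z + -(2 * w.re) * z + z)
        rw [show z + -(2 * w.re) * z + z = (2 - 2 * w.re) * z by ring,
          inv_mul_cancel₀ (mul_ne_zero hc hz)]
      · have hq : w * w - 2 * w.re * w + 1 = 0 := by
          apply Complex.ext
          · simp; linear_combination -hre
          · simp; ring
        simp
        linear_combination (-((z : ℂ)⁻¹ * (2 - 2 * (w.re : ℂ))⁻¹ * b)) * hq
  have hoff : f (0, y * (I * x - 1)) ∈ L := by
    have := hadd _ _ (hS hz) (hsm (-x ^ 2) _ hz)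
    simpa using this
  have hne' : (y * (I * x - 1) : ℂ) ≠ 0 := by
    refine mul_ne_zero (by exact_mod_cast hy) fun h => ?_
    have := congrArg re h
    simp at this
  have := hadd _ _ (hsm p.1 _ hz) (hplane _ hne' hoff p.2)
  simpa using this

/-- One step of the commutator iteration in `SU(2)`: the commutator of `windMat w` and
`su2Group u v`. -/
def commStep (w : ℂ) (p : ℂ × ℂ) : ℂ × ℂ :=
  (p.1 * conj p.1 + conj w * (p.2 * conj p.2), conj p.1 * p.2 * (w - 1))

theorem commStep_mul {w u v : ℂ} (hw : w * conj w = 1) (h : u * conj u + v * conj v = 1) :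
    su2Group (commStep w (u, v)).1 (commStep w (u, v)).2 * (su2Group u v * windMat w) =
      windMat w * su2Group u v := by
  ext i j
  fin_cases i <;> fin_cases j <;>
    simp [su2Group, windMat, commStep, Matrix.mul_apply, Fin.sum_univ_two]
  · linear_combination u * h
  · linear_combination (-conj v) * ((u * conj u + v * conj v) * hw + h)
  · linear_combination w * v * h
  · linear_combination w * conj u * h

theorem commStep_norm {w u v : ℂ} (hw : w * conj w = 1) (h : u * conj u + v * conj v = 1) :
    (commStep w (u, v)).1 * conj (commStep w (u, v)).1 +
      (commStep w (u, v)).2 * conj (commStep w (u, v)).2 = 1 := by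
  simp only [commStep, map_add, map_mul, conj_conj, map_sub, map_one]
  linear_combination (u * conj u * v * conj v  + v ^ 2 * conj v ^ 2) * hw + (u * conj u + v * conj v + 1) * h

variable {ι : Type} [Fintype ι] [DecidableEq ι]

/-- The commutator iteration starting from a quarter turn. The off-diagonal entry shrinks in each
step by at least the factor `‖w - 1‖`, but never vanishes. -/
def commSeq (w : ℂ) (x y : ℝ) : ℕ → ℂ × ℂ
  | 0 => ((1 + I * x) / (√2 : ℝ), I * y / (√2 : ℝ))
  | k + 1 => commStep w (commSeq w x y k)

theorem commSeq_spec {w : ℂ} (hw : w * conj w = 1) (hw1 : w ≠ 1) (hr : ‖w - 1‖ < 1) {x y : ℝ}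
    (hxy : x ^ 2 + y ^ 2 = 1) (hy : y ≠ 0) (k : ℕ) :
    (commSeq w x y k).1 * conj (commSeq w x y k).1 +
      (commSeq w x y k).2 * conj (commSeq w x y k).2 = 1 ∧
    (commSeq w x y k).1 ≠ 0 ∧ (commSeq w x y k).2 ≠ 0 ∧ ‖(commSeq w x y k).2‖ ≤ ‖w - 1‖ ^ k := by
  have h2 : 0 < √2 := by positivity
  induction k with
  | zero =>
    have hn := quarterTurn_norm hxy
    refine ⟨hn, ?_, ?_, ?_⟩
    · refine div_ne_zero (fun h => ?_) (by exact_mod_cast h2.ne')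
      have := congrArg re h
      simp at this
    · exact div_ne_zero (mul_ne_zero I_ne_zero (by exact_mod_cast hy)) (by exact_mod_cast h2.ne')
    · have := congrArg re hn
      simp only [mul_conj, add_re, ofReal_re, one_re, normSq_eq_norm_sq] at this
      simp only [commSeq, pow_zero]
      nlinarith [norm_nonneg (I * y / (√2 : ℝ)), norm_nonneg ((1 + I * x) / (√2 : ℝ) : ℂ)]
  | succ k ih =>
    obtain ⟨h1, h3, h4, h5⟩ := ih
    set u := (commSeq w x y k).1
    set v := (commSeq w x y k).2
    have hn : (commStep w (u, v)).1 * conj (commStep w (u, v)).1 +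
      (commStep w (u, v)).2 * conj (commStep w (u, v)).2 = 1 := commStep_norm hw h1
    have hu1 : ‖u‖ ≤ 1 := by
      have := congrArg re h1
      simp only [mul_conj, add_re, ofReal_re, one_re, normSq_eq_norm_sq] at this
      nlinarith [norm_nonneg u, norm_nonneg v]
    have hle : ‖(commStep w (u, v)).2‖ ≤ ‖w - 1‖ ^ (k + 1) := by
      simp only [commStep, norm_mul, RCLike.norm_conj]
      rw [pow_succ]
      refine mul_le_mul_of_nonneg_right ?_ (norm_nonneg _)
      calc ‖u‖ * ‖v‖ ≤ 1 * ‖v‖ := mul_le_mul_of_nonneg_right hu1 (norm_nonneg _)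
        _ ≤ _ := by rwa [one_mul]
    refine ⟨hn, fun h0 => ?_, ?_, hle⟩
    · change (commStep w (u, v)).1 = 0 at h0
      have := congrArg re hn
      rw [h0] at this
      simp only [mul_conj, ofReal_re, one_re, normSq_eq_norm_sq, zero_mul, zero_add] at this
      have h6 : ‖w - 1‖ ^ (k + 1) < 1 := pow_lt_one₀ (norm_nonneg _) hr (by omega)
      nlinarith [norm_nonneg (commStep w (u, v)).2]
    · exact mul_ne_zero (mul_ne_zero (by simpa using h3) h4) (sub_ne_zero.mpr hw1)

theorem commSeq_tendsto {w : ℂ} (hw : w * conj w = 1) (hw1 : w ≠ 1) (hr : ‖w - 1‖ < 1) {x y : ℝ}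
    (hxy : x ^ 2 + y ^ 2 = 1) (hy : y ≠ 0) :
    Tendsto (fun k => su2Group (commSeq w x y (k + 1)).1 (commSeq w x y (k + 1)).2) atTop (𝓝 1) := by
  have hs := commSeq_spec hw hw1 hr hxy hy
  have hv : Tendsto (fun k => (commSeq w x y k).2) atTop (𝓝 0) :=
    squeeze_zero_norm (fun k => (hs k).2.2.2)
      (tendsto_pow_atTop_nhds_zero_of_lt_one (norm_nonneg _) hr)
  have hu : Tendsto (fun k => (commSeq w x y (k + 1)).1) atTop (𝓝 1) := by
    have h1 : ∀ k, (commSeq w x y (k + 1)).1 =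
        1 + (conj w - 1) * ((commSeq w x y k).2 * conj (commSeq w x y k).2) := by
      intro k
      simp only [commSeq, commStep]
      linear_combination (hs k).1
    simp only [h1]
    have h2 := hv.mul ((continuous_conj.tendsto 0).comp hv)
    have h3 := (h2.const_mul (conj w - 1)).const_add 1
    simpa using h3
  have hc : Continuous fun p : ℂ × ℂ => su2Group p.1 p.2 := by
    refine continuous_matrix fun i j => ?_
    fin_cases i <;> fin_cases j <;> simp [su2Group] <;> fun_prop
  have h4 := (hc.tendsto (1, 0)).comp (hu.prodMk_nhds (hv.comp (tendsto_add_atTop_nat 1)))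
  have h5 : su2Group 1 0 = 1 := by
    ext i j; fin_cases i <;> fin_cases j <;> simp [su2Group]
  simpa [h5, Function.comp_def] using h4

/-- The group of invertible elements that belong to a submonoid together with their inverse. -/
def invertibleIn {M : Type*} [Monoid M] (G : Submonoid M) : Subgroup Mˣ where
  carrier := {u | (u : M) ∈ G ∧ (↑u⁻¹ : M) ∈ G}
  one_mem' := by simp
  mul_mem' := fun ha hb => ⟨by simpa using G.mul_mem ha.1 hb.1, by simpa using G.mul_mem hb.2 ha.2⟩
  inv_mem' := fun h => ⟨h.2, by simpa using h.1⟩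

/-- **Density of the single-qubit gates.** Let `e` embed `2 × 2` matrices as a corner of a matrix
algebra, and let `J`, `S` act in that corner as a winding `windMat w` and a quarter turn, and act
outside of it by commuting operators. If `w ^ 2` is a rotation by less than `π / 3`, then iterated
commutators of `J ^ 2` with `S` tend to `1` without reaching it, and so every closed submonoid that
contains `J`, `S` and their inverses contains all of `SU(2)`. -/
theorem su2_mem_oneParam (G : Submonoid (Matrix ι ι ℂ)) (hG : IsClosed (G : Set (Matrix ι ι ℂ)))
    (e : Matrix (Fin 2) (Fin 2) ℂ →ₙₐ[ℂ] Matrix ι ι ℂ) (he : Function.Injective e)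
    {J S : (Matrix ι ι ℂ)ˣ} (hJ : J ∈ invertibleIn G) (hS : S ∈ invertibleIn G)
    {w : ℂ} (hw : w * conj w = 1) (hwim : w.im ≠ 0) (hr : ‖w ^ 2 - 1‖ < 1) {x y : ℝ}
    (hxy : x ^ 2 + y ^ 2 = 1) (hy : y ≠ 0)
    (hJl : ∀ B, J * e B = e (windMat w * B)) (hJr : ∀ B, e B * J = e (B * windMat w))
    (hSl : ∀ B, S * e B = e (quarterTurn x y * B)) (hSr : ∀ B, e B * S = e (B * quarterTurn x y))
    (hJS : (J * S - S * J : Matrix ι ι ℂ) =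
      e (windMat w * quarterTurn x y - quarterTurn x y * windMat w)) (z : ℝ) (b : ℂ) :
    e (su2Mat z b) ∈ oneParam G hG := by
  have hww : w ^ 2 * conj (w ^ 2) = 1 := by rw [map_pow, ← mul_pow, hw, one_pow]
  have hw1 : w ^ 2 ≠ 1 := by
    intro h
    have h0 : (w - 1) * (w + 1) = 0 := by linear_combination h
    rcases mul_eq_zero.mp h0 with h | h
    · rw [sub_eq_zero.mp h] at hwim; simp at hwim
    · rw [eq_neg_of_add_eq_zero_left h] at hwim; simp at hwim
  have hs := commSeq_spec hww hw1 hr hxy hy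
  have hgg : windMat w * windMat w = windMat (w ^ 2) := by rw [windMat_mul_windMat, sq]
  have hgl : ∀ B, (J : Matrix ι ι ℂ) ^ 2 * e B = e (windMat (w ^ 2) * B) := by
    intro B; rw [sq, mul_assoc, hJl, hJl, ← mul_assoc, hgg]
  have hgr : ∀ B, e B * (J : Matrix ι ι ℂ) ^ 2 = e (B * windMat (w ^ 2)) := by
    intro B; rw [sq, ← mul_assoc, hJr, hJr, mul_assoc, hgg]
  let H : ℕ → (Matrix ι ι ℂ)ˣ := fun k => Nat.rec S (fun _ h => J ^ 2 * h * (J ^ 2)⁻¹ * h⁻¹) k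
  have hH0 : H 0 = S := rfl
  have hHs : ∀ k, H (k + 1) = J ^ 2 * H k * (J ^ 2)⁻¹ * (H k)⁻¹ := fun _ => rfl
  have hHG : ∀ k, H k ∈ invertibleIn G := by
    intro k
    induction k with
    | zero => exact hS
    | succ k ih =>
      rw [hHs]
      exact mul_mem (mul_mem (mul_mem (pow_mem hJ 2) ih) (inv_mem (pow_mem hJ 2))) (inv_mem ih)
  set h : ℕ → Matrix (Fin 2) (Fin 2) ℂ := fun k =>
    su2Group (commSeq (w ^ 2) x y k).1 (commSeq (w ^ 2) x y k).2 with hh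
  -- although `J` and `S` are not `1` outside of the corner, their commutator is
  have step : ∀ k, (J : Matrix ι ι ℂ) ^ 2 * (H k).1 - (H k).1 * (J : Matrix ι ι ℂ) ^ 2 =
      e (windMat (w ^ 2) * h k - h k * windMat (w ^ 2)) → (∀ B, e B * (H k).1 = e (B * h k)) →
      ((H (k + 1)).1 : Matrix ι ι ℂ) = 1 + e (h (k + 1) - 1) := by
    intro k hc hr
    have h1 : h (k + 1) * (h k * windMat (w ^ 2)) = windMat (w ^ 2) * h k :=
      commStep_mul hww (hs k).1
    have h2 : (1 + e (h (k + 1) - 1)) * ((H k * J ^ 2 : (Matrix ι ι ℂ)ˣ) : Matrix ι ι ℂ) =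
        ((J ^ 2 * H k : (Matrix ι ι ℂ)ˣ) : Matrix ι ι ℂ) := by
      push_cast
      rw [add_mul, one_mul, ← mul_assoc (e _), hr, hgr, mul_assoc, sub_mul, h1, one_mul, ← hc]
      abel
    have h3 : H (k + 1) * (H k * J ^ 2) = J ^ 2 * H k := by rw [hHs]; group
    rw [← h3, Units.val_mul (H (k + 1)), Units.mul_left_inj] at h2
    exact h2.symm
  have inv : ∀ k, (∀ B, (H k).1 * e B = e (h k * B)) ∧ (∀ B, e B * (H k).1 = e (B * h k)) ∧
      (J : Matrix ι ι ℂ) ^ 2 * (H k).1 - (H k).1 * (J : Matrix ι ι ℂ) ^ 2 =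
      e (windMat (w ^ 2) * h k - h k * windMat (w ^ 2)) := by
    intro k
    induction k with
    | zero =>
      refine ⟨hSl, hSr, ?_⟩
      have : (J : Matrix ι ι ℂ) ^ 2 * (S : Matrix ι ι ℂ) - (S : Matrix ι ι ℂ) * (J : Matrix ι ι ℂ) ^ 2 =
          J * (J * S - S * J) + (J * S - S * J) * J := by
        noncomm_ring
      rw [hH0, this, hJS, hJl, hJr, ← map_add]
      congr 1
      rw [← hgg]
      change _ = windMat w * windMat w * quarterTurn x y - quarterTurn x y * (windMat w * windMat w)
      noncomm_ring
    | succ k ih =>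
      have h1 := step k ih.2.2 ih.2.1
      refine ⟨fun B => ?_, fun B => ?_, ?_⟩
      · rw [h1, add_mul, one_mul, ← map_mul, ← map_add]; congr 1; noncomm_ring
      · rw [h1, mul_add, mul_one, ← map_mul, ← map_add]; congr 1; noncomm_ring
      · rw [h1, mul_add, add_mul, mul_one, one_mul, hgl, hgr, add_sub_add_left_eq_sub, ← map_sub]
        congr 1; noncomm_ring
  have hHk : ∀ k, ((H (k + 1)).1 : Matrix ι ι ℂ) = 1 + e (h (k + 1) - 1) := fun k =>
    step k (inv k).2.2 (inv k).2.1
  have hec : Continuous e := LinearMap.continuous_of_finiteDimensional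
    (e : Matrix (Fin 2) (Fin 2) ℂ →ₗ[ℂ] Matrix ι ι ℂ)
  have hlim : Tendsto (fun k => (H (k + 1)).1) atTop (𝓝 1) := by
    simp only [hHk]
    have h1 := (commSeq_tendsto hww hw1 hr hxy hy).sub_const 1
    have h2 := ((hec.tendsto _).comp h1).const_add 1
    simpa [Function.comp_def] using h2
  have hHinv : ∀ k, (↑(H (k + 1))⁻¹ : Matrix ι ι ℂ) = 1 + e (su2Group
      (conj (commSeq (w ^ 2) x y (k + 1)).1) (-(commSeq (w ^ 2) x y (k + 1)).2) - 1) := by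
    intro k
    refine Units.inv_eq_of_mul_eq_one_right ?_
    rw [hHk, add_mul, one_mul, mul_add, mul_one, ← map_mul, add_assoc, ← map_add, ← map_add]
    have h1 : h (k + 1) * su2Group (conj (commSeq (w ^ 2) x y (k + 1)).1)
        (-(commSeq (w ^ 2) x y (k + 1)).2) = 1 := su2Group_mul_conj (hs (k + 1)).1
    rw [sub_mul, mul_sub, h1]
    simp only [mul_one, one_mul]
    abel_nf
    rw [map_zero, add_zero]
  let f : ℝ × ℂ →ₗ[ℝ] Matrix ι ι ℂ :=
    ((e : Matrix (Fin 2) (Fin 2) ℂ →ₗ[ℂ] Matrix ι ι ℂ).restrictScalars ℝ).comp su2Lin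
  have hf : ∀ p : ℝ × ℂ, f p = e (su2Mat p.1 p.2) := fun _ => rfl
  have hne : ∀ k, (H (k + 1)).1 ≠ 1 := by
    intro k hk
    rw [hHk, add_eq_left] at hk
    have h1 := he (hk.trans (map_zero e).symm)
    have h2 := congrFun (congrFun h1 1) 0
    simp [hh, su2Group] at h2
    exact (hs (k + 1)).2.2.1 h2
  have hW : ∀ k, (H (k + 1)).1 - (↑(H (k + 1))⁻¹ : Matrix ι ι ℂ) ∈ LinearMap.range f := by
    intro k
    refine ⟨(2 * (commSeq (w ^ 2) x y (k + 1)).1.im, 2 * (commSeq (w ^ 2) x y (k + 1)).2), ?_⟩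
    rw [hHk, hHinv, add_sub_add_left_eq_sub, ← map_sub, hf]
    congr 1
    ext i j
    fin_cases i <;> fin_cases j <;> simp [su2Mat, hh, su2Group] <;>
      apply Complex.ext <;> simp <;> ring
  obtain ⟨X, ⟨p, rfl⟩, hX, hXL⟩ := exists_oneParam_ne_zero G hG (LinearMap.range f)
    (Submodule.closed_of_finiteDimensional _) (fun k => H (k + 1)) (fun k => (hHG (k + 1)).1)
    (fun k => (hHG (k + 1)).2) hlim hne hW
  refine su2_le_of_invariant (oneParam G hG) f (fun p r => ?_) hw hwim (x := x) hy (fun z b hzb => ?_)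
    (fun hzb => ?_) ⟨p, ?_, hXL⟩ (z, b)
  · rw [hf, hf, hf, Ring.lie_def, ← map_mul, ← map_mul, ← map_sub]
    congr 1
    ext i j
    fin_cases i <;> fin_cases j <;> simp [su2Mat]
    · apply Complex.ext <;> simp <;> ring
    · apply Complex.ext <;> simp <;> ring
  · have := conj_mem_oneParam G hG J hJ.1 hJ.2 hzb
    convert this using 1
    rw [eq_comm, Units.mul_inv_eq_iff_eq_mul, hf, hf, hJl, hJr]
    congr 1
    rw [← windMat_conj_su2Mat hw]
    simp only [mul_assoc, windMat_mul_windMat, mul_comm (conj w), hw, windMat_one, mul_one]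
  · have := conj_mem_oneParam G hG S hS.1 hS.2 hzb
    convert this using 1
    rw [eq_comm, Units.mul_inv_eq_iff_eq_mul, hf, hf, hSl, hSr]
    congr 1
    exact quarterTurn_conj_Z hxy
  · rintro rfl; simp at hX

end OneQubit

/-! ### Separating two leaking blocks -/

section TwoBlocks
open Complex ComplexConjugate

/-- The off-diagonal `2 × 2` matrix with entries `b`, `c`. -/
def offMat (b c : ℂ) : Matrix (Fin 2) (Fin 2) ℂ := !![0, b; c, 0]

/-- The traceless diagonal `2 × 2` matrix with entries `d`, `-d`. -/
def diagMat (d : ℂ) : Matrix (Fin 2) (Fin 2) ℂ := !![d, 0; 0, -d]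

/-- The reflection with entries `r`, `-2 b`, `-2 c`, `-r`. -/
def reflMat (r b c : ℂ) : Matrix (Fin 2) (Fin 2) ℂ := !![r, -2 * b; -2 * c, -r]

/-- The projection to the first coordinate. -/
def cornerMat : Matrix (Fin 2) (Fin 2) ℂ := !![1, 0; 0, 0]

theorem offMat_comm (b c b' c' : ℂ) :
    offMat b c * offMat b' c' - offMat b' c' * offMat b c = diagMat (b * c' - b' * c) := by
  ext i j; fin_cases i <;> fin_cases j <;> simp [offMat, diagMat]
  ring

theorem diagMat_comm (d b c : ℂ) :
    diagMat d * offMat b c - offMat b c * diagMat d = offMat (2 * d * b) (-2 * d * c) := by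
  ext i j; fin_cases i <;> fin_cases j <;> simp [offMat, diagMat] <;> ring

theorem cornerMat_comm (d b c : ℂ) :
    (d • cornerMat) * offMat b c - offMat b c * (d • cornerMat) = offMat (d * b) (-d * c) := by
  ext i j; fin_cases i <;> fin_cases j <;> simp [offMat, cornerMat]
  ring

theorem cornerMat_comm_reflMat (d d' r b c : ℂ) :
    (d • cornerMat) * (d' • (reflMat r b c * cornerMat * reflMat r b c)) -
      (d' • (reflMat r b c * cornerMat * reflMat r b c)) * (d • cornerMat) =
      offMat (d * d' * (-2 * b * r)) (-(d * d') * (-2 * c * r)) := by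
  ext i j; fin_cases i <;> fin_cases j <;> simp [offMat, cornerMat, reflMat] <;> ring

theorem smul_offMat (d b c : ℂ) : d • offMat b c = offMat (d * b) (d * c) := by
  ext i j; fin_cases i <;> fin_cases j <;> simp [offMat]

theorem smul_diagMat (d e : ℂ) : d • diagMat e = diagMat (d * e) := by
  ext i j; fin_cases i <;> fin_cases j <;> simp [diagMat]

variable {ι : Type} [Fintype ι] [DecidableEq ι]

/-- **Separating two leaking blocks.** Two reflections act simultaneously in two `2 × 2` blocks. If
the products `r² b c` of their entries differ, then the real Lie algebra generated by the rotation
`(i, 0), (-i, 0)` and its reflection contains the rotation `(i, -i)` of the first block alone: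
with `W` the off-diagonal part of the reflected rotation, the operator `ad T ∘ ad X` for
`T = [[X, W], W]` has eigenvalue `16 r² b c` on the component of `W` in each block. -/
theorem rotation_mem_of_two_blocks (L : LieSubalgebra ℝ (Matrix ι ι ℂ))
    (η₁ η₂ : Matrix (Fin 2) (Fin 2) ℂ →ₙₐ[ℂ] Matrix ι ι ℂ)
    (h12 : ∀ M N, η₁ M * η₂ N = 0) (h21 : ∀ M N, η₂ M * η₁ N = 0) {r₁ r₂ b₁ b₂ c₁ c₂ : ℂ}
    {κ₁ κ₂ : ℝ} (hκ₁ : r₁ ^ 2 * (b₁ * c₁) = κ₁) (hκ₂ : r₂ ^ 2 * (b₂ * c₂) = κ₂) (h0 : κ₁ ≠ 0)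
    (hne : κ₁ ≠ κ₂)
    (hX : η₁ (I • cornerMat) + η₂ (-I • cornerMat) ∈ L)
    (hY : η₁ (I • (reflMat r₁ b₁ c₁ * cornerMat * reflMat r₁ b₁ c₁)) +
      η₂ (-I • (reflMat r₂ b₂ c₂ * cornerMat * reflMat r₂ b₂ c₂)) ∈ L) :
    η₁ (diagMat I) ∈ L := by
  have hlie : ∀ {M N M' N'}, η₁ M + η₂ N ∈ L → η₁ M' + η₂ N' ∈ L →
      η₁ (M * M' - M' * M) + η₂ (N * N' - N' * N) ∈ L := by
    intro M N M' N' h h'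
    have := L.lie_mem h h'
    rw [Ring.lie_def] at this
    convert this using 1
    simp only [add_mul, mul_add, h12, h21, map_sub, map_mul]
    abel
  have hsm : ∀ (t : ℝ) {M N}, η₁ M + η₂ N ∈ L → η₁ ((t : ℂ) • M) + η₂ ((t : ℂ) • N) ∈ L := by
    intro t M N h
    have := L.smul_mem t h
    convert this using 1
    rw [map_smul, map_smul, smul_add]; rfl
  have hI : I * I = -1 := I_mul_I
  have hV : η₁ (offMat (2 * b₁ * r₁) (-2 * c₁ * r₁)) + η₂ (offMat (2 * b₂ * r₂) (-2 * c₂ * r₂)) ∈ L := by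
    have := hlie hX hY
    rw [cornerMat_comm_reflMat, cornerMat_comm_reflMat] at this
    convert this using 4
    · linear_combination (2 * b₁ * r₁) * hI
    · linear_combination (-2 * c₁ * r₁) * hI
    · linear_combination (2 * b₂ * r₂) * hI
    · linear_combination (-2 * c₂ * r₂) * hI
  have hW := hlie hX hV
  rw [cornerMat_comm, cornerMat_comm] at hW
  have hT : η₁ (diagMat (8 * I * κ₁)) + η₂ (diagMat (-8 * I * κ₂)) ∈ L := by
    have := hlie hV hW
    rw [offMat_comm, offMat_comm] at this
    convert this using 4
    · linear_combination -8 * I * hκ₁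
    · linear_combination 8 * I * hκ₂
  have hU := L.add_mem (hlie hT hV) (hsm (-16 * κ₂) hW)
  rw [diagMat_comm, diagMat_comm, smul_offMat, smul_offMat, add_add_add_comm, ← map_add, ← map_add]
    at hU
  have hc : (κ₁ : ℂ) - κ₂ ≠ 0 := by exact_mod_cast sub_ne_zero.mpr hne
  have hW₁ : η₁ (offMat (2 * I * b₁ * r₁) (2 * I * c₁ * r₁)) + η₂ 0 ∈ L := by
    have := hsm (16 * (κ₁ - κ₂))⁻¹ hU
    convert this using 3
    · ext i j
      fin_cases i <;> fin_cases j <;> simp only [offMat] <;> simp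
      · field_simp
        ring
      · field_simp
        ring
    · ext i j
      fin_cases i <;> fin_cases j <;> simp only [offMat] <;> simp
      · right; ring
      · right; ring
  have hfin := hsm (8 * κ₁)⁻¹ (hlie hV hW₁)
  rw [mul_zero, zero_mul, sub_zero, smul_zero, map_zero, add_zero, offMat_comm, smul_diagMat] at hfin
  convert hfin using 3
  have hk : (κ₁ : ℂ) ≠ 0 := by exact_mod_cast h0
  push_cast
  field_simp
  linear_combination -8 * hκ₁

end TwoBlocks

/-! ### Generators of the unitary Lie algebra of `n` qubits -/

section Universality
open Complex ComplexConjugate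

variable {n : ℕ}

/-- Flipping bit `j`. -/
def flipBit (j : Fin n) (x : Fin n → Fin 2) : Fin n → Fin 2 := Function.update x j (1 - x j)

/-- The sign `(-1) ^ (x j)`: the eigenvalues of the Pauli matrix `Z` of qubit `j`. -/
def bitSign (j : Fin n) (x : Fin n → Fin 2) : ℝ := if x j = 0 then 1 else -1

/-- The Pauli matrix `X` of qubit `j`. -/
def flipMat (j : Fin n) : Matrix (Fin n → Fin 2) (Fin n → Fin 2) ℂ :=
  Matrix.of fun x y => if x = flipBit j y then 1 else 0

/-- A real function on bit strings as a diagonal matrix. -/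
def realDiag (f : (Fin n → Fin 2) → ℝ) : Matrix (Fin n → Fin 2) (Fin n → Fin 2) ℂ :=
  Matrix.diagonal fun x => (f x : ℂ)

/-- The difference of a function and its flip in bit `j`. -/
def bitDiff (j : Fin n) (f : (Fin n → Fin 2) → ℝ) : (Fin n → Fin 2) → ℝ :=
  fun x => f x - f (flipBit j x)

theorem flipBit_flipBit (j : Fin n) (x : Fin n → Fin 2) : flipBit j (flipBit j x) = x := by
  simp [flipBit]

theorem bitSign_flipBit_self (j : Fin n) (x : Fin n → Fin 2) :
    bitSign j (flipBit j x) = -bitSign j x := by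
  simp only [bitSign, flipBit, Function.update_self]
  generalize x j = a
  fin_cases a <;> simp

theorem bitSign_flipBit {j k : Fin n} (h : k ≠ j) (x : Fin n → Fin 2) :
    bitSign k (flipBit j x) = bitSign k x := by
  simp [bitSign, flipBit, Function.update_of_ne h]

theorem bitSign_mul_self (j : Fin n) (x : Fin n → Fin 2) : bitSign j x * bitSign j x = 1 := by
  rw [bitSign]; split_ifs <;> norm_num

theorem flipMat_mul_flipMat (j : Fin n) : flipMat j * flipMat j = 1 := by
  ext x y
  simp [flipMat, Matrix.mul_apply, Matrix.one_apply, flipBit_flipBit]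

theorem flipMat_mul_realDiag (j : Fin n) (f : (Fin n → Fin 2) → ℝ) :
    flipMat j * realDiag f = realDiag (fun x => f (flipBit j x)) * flipMat j := by
  ext x y
  simp only [realDiag, Matrix.mul_diagonal, Matrix.diagonal_mul, flipMat, Matrix.of_apply]
  split_ifs with h
  · rw [h, flipBit_flipBit]; ring
  · simp

theorem realDiag_mul (f g : (Fin n → Fin 2) → ℝ) :
    realDiag f * realDiag g = realDiag fun x => f x * g x := by
  simp [realDiag]

theorem realDiag_sub (f g : (Fin n → Fin 2) → ℝ) :
    realDiag f - realDiag g = realDiag fun x => f x - g x := by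
  simp [realDiag]

theorem realDiag_add (f g : (Fin n → Fin 2) → ℝ) :
    realDiag f + realDiag g = realDiag fun x => f x + g x := by
  simp [realDiag]

theorem smul_realDiag (c : ℝ) (f : (Fin n → Fin 2) → ℝ) :
    c • realDiag f = realDiag fun x => c * f x := by
  ext x y
  simp [realDiag, Matrix.diagonal_apply]

variable (L : LieSubalgebra ℝ (Matrix (Fin n → Fin 2) (Fin n → Fin 2) ℂ))

/-- The real functions on bit strings whose diagonal matrices, multiplied by `i`, lie in `L`. -/
def diagPart : Submodule ℝ ((Fin n → Fin 2) → ℝ) where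
  carrier := {f | I • realDiag f ∈ L}
  zero_mem' := by
    have : realDiag (0 : (Fin n → Fin 2) → ℝ) = 0 := by ext; simp [realDiag]
    simp [this]
  add_mem' {f g} hf hg := by
    have := L.add_mem hf hg
    rwa [← smul_add, realDiag_add] at this
  smul_mem' c f hf := by
    have := L.smul_mem c hf
    rwa [smul_comm, smul_realDiag] at this

variable {L}

theorem mem_diagPart {f : (Fin n → Fin 2) → ℝ} : f ∈ diagPart L ↔ I • realDiag f ∈ L := Iff.rfl

section
variable {j : Fin n} (hF : I • flipMat j ∈ L)
include hF

theorem bitDiff_flip_mem {f : (Fin n → Fin 2) → ℝ} (hf : f ∈ diagPart L) :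
    realDiag (bitDiff j f) * flipMat j ∈ L := by
  have := L.neg_mem (L.lie_mem hf hF)
  convert this using 1
  rw [Ring.lie_def, smul_mul_smul_comm, smul_mul_smul_comm, flipMat_mul_realDiag, ← smul_sub,
    ← sub_mul, realDiag_sub, I_mul_I, neg_one_smul, neg_neg]
  rfl

theorem bitDiff_mul_flip_mem {f g : (Fin n → Fin 2) → ℝ} (hf : f ∈ diagPart L)
    (hg : g ∈ diagPart L) :
    I • (realDiag (fun x => bitDiff j f x * bitDiff j g x) * flipMat j) ∈ L := by
  have key : I • (realDiag (fun x => bitDiff j f x * bitDiff j g x) * flipMat j) =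
      -⁅realDiag (bitDiff j f) * flipMat j, I • realDiag g⁆ := by
    rw [Ring.lie_def, mul_smul_comm, smul_mul_assoc, mul_assoc, flipMat_mul_realDiag, ← mul_assoc,
      ← mul_assoc, realDiag_mul, realDiag_mul, ← smul_sub, ← sub_mul, realDiag_sub, ← smul_neg,
      ← neg_mul]
    congr 2
    rw [← neg_one_smul ℝ, smul_realDiag]
    congr 1
    funext x
    simp only [bitDiff]
    ring
  rw [key]
  exact L.neg_mem (L.lie_mem (bitDiff_flip_mem hF hf) hg)

theorem bitDiff_mul_mul_mem {f g h : (Fin n → Fin 2) → ℝ} (hf : f ∈ diagPart L)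
    (hg : g ∈ diagPart L) (hh : h ∈ diagPart L) :
    (fun x => bitDiff j f x * bitDiff j g x * bitDiff j h x) ∈ diagPart L := by
  have h1 := L.lie_mem (bitDiff_mul_flip_mem hF hf hg) hh
  have h2 : realDiag (fun x => bitDiff j f x * bitDiff j g x * bitDiff j h x) * flipMat j ∈ L := by
    convert h1 using 1
    rw [Ring.lie_def, smul_mul_smul_comm, smul_mul_smul_comm, mul_assoc, flipMat_mul_realDiag,
      ← mul_assoc, ← mul_assoc, realDiag_mul, realDiag_mul, ← smul_sub, ← sub_mul, realDiag_sub,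
      I_mul_I, neg_one_smul, ← neg_mul]
    congr 1
    rw [← neg_one_smul ℝ, smul_realDiag]
    congr 1
    funext x
    simp only [bitDiff]
    ring
  have h3 := L.smul_mem (2⁻¹ : ℝ) (L.lie_mem h2 hF)
  rw [mem_diagPart]
  convert h3 using 1
  rw [Ring.lie_def, mul_smul_comm, smul_mul_assoc, mul_assoc, flipMat_mul_flipMat, mul_one,
    ← mul_assoc, flipMat_mul_realDiag, mul_assoc, flipMat_mul_flipMat, mul_one, ← smul_sub,
    realDiag_sub, smul_comm, smul_realDiag]
  congr 2
  funext x
  simp only [bitDiff, flipBit_flipBit]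
  ring

theorem bitDiff_mem {f : (Fin n → Fin 2) → ℝ} (hf : f ∈ diagPart L) : bitDiff j f ∈ diagPart L := by
  have h3 := L.smul_mem (2⁻¹ : ℝ) (L.lie_mem (bitDiff_flip_mem hF hf) hF)
  rw [mem_diagPart]
  convert h3 using 1
  rw [Ring.lie_def, mul_smul_comm, smul_mul_assoc, mul_assoc, flipMat_mul_flipMat, mul_one,
    ← mul_assoc, flipMat_mul_realDiag, mul_assoc, flipMat_mul_flipMat, mul_one, ← smul_sub,
    realDiag_sub, smul_comm, smul_realDiag]
  congr 2
  funext x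
  simp only [bitDiff, flipBit_flipBit]
  ring

/-- The functions `A` that do not depend on bit `j` and have `Z_j A` in the diagonal part of `L`
are closed under multiplication. -/
theorem bitSign_mul_mul_mem {A B : (Fin n → Fin 2) → ℝ} (hZ : bitSign j ∈ diagPart L)
    (hA : ∀ x, A (flipBit j x) = A x) (hB : ∀ x, B (flipBit j x) = B x)
    (hA' : (fun x => bitSign j x * A x) ∈ diagPart L)
    (hB' : (fun x => bitSign j x * B x) ∈ diagPart L) :
    (fun x => bitSign j x * (A x * B x)) ∈ diagPart L := by
  have := (diagPart L).smul_mem (8⁻¹ : ℝ) (bitDiff_mul_mul_mem hF hA' hB' hZ)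
  convert this using 1
  funext x
  simp only [bitDiff, bitSign_flipBit_self, hA, hB, Pi.smul_apply, smul_eq_mul]
  linear_combination (-(A x * B x * bitSign j x)) * bitSign_mul_self j x

end

/-- The rotation generators of the plane spanned by the basis vectors `a` and `b`. -/
def HasRotations {X : Type} [Fintype X] [DecidableEq X] (L : LieSubalgebra ℝ (Matrix X X ℂ))
    (a b : X) : Prop :=
  (Matrix.single a b 1 - Matrix.single b a 1 : Matrix X X ℂ) ∈ L ∧
    I • (Matrix.single a b 1 + Matrix.single b a 1 : Matrix X X ℂ) ∈ L

section
variable {X : Type} [Fintype X] [DecidableEq X] {L : LieSubalgebra ℝ (Matrix X X ℂ)}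

theorem HasRotations.trans {a b c : X} (h1 : HasRotations L a b) (h2 : HasRotations L b c)
    (hab : a ≠ b) (hbc : b ≠ c) (hac : a ≠ c) : HasRotations L a c := by
  constructor
  · convert L.lie_mem h1.1 h2.1 using 1
    simp [Ring.lie_def, mul_sub, sub_mul, hab, hab.symm, hbc, hbc.symm, hac, hac.symm]
  · convert L.lie_mem h1.1 h2.2 using 1
    simp [Ring.lie_def, mul_add, add_mul, mul_sub, sub_mul, hab, hab.symm, hbc, hbc.symm, hac,
      hac.symm]

/-- A Lie algebra with all plane rotations and the scalar `i` contains every skew-Hermitian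
matrix. -/
theorem I_smul_mem_of_hasRotations (h1 : I • (1 : Matrix X X ℂ) ∈ L)
    (h : ∀ a b, a ≠ b → HasRotations L a b) {H : Matrix X X ℂ} (hH : H.IsHermitian) :
    I • H ∈ L := by
  have hdiff : ∀ a b : X, I • (Matrix.single a a 1 - Matrix.single b b 1 : Matrix X X ℂ) ∈ L := by
    intro a b
    by_cases hab : a = b
    · simp [hab]
    · have := L.smul_mem (2⁻¹ : ℝ) (L.lie_mem (h a b hab).1 (h a b hab).2)
      convert this using 1
      rw [Ring.lie_def, mul_smul_comm, smul_mul_assoc, ← smul_sub, smul_comm (2⁻¹ : ℝ)]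
      congr 1
      simp only [mul_add, add_mul, mul_sub, sub_mul, Matrix.single_mul_single_same, mul_one,
        Matrix.single_mul_single_of_ne _ _ _ _ hab, Matrix.single_mul_single_of_ne _ _ _ _ (Ne.symm hab)]
      module
  have hdiag : ∀ a : X, I • (Matrix.single a a 1 : Matrix X X ℂ) ∈ L := by
    intro a
    have hN : (Fintype.card X : ℝ) ≠ 0 := by
      have : Nonempty X := ⟨a⟩
      exact_mod_cast Fintype.card_ne_zero
    have h2 := L.smul_mem (Fintype.card X : ℝ)⁻¹
      (L.add_mem h1 (sum_mem (S := L.toSubmodule) fun b (_ : b ∈ Finset.univ) => hdiff a b))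
    convert h2 using 1
    rw [← Finset.smul_sum, Finset.sum_sub_distrib, ← smul_add, Matrix.sum_single_one,
      add_sub_cancel, Finset.sum_const, Finset.card_univ, smul_comm, ← Nat.cast_smul_eq_nsmul ℝ,
      smul_smul, inv_mul_cancel₀ hN, one_smul]
  have hterm : ∀ a b : X, I • (Matrix.single a b (H a b) + Matrix.single b a (conj (H a b))) ∈ L := by
    intro a b
    by_cases hab : a = b
    · subst hab
      have h2 := L.smul_mem (2 * (H a a).re) (hdiag a)
      convert h2 using 1
      ext x y
      simp only [Matrix.smul_apply, Matrix.add_apply, Matrix.single_apply]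
      split_ifs
      · rw [add_conj]; simp [mul_comm]
      · simp
    · have h2 := L.sub_mem (L.smul_mem (H a b).re (h a b hab).2)
        (L.smul_mem (H a b).im (h a b hab).1)
      convert h2 using 1
      have hz : H a b = (H a b).re + (H a b).im * I := (re_add_im _).symm
      have hc : conj (H a b) = (H a b).re - (H a b).im * I := by
        apply Complex.ext <;> simp
      ext x y
      simp only [Matrix.smul_apply, Matrix.add_apply, Matrix.sub_apply, Matrix.single_apply]
      have h_I := I_mul_I
      split_ifs with h3 h4 h4
      · exact absurd (h3.1.trans h4.1.symm) hab
      · simp only [add_zero, sub_zero, smul_eq_mul, real_smul, mul_one]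
        linear_combination I * hz + ((H a b).im : ℂ) * h_I
      · simp only [zero_add, zero_sub, smul_eq_mul, real_smul, mul_one]
        linear_combination I * hc - ((H a b).im : ℂ) * h_I
      · simp
  have h3 := L.smul_mem (2⁻¹ : ℝ) (sum_mem (S := L.toSubmodule) fun a (_ : a ∈ Finset.univ) =>
    sum_mem (S := L.toSubmodule) fun b (_ : b ∈ Finset.univ) => hterm a b)
  convert h3 using 1
  simp only [← Finset.smul_sum, Finset.sum_add_distrib]
  have e1 : ∑ a, ∑ b, Matrix.single a b (H a b) = H := (Matrix.matrix_eq_sum_single H).symm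
  have e2 : ∑ a, ∑ b, Matrix.single b a (conj (H a b)) = H := by
    rw [Finset.sum_comm]
    conv_rhs => rw [Matrix.matrix_eq_sum_single H]
    refine Finset.sum_congr rfl fun b _ => Finset.sum_congr rfl fun a _ => ?_
    rw [← hH.apply b a]; rfl
  rw [e1, e2, smul_comm, ← two_smul ℝ H, smul_smul]
  norm_num

end

/-- Skew-Hermitian matrices on `n` qubits are generated by the scalars, the one-qubit rotations and
the controlled phases of neighbouring qubits. -/
theorem I_smul_mem_of_qubits {L : LieSubalgebra ℝ (Matrix (Fin n → Fin 2) (Fin n → Fin 2) ℂ)}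
    (h1 : I • (1 : Matrix (Fin n → Fin 2) (Fin n → Fin 2) ℂ) ∈ L)
    (hZ : ∀ j : Fin n, I • realDiag (bitSign j) ∈ L) (hF : ∀ j : Fin n, I • flipMat j ∈ L)
    (hP : ∀ j k : Fin n, (j : ℕ) + 1 = k →
      I • realDiag (fun x => if x j = 0 ∧ x k = 0 then 1 else 0) ∈ L)
    {H : Matrix (Fin n → Fin 2) (Fin n → Fin 2) ℂ} (hH : H.IsHermitian) : I • H ∈ L := by
  -- `Z_j Z_k` for neighbours: the controlled phase is `(1 + Z_j) (1 + Z_k) / 4`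
  have adj : ∀ j k : Fin n, (j : ℕ) + 1 = k →
      (fun x => bitSign j x * bitSign k x) ∈ diagPart L := by
    intro j k hjk
    have hne : k ≠ j := by intro h; subst h; omega
    have h2 := (diagPart L).sub_mem ((diagPart L).smul_mem (2 : ℝ) (bitDiff_mem (hF j) (hP j k hjk)))
      (hZ j)
    convert h2 using 1
    funext x
    simp only [bitDiff, bitSign, flipBit, Pi.sub_apply, Pi.smul_apply, Function.update_self,
      Function.update_of_ne hne, smul_eq_mul]
    generalize x j = a
    generalize x k = b
    fin_cases a <;> fin_cases b <;> norm_num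
  -- `Z_j Z_k` in general, by multiplying along the qubits between `j` and `k`
  have dist : ∀ d : ℕ, ∀ j k : Fin n, (j : ℕ) + 1 + d = k →
      (fun x => bitSign j x * bitSign k x) ∈ diagPart L := by
    intro d
    induction d with
    | zero => exact fun j k h => adj j k h
    | succ d ih =>
      intro j k h
      let m : Fin n := ⟨j + 1 + d, by omega⟩
      have hm : (m : ℕ) = j + 1 + d := rfl
      have hjm : j ≠ m := by intro h; rw [← h] at hm; omega
      have hkm : k ≠ m := by intro h; rw [← h] at hm; omega
      have hkj : k ≠ j := by intro h; subst h; omega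
      have e1 := ih j m rfl
      have e2 := adj m k h
      have e3 := bitSign_mul_mul_mem (hF m) (hZ m) (bitSign_flipBit hjm) (bitSign_flipBit hkm)
        (by simpa only [mul_comm] using e1) e2
      have e4 := bitSign_mul_mul_mem (B := fun x => bitSign m x * bitSign k x) (hF j) (hZ j)
        (bitSign_flipBit hjm.symm)
        (fun x => by simp only [bitSign_flipBit hjm.symm, bitSign_flipBit hkj]) e1
        (by convert e3 using 1; funext x; ring)
      convert e4 using 1
      funext x
      linear_combination (-(bitSign j x * bitSign k x)) * bitSign_mul_self m x
  have pair : ∀ j k : Fin n, k ≠ j → (fun x => bitSign j x * bitSign k x) ∈ diagPart L := by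
    intro j k h
    rcases lt_or_gt_of_ne h with h | h
    · have := dist (j - (k + 1)) k j (by have : (k : ℕ) < j := h; omega)
      simpa only [mul_comm] using this
    · exact dist (k - (j + 1)) j k (by have : (j : ℕ) < k := h; omega)
  -- the projection onto the strings that agree with `a` away from bit `j`, times `Z_j`
  have ind : ∀ (j : Fin n) (a : Fin n → Fin 2) (S : Finset (Fin n)), j ∉ S →
      (fun x => bitSign j x * ∏ k ∈ S, (1 + bitSign k a * bitSign k x) / 2) ∈ diagPart L := by
    intro j a S
    induction S using Finset.induction_on with
    | empty => intro _; simp only [Finset.prod_empty, mul_one]; exact hZ j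
    | insert k S hk ih =>
      intro hj
      have hkj : k ≠ j := fun h => hj (h ▸ Finset.mem_insert_self k S)
      have hjS : j ∉ S := fun h => hj (Finset.mem_insert_of_mem h)
      simp only [Finset.prod_insert hk]
      refine bitSign_mul_mul_mem (hF j) (hZ j) (fun x => by rw [bitSign_flipBit hkj]) (fun x => ?_)
        ?_ (ih hjS)
      · refine Finset.prod_congr rfl fun i hi => ?_
        rw [bitSign_flipBit (ne_of_mem_of_not_mem hi hjS)]
      · have := (diagPart L).add_mem ((diagPart L).smul_mem (2⁻¹ : ℝ) (hZ j))
          ((diagPart L).smul_mem (bitSign k a / 2) (pair j k hkj))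
        convert this using 1
        funext x
        simp only [Pi.add_apply, Pi.smul_apply, smul_eq_mul]
        ring
  have prodval : ∀ (j : Fin n) (a x : Fin n → Fin 2),
      ∏ k ∈ Finset.univ.erase j, (1 + bitSign k a * bitSign k x) / 2 =
        if x = a ∨ x = flipBit j a then (1 : ℝ) else 0 := by
    intro j a x
    have hfac : ∀ k, (1 + bitSign k a * bitSign k x) / 2 = if x k = a k then (1 : ℝ) else 0 := by
      intro k
      simp only [bitSign]
      generalize x k = u
      generalize a k = v
      fin_cases u <;> fin_cases v <;> norm_num
    simp only [hfac]
    split_ifs with h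
    · refine Finset.prod_eq_one fun k hk => if_pos ?_
      rcases h with rfl | rfl
      · rfl
      · rw [flipBit, Function.update_of_ne (Finset.ne_of_mem_erase hk)]
    · by_contra h0
      have h2 : ∀ k, k ≠ j → x k = a k := by
        intro k hk
        by_contra h3
        exact h0 (Finset.prod_eq_zero (Finset.mem_erase.mpr ⟨hk, Finset.mem_univ k⟩) (if_neg h3))
      apply h
      by_cases h4 : x j = a j
      · left; funext k
        by_cases hk : k = j
        · rw [hk, h4]
        · exact h2 k hk
      · right; funext k
        by_cases hk : k = j
        · subst hk
          rw [flipBit, Function.update_self]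
          revert h4
          generalize x k = u
          generalize a k = v
          revert u v
          decide
        · rw [flipBit, Function.update_of_ne hk, h2 k hk]
  -- hence the plane rotations along the edges of the hypercube of bit strings
  have base : ∀ (j : Fin n) (a : Fin n → Fin 2), HasRotations L a (flipBit j a) := by
    intro j a
    have hf := ind j a (Finset.univ.erase j) (Finset.notMem_erase j _)
    simp only [prodval] at hf
    have hne : a ≠ flipBit j a := by
      intro h
      have := congrFun h j
      rw [flipBit, Function.update_self] at this
      revert this
      generalize a j = v
      revert v
      decide
    have hflip : ∀ x y : Fin n → Fin 2, flipBit j x = y ↔ x = flipBit j y := fun x y =>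
      ⟨fun h => by rw [← h, flipBit_flipBit], fun h => by rw [h, flipBit_flipBit]⟩
    have hs := bitSign_mul_self j a
    constructor
    · have h2 := L.smul_mem (bitSign j a / 2) (bitDiff_flip_mem (hF j) hf)
      convert h2 using 1
      ext x y
      simp only [Matrix.sub_apply, Matrix.single_apply, Matrix.smul_apply, realDiag,
        Matrix.diagonal_mul, bitDiff, flipMat, Matrix.of_apply, bitSign_flipBit_self, hflip,
        flipBit_flipBit]
      by_cases hx : x = a
      · subst hx
        by_cases hy : y = flipBit j x
        · subst hy
          have : (bitSign j x : ℂ) * bitSign j x = 1 := by exact_mod_cast hs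
          simp [hne, flipBit_flipBit]
          linear_combination -this
        · have : ¬ x = flipBit j y := fun h => hy ((hflip x y).mpr h).symm
          simp [this]
          exact fun h => absurd h hne
      · by_cases hx' : x = flipBit j a
        · subst hx'
          by_cases hy : y = a
          · subst hy
            have : (bitSign j y : ℂ) * bitSign j y = 1 := by exact_mod_cast hs
            simp [hne, hne.symm, flipBit_flipBit, bitSign_flipBit_self]
            linear_combination this
          · have : ¬ flipBit j a = flipBit j y := fun h => hy (by
              rw [← flipBit_flipBit j y, ← h, flipBit_flipBit])
            simp [this, Ne.symm hy, hne]
        · simp [hx, hx', Ne.symm hx]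
          exact fun h => absurd ((hflip x a).mp h.symm) hx'
    · have h2 := L.smul_mem (4⁻¹ : ℝ) (bitDiff_mul_flip_mem (hF j) hf (hZ j))
      convert h2 using 1
      ext x y
      simp only [Matrix.add_apply, Matrix.single_apply, Matrix.smul_apply, realDiag,
        Matrix.diagonal_mul, bitDiff, flipMat, Matrix.of_apply, bitSign_flipBit_self, hflip,
        flipBit_flipBit]
      by_cases hx : x = a
      · subst hx
        by_cases hy : y = flipBit j x
        · subst hy
          have : (bitSign j x : ℂ) * bitSign j x = 1 := by exact_mod_cast hs
          simp [hne, flipBit_flipBit]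
          linear_combination (-I) * this
        · have : ¬ x = flipBit j y := fun h => hy ((hflip x y).mpr h).symm
          simp [this]
          exact fun h => absurd h hne
      · by_cases hx' : x = flipBit j a
        · subst hx'
          by_cases hy : y = a
          · subst hy
            have : (bitSign j y : ℂ) * bitSign j y = 1 := by exact_mod_cast hs
            simp [hne, hne.symm, flipBit_flipBit, bitSign_flipBit_self]
            linear_combination (-I) * this
          · have : ¬ flipBit j a = flipBit j y := fun h => hy (by
              rw [← flipBit_flipBit j y, ← h, flipBit_flipBit])
            simp [this, Ne.symm hy, hne]
        · simp [hx, hx', Ne.symm hx]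
          exact fun h => absurd ((hflip x a).mp h.symm) hx'
  refine I_smul_mem_of_hasRotations h1 ?_ hH
  have all : ∀ (S : Finset (Fin n)) (a b : Fin n → Fin 2), a ≠ b → (∀ i, i ∉ S → a i = b i) →
      HasRotations L a b := by
    intro S
    induction S using Finset.induction_on with
    | empty => intro a b hab h; exact absurd (funext fun i => h i (Finset.notMem_empty i)) hab
    | insert i S _ ih =>
      intro a b hab h
      by_cases hi : a i = b i
      · refine ih a b hab fun k hk => ?_
        by_cases hki : k = i
        · rw [hki, hi]
        · exact h k (by simp [hki, hk])
      · have hfi : flipBit i a i = b i := by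
          rw [flipBit, Function.update_self]
          revert hi
          generalize a i = u
          generalize b i = v
          revert u v
          decide
        by_cases hc : flipBit i a = b
        · exact hc ▸ base i a
        · refine (base i a).trans (ih _ b hc fun k hk => ?_) (fun h => hi ?_) hc hab
          · by_cases hki : k = i
            · rw [hki, hfi]
            · rw [flipBit, Function.update_of_ne hki]; exact h k (by simp [hki, hk])
          · rw [← hfi, ← h]
  exact fun a b hab => all Finset.univ a b hab fun i hi => absurd (Finset.mem_univ i) hi

end Universality

/-! ### Unitary matrices as exponentials -/

section Cayley
open Complex ComplexConjugate
variable {X : Type} [Fintype X] [DecidableEq X]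

theorem one_sub_I_mul_ne_zero (t : ℝ) : (1 - I * t : ℂ) ≠ 0 := by
  intro h
  have := congrArg re h
  simp at this

theorem exists_cayley_angle (t : ℝ) : ∃ θ : ℝ, (1 + I * t) / (1 - I * t) = exp (I * θ) := by
  refine ⟨arg ((1 + I * t) / (1 - I * t)), ?_⟩
  have h : ‖(1 + I * t : ℂ) / (1 - I * t)‖ = 1 := by
    rw [norm_div, div_eq_one_iff_eq (norm_ne_zero_iff.mpr (one_sub_I_mul_ne_zero t)),
      ← RCLike.norm_conj]
    congr 1
    simp [sub_eq_add_neg]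
  conv_lhs => rw [← norm_mul_exp_arg_mul_I ((1 + I * t : ℂ) / (1 - I * t)), h]
  rw [ofReal_one, one_mul, mul_comm]

/-- The Cayley transform: a unitary matrix without eigenvalue `-1` is the exponential of a
skew-Hermitian one. -/
theorem exists_exp_of_isUnit_one_add {V : Matrix X X ℂ} (hV : Vᴴ * V = 1) (h : IsUnit (1 + V)) :
    ∃ H : Matrix X X ℂ, H.IsHermitian ∧ V = NormedSpace.exp (I • H) := by
  obtain ⟨u, hu⟩ := h
  obtain ⟨W, hW1⟩ : ∃ W, (1 + V) * W = 1 := ⟨_, by rw [← hu]; exact u.mul_inv⟩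
  have hA : (I • ((1 - V) * W)).IsHermitian := by
    have e1 : Wᴴ * (1 + Vᴴ) = 1 := by
      have := congrArg Matrix.conjTranspose hW1
      simpa [Matrix.conjTranspose_mul] using this
    have e2 : -((1 - Vᴴ) * (1 + V)) = (1 + Vᴴ) * (1 - V) := by
      simp only [mul_add, mul_sub, sub_mul, add_mul, hV]; noncomm_ring
    rw [Matrix.IsHermitian, Matrix.conjTranspose_smul, Matrix.conjTranspose_mul,
      Matrix.conjTranspose_sub, Matrix.conjTranspose_one]
    have e3 : Wᴴ * (1 - Vᴴ) = -((1 - V) * W) := by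
      calc Wᴴ * (1 - Vᴴ) = Wᴴ * (-(-((1 - Vᴴ) * (1 + V))) * W) := by
            rw [neg_neg, mul_assoc, hW1, mul_one]
        _ = -(Wᴴ * (1 + Vᴴ) * ((1 - V) * W)) := by rw [e2]; noncomm_ring
        _ = _ := by rw [e1, one_mul]
    rw [e3]; simp
  set A := I • ((1 - V) * W) with hAdef
  have hIA : I • A = -((1 - V) * W) := by rw [hAdef, smul_smul, I_mul_I, neg_one_smul]
  have hmain : V * (1 - I • A) = 1 + I • A := by
    rw [hIA]
    have e4 : V * (1 + V) = (1 + V) * V := by noncomm_ring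
    calc V * (1 - -((1 - V) * W)) = V * (((1 + V) * W) + (1 - V) * W) := by
          rw [hW1, sub_neg_eq_add]
      _ = (1 + V) * W + -((1 - V) * W) := by noncomm_ring
      _ = _ := by rw [hW1]
  set P : Matrix X X ℂ := (hA.eigenvectorUnitary : Matrix X X ℂ) with hP
  have hP1 : Pᴴ * P = 1 := Unitary.coe_star_mul_self hA.eigenvectorUnitary
  have hP2 : P * Pᴴ = 1 := Unitary.coe_mul_star_self hA.eigenvectorUnitary
  have hspec : A = P * Matrix.diagonal (fun i => (hA.eigenvalues i : ℂ)) * Pᴴ := by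
    conv_lhs => rw [hA.spectral_theorem, Unitary.conjStarAlgAut_apply]
    rfl
  choose θ hθ using fun i => exists_cayley_angle (hA.eigenvalues i)
  refine ⟨P * Matrix.diagonal (fun i => (θ i : ℂ)) * Pᴴ, ?_, ?_⟩
  · rw [Matrix.IsHermitian, Matrix.conjTranspose_mul, Matrix.conjTranspose_mul,
      Matrix.conjTranspose_conjTranspose, Matrix.diagonal_conjTranspose, mul_assoc]
    congr 3
    ext i
    simp
  · have e5 : I • (P * Matrix.diagonal (fun i => (θ i : ℂ)) * Pᴴ) =
        P * Matrix.diagonal (fun i => I * (θ i : ℂ)) * Pᴴ := by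
      have : Matrix.diagonal (fun i => I * (θ i : ℂ)) = I • Matrix.diagonal (fun i => (θ i : ℂ)) := by
        rw [← Matrix.diagonal_smul]; rfl
      rw [this, Matrix.mul_smul, Matrix.smul_mul]
    have hPinv : Pᴴ = P⁻¹ := (Matrix.inv_eq_left_inv hP1).symm
    have hPu : IsUnit P := ⟨⟨P, Pᴴ, hP2, hP1⟩, rfl⟩
    rw [e5, hPinv, Matrix.exp_conj _ _ hPu, ← hPinv, Matrix.exp_diagonal]
    have e6 : NormedSpace.exp (fun i => I * (θ i : ℂ)) =
        fun i => (1 + I * (hA.eigenvalues i : ℂ)) / (1 - I * (hA.eigenvalues i : ℂ)) := by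
      funext i
      rw [Pi.coe_exp, hθ, Complex.exp_eq_exp_ℂ]
    rw [e6]
    set Λ : X → ℂ := fun i => (hA.eigenvalues i : ℂ) with hΛ
    have e7 : ∀ z : ℂ, 1 + z • A = P * Matrix.diagonal (fun i => 1 + z * Λ i) * Pᴴ := by
      intro z
      have : Matrix.diagonal (fun i => 1 + z * Λ i) = 1 + z • Matrix.diagonal Λ := by
        rw [← Matrix.diagonal_smul, ← Matrix.diagonal_one, Matrix.diagonal_add]; rfl
      rw [this, mul_add, add_mul, mul_one, hP2, Matrix.mul_smul, Matrix.smul_mul, ← hspec]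
    have e8 : 1 - I • A = P * Matrix.diagonal (fun i => 1 - I * Λ i) * Pᴴ := by
      have := e7 (-I)
      simpa only [neg_smul, ← sub_eq_add_neg, neg_mul] using this
    rw [e8, e7] at hmain
    have e9 : V * P * Matrix.diagonal (fun i => 1 - I * Λ i) =
        P * Matrix.diagonal (fun i => 1 + I * Λ i) := by
      have := congrArg (· * P) hmain
      simpa only [mul_assoc, hP1, mul_one] using this
    have e10 : V * P = P * Matrix.diagonal (fun i => (1 + I * Λ i) / (1 - I * Λ i)) := by
      have := congrArg (· * Matrix.diagonal (fun i => (1 - I * Λ i)⁻¹)) e9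
      simp only [mul_assoc, Matrix.diagonal_mul_diagonal] at this
      have h1 : (fun i => (1 - I * Λ i) * (1 - I * Λ i)⁻¹) = fun _ => 1 := by
        funext i; exact mul_inv_cancel₀ (one_sub_I_mul_ne_zero _)
      rw [h1, Matrix.diagonal_one, mul_one] at this
      rw [this]; rfl
    rw [← e10, mul_assoc, hP2, mul_one]

/-- Only finitely many points of the unit circle are eigenvalues of `-U`. -/
theorem exists_phase_isUnit (U : Matrix X X ℂ) : ∃ z : ℂ, ‖z‖ = 1 ∧ IsUnit (z • 1 + U) := by
  by_contra! h
  have hsub : Metric.sphere (0 : ℂ) 1 ⊆ {z | ((-U).charpoly).IsRoot z} := by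
    intro z hz
    have := h z (by simpa using hz)
    rw [Matrix.isUnit_iff_isUnit_det, isUnit_iff_ne_zero, not_not] at this
    rw [Set.mem_ofPred_eq, Polynomial.IsRoot, Matrix.eval_charpoly, ← this]
    congr 1
    rw [sub_neg_eq_add, Matrix.scalar_apply, Matrix.smul_one_eq_diagonal]
  have hfin := (Polynomial.finite_setOfPred_isRoot (Matrix.charpoly_monic (-U)).ne_zero).subset hsub
  have hinf : (Metric.sphere (0 : ℂ) 1).Infinite := by
    have : Set.InjOn (fun t : ℝ => exp (t * I)) (Set.Ioc (-Real.pi) Real.pi) := by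
      intro a ha b hb hab
      have := congrArg arg hab
      simpa only [arg_exp_mul_I, toIocMod_eq_self, (toIocMod_eq_self Real.two_pi_pos).mpr
        (show a ∈ Set.Ioc (-Real.pi) (-Real.pi + 2 * Real.pi) by convert ha using 2; ring),
        (toIocMod_eq_self Real.two_pi_pos).mpr
        (show b ∈ Set.Ioc (-Real.pi) (-Real.pi + 2 * Real.pi) by convert hb using 2; ring)] using this
    refine ((Set.Ioc_infinite (by linarith [Real.pi_pos])).image this).mono ?_
    rintro _ ⟨t, -, rfl⟩
    simp [norm_exp_ofReal_mul_I]
  exact hinf hfin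

/-- Every unitary matrix is, up to a phase, the exponential of a skew-Hermitian matrix. -/
theorem exists_phase_smul_exp {U : Matrix X X ℂ} (hU : Uᴴ * U = 1) :
    ∃ z : ℂ, ‖z‖ = 1 ∧ ∃ H : Matrix X X ℂ, H.IsHermitian ∧ U = z • NormedSpace.exp (I • H) := by
  obtain ⟨z, hz, hu⟩ := exists_phase_isUnit U
  have hz0 : z ≠ 0 := norm_ne_zero_iff.mp (by rw [hz]; exact one_ne_zero)
  have hV : (z⁻¹ • U)ᴴ * (z⁻¹ • U) = 1 := by
    have : z⁻¹ * conj (z⁻¹) = 1 := by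
      rw [mul_conj, normSq_eq_norm_sq, norm_inv, hz]; simp
    rw [Matrix.conjTranspose_smul, Matrix.smul_mul, Matrix.mul_smul, hU, smul_smul, mul_comm]
    change (z⁻¹ * conj z⁻¹) • (1 : Matrix X X ℂ) = 1
    rw [this, one_smul]
  have hu' : IsUnit (1 + z⁻¹ • U) := by
    have : 1 + z⁻¹ • U = z⁻¹ • (z • 1 + U) := by
      rw [smul_add, smul_smul, inv_mul_cancel₀ hz0, one_smul]
    rw [this]
    exact hu.smul (Units.mk0 z⁻¹ (inv_ne_zero hz0))
  obtain ⟨H, hH, h⟩ := exists_exp_of_isUnit_one_add hV hu'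
  exact ⟨z, hz, H, hH, by rw [← h, smul_smul, mul_inv_cancel₀ hz0, one_smul]⟩

end Cayley

/-! ### Coefficient matrices reached by a monoid of operators -/

section Reach
variable {N M X T C D : Type} [Fintype N] [DecidableEq N] [Fintype X] [DecidableEq X] [Fintype T]
  [DecidableEq T]

/-- The family of vectors obtained from the family `vec` by the coefficient matrix `A`, that is,
`y ↦ ∑ₓ A x y • vec x`. The vectors are matrices, and depend on a parameter in `C`. -/
def recombine (vec : X → C → Matrix N M ℂ) (A : Matrix X X ℂ) : X → C → Matrix N M ℂ :=
  fun y c => ∑ x, A x y • vec x c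

/-- The families obtained from `vec` by multiplication with an operator in `𝒜`. -/
def orbit (𝒜 : Submonoid (Matrix N N ℂ)) (vec : X → C → Matrix N M ℂ) :
    Set (X → C → Matrix N M ℂ) :=
  {f | ∃ P ∈ 𝒜, f = fun y c => P * vec y c}

theorem continuous_recombine (vec : X → C → Matrix N M ℂ) : Continuous (recombine vec) := by
  refine continuous_pi fun y => continuous_pi fun c => ?_
  refine continuous_finsetSum _ fun x _ => ?_
  exact ((continuous_id (X := Matrix X X ℂ)).matrix_elem x y).smul continuous_const

/-- The coefficient matrices by which the operators in `𝒜`, or limits of such operators, act on the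
span of the family `vec`. -/
def reach (𝒜 : Submonoid (Matrix N N ℂ)) (vec : X → C → Matrix N M ℂ) :
    Submonoid (Matrix X X ℂ) where
  carrier := {A | recombine vec A ∈ closure (orbit 𝒜 vec)}
  one_mem' := by
    refine subset_closure ⟨1, 𝒜.one_mem, ?_⟩
    funext y c
    simp [recombine, Matrix.one_apply, ite_smul]
  mul_mem' {A B} hA hB := by
    have hcont : Continuous fun (f : X → C → Matrix N M ℂ) y c => ∑ z, B z y • f z c := by
      fun_prop
    have hmaps : Set.MapsTo (fun (f : X → C → Matrix N M ℂ) y c => ∑ z, B z y • f z c)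
        (orbit 𝒜 vec) (closure (orbit 𝒜 vec)) := by
      rintro f ⟨P, hP, rfl⟩
      have hP' : Continuous fun (f : X → C → Matrix N M ℂ) y c => P * f y c := by
        refine continuous_pi fun y => continuous_pi fun c => ?_
        exact continuous_const.matrix_mul (by fun_prop)
      have := map_mem_closure hP' hB (t := orbit 𝒜 vec) (by
        rintro f ⟨Q, hQ, rfl⟩
        exact ⟨P * Q, 𝒜.mul_mem hP hQ, by simp only [Matrix.mul_assoc]⟩)
      convert this using 3 with y c
      simp [recombine, Matrix.mul_sum]
    have := map_mem_closure hcont hA hmaps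
    rw [closure_closure] at this
    change recombine vec (A * B) ∈ closure (orbit 𝒜 vec)
    convert this using 3 with y c
    simp only [recombine, Matrix.mul_apply, Finset.sum_smul, Finset.smul_sum, smul_smul]
    rw [Finset.sum_comm]
    simp only [mul_comm]

theorem mem_reach {𝒜 : Submonoid (Matrix N N ℂ)} {vec : X → C → Matrix N M ℂ} {A : Matrix X X ℂ} :
    A ∈ reach 𝒜 vec ↔ recombine vec A ∈ closure (orbit 𝒜 vec) := Iff.rfl

theorem isClosed_reach (𝒜 : Submonoid (Matrix N N ℂ)) (vec : X → C → Matrix N M ℂ) :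
    IsClosed (reach 𝒜 vec : Set (Matrix X X ℂ)) :=
  isClosed_closure.preimage (continuous_recombine vec)

theorem mem_reach_of_acts {𝒜 : Submonoid (Matrix N N ℂ)} {vec : X → C → Matrix N M ℂ}
    {A : Matrix X X ℂ} {P : Matrix N N ℂ} (hP : P ∈ 𝒜)
    (h : ∀ y c, P * vec y c = ∑ x, A x y • vec x c) : A ∈ reach 𝒜 vec :=
  subset_closure ⟨P, hP, by funext y c; exact (h y c).symm⟩

/-- An invertible operator in `𝒜` that acts on the family by an invertible coefficient matrix. -/
theorem mem_invertibleIn_reach {𝒜 : Submonoid (Matrix N N ℂ)} {vec : X → C → Matrix N M ℂ}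
    {A : (Matrix X X ℂ)ˣ} {P P' : Matrix N N ℂ} (hP : P ∈ 𝒜) (hP' : P' ∈ 𝒜) (hPP : P' * P = 1)
    (h : ∀ y c, P * vec y c = ∑ x, (A : Matrix X X ℂ) x y • vec x c) :
    A ∈ invertibleIn (reach 𝒜 vec) := by
  refine ⟨mem_reach_of_acts hP h, mem_reach_of_acts hP' fun y c => ?_⟩
  have h1 : vec y c = ∑ x, ((A⁻¹ : (Matrix X X ℂ)ˣ) : Matrix X X ℂ) x y • (P * vec x c) := by
    simp only [h, Finset.smul_sum, smul_smul]
    rw [Finset.sum_comm]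
    simp only [← Finset.sum_smul, mul_comm _ ((A : Matrix X X ℂ) _ _), ← Matrix.mul_apply, A.mul_inv]
    simp [Matrix.one_apply, ite_smul]
  conv_lhs => rw [h1]
  simp only [Matrix.mul_sum, Matrix.mul_smul, ← Matrix.mul_assoc, hPP, Matrix.one_mul]

/-- Transfer of reachability between two families whose members include the same vectors. -/
theorem mem_reach_of_context {𝒜 : Submonoid (Matrix N N ℂ)} {vec : X → C → Matrix N M ℂ}
    {vec' : T → D → Matrix N M ℂ} {A : Matrix T T ℂ} {B : Matrix X X ℂ} (hA : A ∈ reach 𝒜 vec')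
    (lab : X → T) (ctx : X → C → D) (hvec : ∀ y c, vec y c = vec' (lab y) (ctx y c))
    (h : ∀ y c, ∑ t, A t (lab y) • vec' t (ctx y c) = ∑ x, B x y • vec x c) :
    B ∈ reach 𝒜 vec := by
  have hcont : Continuous fun (f : T → D → Matrix N M ℂ) (y : X) (c : C) => f (lab y) (ctx y c) := by
    fun_prop
  have := map_mem_closure hcont hA (t := orbit 𝒜 vec) (by
    rintro f ⟨P, hP, rfl⟩
    exact ⟨P, hP, by simp only [hvec]⟩)
  rw [mem_reach]
  convert this using 3 with y c
  exact (h y c).symm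

end Reach

/-! ### Braiding and winding of Ising anyons at fusion vertices -/

open QModule

section Paths
variable {ι κ μ : Type} [Fintype ι] [DecidableEq ι] [Fintype κ] [DecidableEq κ] [Fintype μ]
  [DecidableEq μ]

/-- The braiding of the last two Ising anyons commutes with operators on what is to their left. -/
theorem crossing_mul_kron_one (X : Matrix κ ι ℂ) :
    crossing κ * ((X ⊗ₖ (1 : Matrix (Fin 2) (Fin 2) ℂ)) ⊗ₖ (1 : Matrix (Fin 2) (Fin 2) ℂ)) =
      ((X ⊗ₖ (1 : Matrix (Fin 2) (Fin 2) ℂ)) ⊗ₖ (1 : Matrix (Fin 2) (Fin 2) ℂ)) * crossing ι := by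
  have e : (X ⊗ₖ (1 : Matrix (Fin 2) (Fin 2) ℂ)) ⊗ₖ (1 : Matrix (Fin 2) (Fin 2) ℂ) =
      (X ⊗ₖ (1 : Matrix (Fin 2 × Fin 2) (Fin 2 × Fin 2) ℂ)).submatrix
        (Equiv.prodAssoc κ (Fin 2) (Fin 2)) (Equiv.prodAssoc ι (Fin 2) (Fin 2)) := by
    ext ⟨⟨a, b⟩, c⟩ ⟨⟨a', b'⟩, c'⟩
    simp [Matrix.one_apply, Prod.ext_iff]
    split_ifs <;> simp_all
  rw [e, crossing, crossing, Matrix.submatrix_mul_equiv, Matrix.submatrix_mul_equiv,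
    ← Matrix.mul_kronecker_mul, ← Matrix.mul_kronecker_mul]
  simp

theorem IsHom.comm_K {A : QModule ι} {B : QModule κ} {f : Matrix κ ι ℂ} (h : IsHom A B f) :
    f * A.K = B.K * f := by
  ext i j
  have h4 := congrFun (congrFun h.2.2 i) j
  simp only [QModule.H, QModule.K, Matrix.mul_diagonal, Matrix.diagonal_mul] at h4 ⊢
  by_cases hf : f i j = 0
  · simp [hf]
  · rw [mul_comm] at h4
    have h5 : (A.wt j : ℂ) = B.wt i := mul_right_cancel₀ hf h4
    rw [Complex.ofReal_inj.mp h5, mul_comm]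

theorem IsHom.kron_one_mul_blockD {A : QModule ι} {B : QModule κ} {f : Matrix κ ι ℂ}
    (h : IsHom A B f) : (f ⊗ₖ (1 : Matrix (Fin 2) (Fin 2) ℂ)) * blockD A =
      blockD B * (f ⊗ₖ (1 : Matrix (Fin 2) (Fin 2) ℂ)) := by
  have h1 : f * (A.F * A.E) = B.F * (B.E * f) := by
    rw [← Matrix.mul_assoc, h.2.1, Matrix.mul_assoc, h.1]
  have h2 : f * (A.Kinv * A.E) = B.Kinv * (B.E * f) := by
    rw [← Matrix.mul_assoc, IsHom.comm_Kinv h, Matrix.mul_assoc, h.1]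
  simp only [blockD, Matrix.mul_add, Matrix.add_mul, Matrix.mul_smul, Matrix.smul_mul,
    ← Matrix.mul_kronecker_mul, Matrix.mul_one, Matrix.one_mul, Matrix.mul_assoc, h.2.1, IsHom.comm_K h,
    IsHom.comm_Kinv h, h1, h2]

/-- Homomorphisms out of a typical module agree if they agree on the highest weight vector. -/
theorem IsHom.ext_typical {A : QModule ι} {β : ℝ} {f g : Matrix ι (Fin 4) ℂ}
    (hf : f * (typical β).F = A.F * f) (hg : g * (typical β).F = A.F * g)
    (h : ∀ i, f i 0 = g i 0) : f = g := by
  rw [← sub_eq_zero]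
  apply eq_zero_of_F (A := A) β
  · rw [Matrix.sub_mul, Matrix.mul_sub, hf, hg]
  · ext i
    simp [h]

theorem hwMap_apply_zero (A : QModule ι) (w : ι → ℂ) (i : ι) : hwMap A w i 0 = w i := by
  have := congrFun (hwMap_mulVec A w 0) i
  simpa using this

theorem hwMap_apply_one (A : QModule ι) (w : ι → ℂ) (i : ι) :
    hwMap A w i 1 = (A.F *ᵥ w) i := by
  have := congrFun (hwMap_mulVec A w 1) i
  simpa using this

theorem qint_neg (x : ℝ) : qint (-x) = -qint x := by
  simp only [qint, qbr, neg_neg]; ring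

theorem qint_ne_zero {x : ℝ} (h : ∀ k : ℤ, x ≠ k) : qint x ≠ 0 :=
  div_ne_zero (qbr_ne_zero h) qbr_one_ne_zero

theorem qpow_three : qpow 3 = -(qpow 1)⁻¹ := by
  have h := qpow_one_pow_four
  have h0 := qpow_ne_zero 1
  rw [show (3 : ℝ) = (3 : ℕ) * 1 by norm_num, qpow_nat_mul]
  field_simp
  linear_combination h

theorem sq_qpow_one_sub_one_ne_zero : qpow 1 ^ 2 - 1 ≠ 0 := by
  have h := qbr_one_ne_zero
  have hq := qpow_ne_zero 1
  rw [qbr, qpow_neg] at h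
  intro h'
  apply h
  field_simp
  rw [h', mul_zero]

theorem qint_eq_div (x : ℝ) :
    qint x = (qpow x ^ 2 - 1) * qpow 1 / ((qpow 1 ^ 2 - 1) * qpow x) := by
  have hq := qpow_ne_zero 1
  have hx := qpow_ne_zero x
  have h := sq_qpow_one_sub_one_ne_zero
  rw [qint, qbr, qbr, qpow_neg, qpow_neg]
  have : qpow 1 - (qpow 1)⁻¹ = (qpow 1 ^ 2 - 1) / qpow 1 := by field_simp
  rw [this]
  field_simp

theorem sq_qpow_sub_one_ne_zero {x : ℝ} (h : ∀ k : ℤ, x ≠ k) : qpow x ^ 2 - 1 ≠ 0 := by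
  have := qint_ne_zero h
  rw [qint_eq_div] at this
  intro h'
  simp [h'] at this

theorem qint_one_sub_eq {β : ℝ} (hβ : ∀ k : ℤ, β ≠ k) :
    qint (1 - β) = (qpow 1 ^ 2 - qpow β ^ 2) / ((qpow 1 ^ 2 - 1) * qpow β) ∧
      qpow 1 ^ 2 - qpow β ^ 2 ≠ 0 := by
  have hq := qpow_ne_zero 1
  have hx := qpow_ne_zero β
  have h := sq_qpow_one_sub_one_ne_zero
  have e : qint (1 - β) = (qpow 1 ^ 2 - qpow β ^ 2) / ((qpow 1 ^ 2 - 1) * qpow β) := by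
    rw [qint_eq_div, show 1 - β = 1 + -β by ring, qpow_add, qpow_neg]
    field_simp
  refine ⟨e, fun h' => ?_⟩
  have h0 : qint (1 - β) ≠ 0 := qint_ne_zero (fun k hk => hβ (1 - k) (by push_cast; linarith))
  rw [e, h', zero_div] at h0
  exact h0 rfl

/-- The scalar by which winding an Ising anyon around an anyon of charge `β` acts in channel `s`. -/
def windScalar (β : ℝ) (s : Fin 2) : ℂ := if s = 0 then qpow (β + 3) else qpow (3 - β)

theorem shift_ne_int {β : ℝ} (hβ : ∀ k : ℤ, β ≠ k) (m : ℤ) : ∀ k : ℤ, β + m ≠ k := fun k h =>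
  hβ (k - m) (by push_cast; linarith)

theorem isHom_blockD_typical (β : ℝ) : IsEndo ((typical β).tensor ising) (blockD (typical β)) :=
  ⟨blockD_comm_E (isGraded_typical β) (hasComm_typical β),
    blockD_comm_F (isGraded_typical β) (hasComm_typical β), blockD_comm_H (isGraded_typical β)⟩

theorem smul_comm_F {A : QModule ι} {B : QModule κ} {f : Matrix κ ι ℂ} (h : f * A.F = B.F * f)
    (c : ℂ) : (c • f) * A.F = B.F * (c • f) := by
  rw [Matrix.smul_mul, Matrix.mul_smul, h]

theorem blockD_mul_vertex (β : ℝ) (hβ : ∀ k : ℤ, β ≠ k) (s : Fin 2) :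
    blockD (typical β) * vertex β s = windScalar β s • vertex β s := by
  have hv := isHom_vertex β hβ s
  refine IsHom.ext_typical (A := (typical β).tensor ising)
    (IsHom.comp (isHom_blockD_typical β) hv).2.1 (smul_comm_F hv.2.1 _) fun x => ?_
  have e : ∀ y, vertex β s y 0 = hwVec β s y := fun y => hwMap_apply_zero _ _ y
  have h0 : qint (1 - β) ≠ 0 := qint_ne_zero (fun k hk => hβ (1 - k) (by push_cast; linarith))
  have h1 : qint 1 = 1 := div_self qbr_one_ne_zero
  have hq := qpow_ne_zero 1
  have hQ := qpow_ne_zero β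
  have h3 := qpow_three
  have f1 : qpow (-3 + -β) = -(qpow 1 * (qpow β)⁻¹) := by
    rw [qpow_add, qpow_neg, qpow_neg, h3]; field_simp
  have f2 : qpow (3 - β) = -((qpow 1)⁻¹ * (qpow β)⁻¹) := by
    rw [sub_eq_add_neg, qpow_add, qpow_neg, h3]; ring
  have f3 : qpow (β + 3 - 2) = qpow β * qpow 1 := by
    rw [← qpow_add]; norm_num [add_sub_assoc]
  rw [Matrix.mul_apply]
  simp only [e, Matrix.smul_apply]
  obtain ⟨i, a⟩ := x
  fin_cases s
  · fin_cases i <;> fin_cases a <;>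
      simp [hwVec, blockD, windScalar, QModule.K, QModule.Kinv, typical, Matrix.mul_apply,
        Pi.single_apply, Prod.ext_iff, Fintype.sum_prod_type, Fin.sum_univ_four, Matrix.single_apply]
  · fin_cases i <;> fin_cases a <;>
      simp [hwVec, blockD, windScalar, QModule.K, QModule.Kinv, typical, Matrix.mul_apply,
        Pi.single_apply, Prod.ext_iff, Fintype.sum_prod_type, Fin.sum_univ_four, Matrix.single_apply, h1]
    · rw [f1, f2, qbr, qpow_neg 1]
      field_simp
      ring
    · rw [f2, f3]
      have h5 : qbr 1 = qpow 1 - (qpow 1)⁻¹ := by rw [qbr, qpow_neg]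
      have h6 := qpow_one_pow_four
      obtain ⟨g1, g2⟩ := qint_one_sub_eq hβ
      have g3 := sq_qpow_one_sub_one_ne_zero
      rw [qpow_neg 1, g1, h5]
      field_simp
      linear_combination (-qpow β ^ 2) * h6

/-- Two successive vertices, with channels `s` and `t`. -/
def vertexPair (β : ℝ) (s t : Fin 2) : Matrix ((Fin 4 × Fin 2) × Fin 2) (Fin 4) ℂ :=
  (vertex β s ⊗ₖ (1 : Matrix (Fin 2) (Fin 2) ℂ)) * vertex (β + ising.wt s) t

theorem vertexPair_comm_F {β : ℝ} (hβ : ∀ k : ℤ, β ≠ k) (s t : Fin 2) (γ : ℝ) :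
    vertexPair β s t * (typical γ).F =
      (((typical β).tensor ising).tensor ising).F * vertexPair β s t := by
  have h : ∀ k : ℤ, β + ising.wt s ≠ k := by
    fin_cases s
    · simpa [ising] using shift_ne_int hβ 1
    · convert shift_ne_int hβ (-1) using 3
      simp [ising]; norm_num
  exact (IsHom.comp (IsHom.kron_one (isHom_vertex β hβ s)) (isHom_vertex (β + ising.wt s) h t)).2.1

theorem crossing_vertexPair_comm_F {β : ℝ} (hβ : ∀ k : ℤ, β ≠ k) (s t : Fin 2) (γ : ℝ) :
    (crossing (Fin 4) * vertexPair β s t) * (typical γ).F =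
      (((typical β).tensor ising).tensor ising).F * (crossing (Fin 4) * vertexPair β s t) := by
  rw [Matrix.mul_assoc, vertexPair_comm_F hβ, ← Matrix.mul_assoc,
    (isHom_crossing (typical β)).2.1, Matrix.mul_assoc]

/-- Minus the coefficient of `v_1 ⊗ s_0` in the highest weight vector of channel `-`. -/
def lowerCoeff (β : ℝ) : ℂ := qpow (-1) / qint (1 - β)

theorem ising_wt_zero : ising.wt 0 = 1 := by simp [ising]

theorem ising_wt_one : ising.wt 1 = -1 := by simp [ising]; norm_num

theorem hwVec_zero (β : ℝ) : hwVec β 0 = Pi.single (0, 0) 1 := rfl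

theorem hwVec_one (β : ℝ) :
    hwVec β 1 = Pi.single (0, 1) 1 - lowerCoeff β • Pi.single (1, 0) 1 := rfl

/-- The images of the highest weight vectors under `F`. -/
def hwVecF (β : ℝ) : Fin 2 → Fin 4 × Fin 2 → ℂ
  | 0 => qpow (-(β + 3)) • Pi.single (0, 1) 1 + Pi.single (1, 0) 1
  | 1 => (1 - lowerCoeff β * qpow (-(β + 1))) • Pi.single (1, 1) 1 -
      lowerCoeff β • Pi.single (2, 0) 1

theorem F_mulVec_hwVec (β : ℝ) (s : Fin 2) :
    ((typical β).tensor ising).F *ᵥ hwVec β s = hwVecF β s := by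
  have : β + 3 - 2 = β + 1 := by ring
  fin_cases s
  · ext ⟨i, a⟩
    fin_cases i <;> fin_cases a <;>
      simp [hwVec, hwVecF, QModule.tensor, typical, ising, QModule.Kinv]
  · ext ⟨i, a⟩
    fin_cases i <;> fin_cases a <;>
      simp [hwVec, hwVecF, QModule.tensor, typical, ising, QModule.Kinv, lowerCoeff,
        Matrix.mulVec_sub, Matrix.mulVec_smul, -neg_add_rev, -neg_sub, this]

theorem vertexPair_apply_zero (β : ℝ) (s t : Fin 2) (x : Fin 4 × Fin 2) (b : Fin 2) :
    vertexPair β s t (x, b) 0 = hwVec β s x * hwVec (β + ising.wt s) t (0, b) +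
      hwVecF β s x * hwVec (β + ising.wt s) t (1, b) := by
  have e : ∀ y, vertex (β + ising.wt s) t y 0 = hwVec (β + ising.wt s) t y :=
    fun y => hwMap_apply_zero _ _ y
  have h2 : ∀ c, hwVec (β + ising.wt s) t (2, c) = 0 := by
    intro c; fin_cases t <;> fin_cases c <;> simp [hwVec]
  have h3 : ∀ c, hwVec (β + ising.wt s) t (3, c) = 0 := by
    intro c; fin_cases t <;> fin_cases c <;> simp [hwVec]
  rw [vertexPair, Matrix.mul_apply, Fintype.sum_prod_type]
  simp only [e, Fin.sum_univ_four, h2, h3, Matrix.kroneckerMap_apply, Matrix.one_apply, mul_ite,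
    mul_one, mul_zero, ite_mul, zero_mul, Finset.sum_ite_eq, Finset.mem_univ, if_true,
    add_zero]
  rw [vertex, hwMap_apply_zero, hwMap_apply_one, F_mulVec_hwVec]

/-- The braiding of two Ising anyons is determined by its values on highest weight vectors. -/
theorem crossing_mul_vertexPair_eq {β : ℝ} (hβ : ∀ k : ℤ, β ≠ k) (s t : Fin 2)
    (W : Matrix ((Fin 4 × Fin 2) × Fin 2) (Fin 4) ℂ) (γ : ℝ)
    (hW : W * (typical γ).F = (((typical β).tensor ising).tensor ising).F * W)
    (h00 : ∀ i, qpow (1 / 2) * vertexPair β s t ((i, 0), 0) 0 = W ((i, 0), 0) 0)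
    (h01 : ∀ i, (qpow (1 / 2))⁻¹ * vertexPair β s t ((i, 1), 0) 0 = W ((i, 0), 1) 0)
    (h10 : ∀ i, (qpow (1 / 2))⁻¹ * vertexPair β s t ((i, 0), 1) 0 +
      (qpow (1 / 2) - (qpow (1 / 2))⁻¹ ^ 3) * vertexPair β s t ((i, 1), 0) 0 = W ((i, 1), 0) 0)
    (h11 : ∀ i, qpow (1 / 2) * vertexPair β s t ((i, 1), 1) 0 = W ((i, 1), 1) 0) :
    crossing (Fin 4) * vertexPair β s t = W := by
  refine IsHom.ext_typical (β := γ) (crossing_vertexPair_comm_F hβ s t γ) hW ?_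
  obtain ⟨c1, c2, c3, c4, c5, c6, c7, c8, c9, c10, c11, c12, c13, c14, c15, c16⟩ :=
    isingCross_entries (qpow (1 / 2))
  have key : ∀ i a b, (crossing (Fin 4) * vertexPair β s t) ((i, a), b) 0 =
      ∑ c, ∑ d, isingCross (qpow (1 / 2)) (a, b) (c, d) * vertexPair β s t ((i, c), d) 0 := by
    intro i a b
    rw [crossing, ising_braiding, Matrix.mul_apply, Fintype.sum_prod_type, Fintype.sum_prod_type]
    simp only [Matrix.submatrix_apply, Equiv.prodAssoc_apply, Matrix.kroneckerMap_apply]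
    rw [Finset.sum_eq_single i]
    · simp only [Matrix.one_apply_eq, one_mul]
    · intro j _ hj
      simp only [Matrix.one_apply_ne hj.symm, zero_mul, Finset.sum_const_zero]
    · simp
  rintro ⟨⟨i, a⟩, b⟩
  rw [key]
  match a, b with
  | 0, 0 => rw [← h00]; simp only [Fin.sum_univ_two, c1, c2, c3, c4]; ring
  | 0, 1 => rw [← h01]; simp only [Fin.sum_univ_two, c5, c6, c7, c8]; ring
  | 1, 0 => rw [← h10]; simp only [Fin.sum_univ_two, c9, c10, c11, c12]; ring
  | 1, 1 => rw [← h11]; simp only [Fin.sum_univ_two, c13, c14, c15, c16]; ring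

/-- The quantum numbers near `β`, as rational functions of `q` and `q ^ β`. -/
theorem qint_formulas {β : ℝ} (hβ : ∀ k : ℤ, β ≠ k) {h Q : ℂ} (hh : h ^ 2 = qpow 1)
    (hQ : Q = qpow β) :
    (h ≠ 0 ∧ Q ≠ 0 ∧ h ^ 4 - 1 ≠ 0 ∧ Q ^ 2 - 1 ≠ 0 ∧ h ^ 4 - Q ^ 2 ≠ 0 ∧ h ^ 8 - Q ^ 2 ≠ 0) ∧
    (qint β = (Q ^ 2 - 1) * h ^ 2 / ((h ^ 4 - 1) * Q) ∧
      qint (β - 1) = -((h ^ 4 - Q ^ 2) / ((h ^ 4 - 1) * Q)) ∧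
      qint (β + 1) = (Q ^ 2 * h ^ 4 - 1) / ((h ^ 4 - 1) * Q)) ∧
    (lowerCoeff β = (h ^ 4 - 1) * Q / (h ^ 2 * (h ^ 4 - Q ^ 2)) ∧
      lowerCoeff (β + 1) = -((h ^ 4 - 1) * Q / (h ^ 4 * (Q ^ 2 - 1))) ∧
      lowerCoeff (β + -1) = (h ^ 4 - 1) * Q / (h ^ 8 - Q ^ 2)) ∧
    qpow (-(β + 3)) = -(h ^ 2 / Q) ∧ qpow (-(β + 1)) = 1 / (h ^ 2 * Q) := by
  have hq := qpow_ne_zero 1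
  have hQ0 := qpow_ne_zero β
  have h1 := sq_qpow_one_sub_one_ne_zero
  have h2 := sq_qpow_sub_one_ne_zero hβ
  obtain ⟨e1, h3⟩ := qint_one_sub_eq hβ
  have hβ' : ∀ k : ℤ, β - 1 ≠ k := fun k hk => hβ (k + 1) (by push_cast; linarith)
  obtain ⟨e2, h4⟩ := qint_one_sub_eq hβ'
  have e3 : qpow (β - 1) = qpow β * (qpow 1)⁻¹ := by rw [sub_eq_add_neg, qpow_add, qpow_neg]
  have e0 : qint β = (qpow β ^ 2 - 1) * qpow 1 / ((qpow 1 ^ 2 - 1) * qpow β) := qint_eq_div β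
  have e4 : qint (β - 1) = -qint (1 - β) := by rw [← qint_neg, neg_sub]
  have e5 : qint (1 - (β + 1)) = -qint β := by rw [← qint_neg]; congr 1; ring
  have e6 : qint (β + 1) = (qpow β ^ 2 * qpow 1 ^ 2 - 1) / ((qpow 1 ^ 2 - 1) * qpow β) := by
    rw [qint_eq_div, qpow_add]; field_simp
  have e7 : qpow (-(β + 3)) = -(qpow 1 / qpow β) := by
    rw [qpow_neg, qpow_add, qpow_three]; field_simp
  have e8 : qpow (-(β + 1)) = 1 / (qpow 1 * qpow β) := by
    rw [qpow_neg, qpow_add]; field_simp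
  rw [e3] at e2 h4
  have h4' : qpow 1 ^ 4 - qpow β ^ 2 ≠ 0 := by
    intro h'
    apply h4
    field_simp
    linear_combination h'
  have hh0 : h ≠ 0 := by rintro rfl; exact hq (by rw [← hh]; norm_num)
  rw [lowerCoeff, lowerCoeff, lowerCoeff, ← sub_eq_add_neg, e2, e5, e4, e1, e0, e6, e7, e8, qpow_neg, ← hQ, ← hh] at *
  have p4 : (h ^ 2) ^ 2 = h ^ 4 := by ring
  have p8 : (h ^ 2) ^ 4 = h ^ 8 := by ring
  rw [p4] at h1 h3
  rw [p8] at h4'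
  refine ⟨⟨hh0, hQ0, h1, h2, h3, h4'⟩, ⟨?_, ?_, ?_⟩, ⟨?_, ?_, ?_⟩, rfl, rfl⟩ <;> rw [p4]
  · field_simp
  · field_simp
  · have : h ^ 4 - (Q * (h ^ 2)⁻¹) ^ 2 = (h ^ 8 - Q ^ 2) / h ^ 4 := by field_simp
    rw [this]
    field_simp

theorem crossing_mul_vertexPair_self {β : ℝ} (hβ : ∀ k : ℤ, β ≠ k) (s : Fin 2) :
    crossing (Fin 4) * vertexPair β s s = qpow (1 / 2) • vertexPair β s s := by
  obtain ⟨⟨n1, n2, n3, n4, n5, n6⟩, -, ⟨f1, f2, f3⟩, f4, f5⟩ :=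
    qint_formulas hβ qpow_half_sq rfl
  have h8 : qpow (1 / 2) ^ 8 = -1 := by
    rw [show (8 : ℕ) = 2 * 4 from rfl, pow_mul, qpow_half_sq, qpow_one_pow_four]
  refine crossing_mul_vertexPair_eq hβ s s _ β (smul_comm_F (vertexPair_comm_F hβ s s β) _)
    ?_ ?_ ?_ ?_ <;> intro i <;> simp only [vertexPair_apply_zero, Matrix.smul_apply] <;>
    generalize qpow (1 / 2) = h at * <;> generalize qpow β = Q at * <;> fin_cases s
  all_goals
    simp only [Fin.mk_one, Fin.zero_eta, Fin.isValue, ising_wt_zero, ising_wt_one, hwVecF, hwVec_zero,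
      hwVec_one, f1, f3, f4, f5]
    fin_cases i <;> simp <;> field_simp <;>
      first | ring1 | linear_combination (1 - h ^ 4) * h8

theorem crossing_mul_vertexPair_lower {β : ℝ} (hβ : ∀ k : ℤ, β ≠ k) :
    crossing (Fin 4) * vertexPair β 1 0 = qpow (1 / 2) • (vertexPair β 1 0 -
      (qpow 1)⁻¹ • ((qint (β - 1) / qint β) • vertexPair β 1 0 - vertexPair β 0 1)) := by
  obtain ⟨⟨n1, n2, n3, n4, n5, n6⟩, ⟨g1, g2, g3⟩, ⟨f1, f2, f3⟩, f4, f5⟩ :=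
    qint_formulas hβ qpow_half_sq rfl
  rw [← qpow_half_sq]
  refine crossing_mul_vertexPair_eq hβ 1 0 _ β (by
      simp only [Matrix.smul_mul, Matrix.mul_smul, Matrix.sub_mul, Matrix.mul_sub,
        vertexPair_comm_F hβ])
    ?_ ?_ ?_ ?_ <;> intro i <;>
    simp only [vertexPair_apply_zero, Matrix.smul_apply, Matrix.sub_apply] <;>
    generalize qpow (1 / 2) = h at * <;> generalize qpow β = Q at *
  all_goals
    simp only [Fin.isValue, ising_wt_zero, ising_wt_one, hwVecF, hwVec_zero, hwVec_one, f1, f2,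
      f4, f5, g1, g2]
    fin_cases i <;> simp <;> field_simp <;> ring1

theorem crossing_mul_vertexPair_upper {β : ℝ} (hβ : ∀ k : ℤ, β ≠ k) :
    crossing (Fin 4) * vertexPair β 0 1 = qpow (1 / 2) • (vertexPair β 0 1 -
      (qpow 1)⁻¹ • ((qint (β + 1) / qint β) • vertexPair β 0 1 -
        (qint (β + 1) * qint (β - 1) / qint β ^ 2) • vertexPair β 1 0)) := by
  obtain ⟨⟨n1, n2, n3, n4, n5, n6⟩, ⟨g1, g2, g3⟩, ⟨f1, f2, f3⟩, f4, f5⟩ :=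
    qint_formulas hβ qpow_half_sq rfl
  rw [← qpow_half_sq]
  refine crossing_mul_vertexPair_eq hβ 0 1 _ β (by
      simp only [Matrix.smul_mul, Matrix.mul_smul, Matrix.sub_mul, Matrix.mul_sub,
        vertexPair_comm_F hβ])
    ?_ ?_ ?_ ?_ <;> intro i <;>
    simp only [vertexPair_apply_zero, Matrix.smul_apply, Matrix.sub_apply] <;>
    generalize qpow (1 / 2) = h at * <;> generalize qpow β = Q at *
  all_goals
    simp only [Fin.isValue, ising_wt_zero, ising_wt_one, hwVecF, hwVec_zero, hwVec_one, f1, f2,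
      f4, f5, g1, g2, g3]
    fin_cases i <;> simp <;> field_simp <;> first | ring1 | simp

end Paths

/-! ### The action of braids on fusion trees -/

section BraidAction
variable {α : ℝ}

theorem charge_congr {s s' : ℕ → Fin 2} : ∀ {m : ℕ}, (∀ k < m, s k = s' k) →
    charge α s m = charge α s' m
  | 0, _ => rfl
  | m + 1, h => by
    rw [charge, charge, charge_congr fun k hk => h k (by omega), h m (by omega)]

theorem ket_congr {s s' : ℕ → Fin 2} : ∀ {m : ℕ}, (∀ k < m, s k = s' k) →
    ket α s m = ket α s' m
  | 0, _ => rfl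
  | m + 1, h => by
    rw [ket, ket, ket_congr fun k hk => h k (by omega), h m (by omega),
      charge_congr fun k hk => h k (by omega)]

/-- The path `s` has the channels `+ -` and the path `s'` has the channels `- +` at the steps `i` and
`i + 1`; elsewhere they agree. They have the same charge at step `i` and from step `i + 2` on. -/
structure Swaps (i : ℕ) (s s' : ℕ → Fin 2) : Prop where
  fst : s i = 0
  snd : s (i + 1) = 1
  fst' : s' i = 1
  snd' : s' (i + 1) = 0
  other : ∀ k, k ≠ i → k ≠ i + 1 → s' k = s k

theorem Swaps.charge_eq {i : ℕ} {s s' : ℕ → Fin 2} (h : Swaps i s s') :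
    ∀ {m : ℕ}, i + 2 ≤ m → charge α s' m = charge α s m
  | 0, hm => by omega
  | 1, hm => by omega
  | m + 2, hm => by
    by_cases hi : i = m
    · subst hi
      have : charge α s' i = charge α s i :=
        charge_congr fun k hk => h.other k (by omega) (by omega)
      rw [charge, charge, charge, charge, this, h.fst, h.snd, h.fst', h.snd', ising_wt_zero,
        ising_wt_one]
      ring
    · rw [charge, charge.eq_2 α s (m + 1), h.charge_eq (m := m + 1) (by omega),
        h.other (m + 1) (by omega) (by omega)]

theorem ket_add_two (s : ℕ → Fin 2) (i : ℕ) : ket α s (i + 2) =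
    ((ket α s i ⊗ₖ (1 : Matrix (Fin 2) (Fin 2) ℂ)) ⊗ₖ (1 : Matrix (Fin 2) (Fin 2) ℂ)) *
      vertexPair (charge α s i) (s i) (s (i + 1)) := by
  rw [ket, ket, vertexPair, ← Matrix.mul_assoc, ← Matrix.mul_kronecker_mul, Matrix.one_mul]
  rfl

theorem crossing_mul_ket (s : ℕ → Fin 2) (i : ℕ) : crossing (Idx i) * ket α s (i + 2) =
    ((ket α s i ⊗ₖ (1 : Matrix (Fin 2) (Fin 2) ℂ)) ⊗ₖ (1 : Matrix (Fin 2) (Fin 2) ℂ)) *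
      (crossing (Fin 4) * vertexPair (charge α s i) (s i) (s (i + 1))) := by
  rw [ket_add_two, ← Matrix.mul_assoc]
  erw [crossing_mul_kron_one]
  rw [Matrix.mul_assoc]

/-- An operator that mixes two paths of equal charge also mixes their extensions by the same
channel, with the same coefficients. -/
theorem kron_one_mul_ket {m : ℕ} {B : Matrix (Idx m) (Idx m) ℂ} {s s' : ℕ → Fin 2} {a b : ℂ}
    (h : B * ket α s m = a • ket α s m + b • ket α s' m) (hc : charge α s' m = charge α s m)
    (hs : s' m = s m) : (B ⊗ₖ (1 : Matrix (Fin 2) (Fin 2) ℂ)) * ket α s (m + 1) =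
      a • ket α s (m + 1) + b • ket α s' (m + 1) := by
  rw [ket, ket, hc, hs, ← Matrix.mul_assoc, ← Matrix.mul_kronecker_mul, h, Matrix.add_kronecker,
    Matrix.smul_kronecker, Matrix.smul_kronecker, Matrix.one_mul, Matrix.add_mul, Matrix.smul_mul,
    Matrix.smul_mul]

/-- An elementary braid acts by a scalar on two equal channels. -/
theorem braidMatrix_mul_ket_self (hα : ∀ k : ℤ, α ≠ k) {s : ℕ → Fin 2} {i : ℕ}
    (h : s i = s (i + 1)) : ∀ {m : ℕ}, i + 2 ≤ m →
      braidMatrix α m (i + 1) * ket α s m = qpow (1 / 2) • ket α s m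
  | 0, hm => by omega
  | 1, hm => by omega
  | m + 2, hm => by
    by_cases hi : i = m
    · subst hi
      rw [braidMatrix_top, crossing_mul_ket, ← h,
        crossing_mul_vertexPair_self (charge_ne_int α hα s i), Matrix.mul_smul, ket_add_two, ← h]
    · rw [braidMatrix_lower α m (by omega)]
      have ih := braidMatrix_mul_ket_self hα h (m := m + 1) (by omega)
      have := kron_one_mul_ket (a := qpow (1 / 2)) (b := 0) (s' := s)
        (by rw [ih, zero_smul, add_zero]) rfl rfl
      rwa [zero_smul, add_zero] at this

/-- The action of an elementary braid on the channels `+ -`. -/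
theorem braidMatrix_mul_ket_upper (hα : ∀ k : ℤ, α ≠ k) {s s' : ℕ → Fin 2} {i : ℕ} {β : ℝ}
    (h : Swaps i s s') (hβ : charge α s i = β) : ∀ {m : ℕ}, i + 2 ≤ m →
      braidMatrix α m (i + 1) * ket α s m =
        (qpow (1 / 2) * (1 - (qpow 1)⁻¹ * (qint (β + 1) / qint β))) • ket α s m +
        (qpow (1 / 2) * ((qpow 1)⁻¹ * (qint (β + 1) * qint (β - 1) / qint β ^ 2))) • ket α s' m
  | 0, hm => by omega
  | 1, hm => by omega
  | m + 2, hm => by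
    by_cases hi : i = m
    · subst hi
      have e1 : charge α s' i = β := by
        rw [← hβ]; exact charge_congr fun k hk => h.other k (by omega) (by omega)
      have e2 : ket α s' i = ket α s i := ket_congr fun k hk => h.other k (by omega) (by omega)
      rw [braidMatrix_top, crossing_mul_ket, ket_add_two s, ket_add_two s', e1, e2, hβ, h.fst, h.snd,
        h.fst', h.snd', crossing_mul_vertexPair_upper (hβ ▸ charge_ne_int α hα s i)]
      simp only [Matrix.mul_smul, Matrix.mul_sub]
      module
    · rw [braidMatrix_lower α m (by omega)]
      exact kron_one_mul_ket (braidMatrix_mul_ket_upper hα h hβ (m := m + 1) (by omega))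
        (h.charge_eq (by omega)) (h.other _ (by omega) (by omega))

/-- The action of an elementary braid on the channels `- +`. -/
theorem braidMatrix_mul_ket_lower (hα : ∀ k : ℤ, α ≠ k) {s s' : ℕ → Fin 2} {i : ℕ} {β : ℝ}
    (h : Swaps i s s') (hβ : charge α s i = β) : ∀ {m : ℕ}, i + 2 ≤ m →
      braidMatrix α m (i + 1) * ket α s' m =
        (qpow (1 / 2) * (1 - (qpow 1)⁻¹ * (qint (β - 1) / qint β))) • ket α s' m +
        (qpow (1 / 2) * (qpow 1)⁻¹) • ket α s m
  | 0, hm => by omega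
  | 1, hm => by omega
  | m + 2, hm => by
    by_cases hi : i = m
    · subst hi
      have e1 : charge α s' i = β := by
        rw [← hβ]; exact charge_congr fun k hk => h.other k (by omega) (by omega)
      have e2 : ket α s' i = ket α s i := ket_congr fun k hk => h.other k (by omega) (by omega)
      rw [braidMatrix_top, crossing_mul_ket, ket_add_two s, ket_add_two s', e1, e2, hβ, h.fst, h.snd,
        h.fst', h.snd', crossing_mul_vertexPair_lower (hβ ▸ charge_ne_int α hα s i)]
      simp only [Matrix.mul_smul, Matrix.mul_sub]
      module
    · rw [braidMatrix_lower α m (by omega)]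
      exact kron_one_mul_ket (braidMatrix_mul_ket_lower hα h hβ (m := m + 1) (by omega))
        (h.charge_eq (by omega)).symm (h.other _ (by omega) (by omega)).symm

/-- The operator that winds the Ising anyon number `k` around everything to its left. -/
def windMatrix (α : ℝ) : (m : ℕ) → ℕ → Matrix (Idx m) (Idx m) ℂ
  | 0, _ => 1
  | m + 1, k => if k = m then blockD (tensorPower α m) else
      windMatrix α m k ⊗ₖ (1 : Matrix (Fin 2) (Fin 2) ℂ)

theorem windMatrix_top (α : ℝ) (m : ℕ) : windMatrix α (m + 1) m = blockD (tensorPower α m) := by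
  rw [windMatrix, if_pos rfl]

theorem windMatrix_lower (α : ℝ) (m : ℕ) {k : ℕ} (h : k ≠ m) :
    windMatrix α (m + 1) k = windMatrix α m k ⊗ₖ (1 : Matrix (Fin 2) (Fin 2) ℂ) := by
  rw [windMatrix, if_neg h]

theorem windMatrix_zero (α : ℝ) : ∀ {m : ℕ}, 0 < m → windMatrix α m 0 = braidMatrix α m 0
  | 1, _ => by rw [windMatrix_top, braidMatrix, poleBraid_eq]; rfl
  | m + 2, _ => by
    rw [windMatrix_lower α _ (by omega), braidMatrix_lower α _ (by omega), windMatrix_zero α (by omega)]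

theorem windMatrix_succ (α : ℝ) (k : ℕ) : ∀ {m : ℕ}, k + 1 < m → windMatrix α m (k + 1) =
    braidMatrix α m (k + 1) * windMatrix α m k * braidMatrix α m (k + 1)
  | 0, h => by omega
  | 1, h => by omega
  | m + 2, h => by
    by_cases hk : k = m
    · subst hk
      rw [windMatrix_top, windMatrix_lower α _ (by omega), windMatrix_top, braidMatrix_top]
      exact (hexagon (tensorPower α k)).symm
    · rw [windMatrix_lower α (m + 1) (k := k + 1) (by omega), windMatrix_lower α (m + 1) (k := k) (by omega),
        braidMatrix_lower α _ (by omega), windMatrix_succ α k (m := m + 1) (by omega), ← Matrix.mul_kronecker_mul,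
        ← Matrix.mul_kronecker_mul, Matrix.one_mul, Matrix.one_mul]

theorem windMatrix_mul_ket (hα : ∀ k : ℤ, α ≠ k) (s : ℕ → Fin 2) (k : ℕ) : ∀ {m : ℕ}, k < m →
    windMatrix α m k * ket α s m = windScalar (charge α s k) (s k) • ket α s m
  | 0, h => by omega
  | m + 1, h => by
    by_cases hk : k = m
    · subst hk
      rw [windMatrix_top, ket, ← Matrix.mul_assoc]
      erw [← IsHom.kron_one_mul_blockD (isHom_ket α hα s k)]
      rw [Matrix.mul_assoc, blockD_mul_vertex _ (charge_ne_int α hα s k), Matrix.mul_smul]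
    · rw [windMatrix_lower α _ hk]
      have ih := windMatrix_mul_ket hα s k (m := m) (by omega)
      have := kron_one_mul_ket (a := windScalar (charge α s k) (s k)) (b := 0) (s' := s)
        (by rw [ih, zero_smul, add_zero]) rfl rfl
      rwa [zero_smul, add_zero] at this

/-- The operators by which the affine braids act, up to phases. -/
def braidOperators (α : ℝ) (m : ℕ) : Submonoid (Matrix (Idx m) (Idx m) ℂ) where
  carrier := {P | ∃ c : ℂ, ‖c‖ = 1 ∧ ∃ b : AffineBraidGroup m,
    P = c • (braidAction α m b : Matrix (Idx m) (Idx m) ℂ)}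
  one_mem' := ⟨1, norm_one, 1, by simp⟩
  mul_mem' := by
    rintro _ _ ⟨c, hc, b, rfl⟩ ⟨c', hc', b', rfl⟩
    refine ⟨c * c', by rw [norm_mul, hc, hc', one_mul], b * b', ?_⟩
    rw [map_mul, Units.val_mul, smul_mul_smul_comm]

theorem braidAction_of (α : ℝ) {m i : ℕ} (h : i < m) :
    (braidAction α m (PresentedGroup.of ⟨i, h⟩) : Matrix (Idx m) (Idx m) ℂ) = braidMatrix α m i := by
  rw [braidAction, PresentedGroup.toGroup.of]; rfl

/-- The windings belong to the affine braid group: they are obtained from the winding of the first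
strand by the hexagon relation `windMatrix_succ`. -/
theorem exists_braidAction_eq_windMatrix (α : ℝ) {m : ℕ} : ∀ {k : ℕ}, k < m →
    ∃ b : AffineBraidGroup m, (braidAction α m b : Matrix (Idx m) (Idx m) ℂ) = windMatrix α m k
  | 0, h => ⟨_, by rw [windMatrix_zero α h, braidAction_of α h]⟩
  | k + 1, h => by
    obtain ⟨b, hb⟩ := exists_braidAction_eq_windMatrix α (m := m) (k := k) (by omega)
    refine ⟨PresentedGroup.of ⟨k + 1, h⟩ * b * PresentedGroup.of ⟨k + 1, h⟩, ?_⟩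
    rw [map_mul, map_mul, Units.val_mul, Units.val_mul, braidAction_of α h, hb, windMatrix_succ α k h]

/-- An operator by which a braid acts, up to a phase, with its inverse. -/
theorem exists_inverse_mem_braidOperators {m : ℕ} {c : ℂ} (hc : ‖c‖ = 1) (b : AffineBraidGroup m) :
    c • (braidAction α m b : Matrix (Idx m) (Idx m) ℂ) ∈ braidOperators α m ∧
    ∃ P' ∈ braidOperators α m, P' * (c • (braidAction α m b : Matrix (Idx m) (Idx m) ℂ)) = 1 := by
  have hc0 : c ≠ 0 := norm_ne_zero_iff.mp (by rw [hc]; exact one_ne_zero)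
  refine ⟨⟨c, hc, b, rfl⟩, _, ⟨c⁻¹, by rw [norm_inv, hc, inv_one], b⁻¹, rfl⟩, ?_⟩
  rw [map_inv, smul_mul_smul_comm, inv_mul_cancel₀ hc0, one_smul, Units.inv_mul]

end BraidAction

/-! ### Trigonometry of the charge -/

section Angles
open Complex ComplexConjugate

/-- `sin (π α / 4)`. -/
def sinQ (α : ℝ) : ℝ := Real.sin (Real.pi * α / 4)

/-- `cos (π α / 4)`. -/
def cosQ (α : ℝ) : ℝ := Real.cos (Real.pi * α / 4)

theorem qpow_eq (x : ℝ) : qpow x = cosQ x + sinQ x * I := by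
  rw [qpow, exp_mul_I, ← ofReal_cos, ← ofReal_sin]; rfl

theorem qint_eq_sinQ (x : ℝ) : qint x = (√2 * sinQ x : ℝ) := by
  have h : ∀ y, qbr y = 2 * I * sinQ y := by
    intro y
    rw [qbr, qpow_eq, qpow_eq]
    have h1 : cosQ (-y) = cosQ y := by rw [cosQ, cosQ, ← Real.cos_neg]; ring_nf
    have h2 : sinQ (-y) = -sinQ y := by rw [sinQ, sinQ, ← Real.sin_neg]; ring_nf
    rw [h1, h2]; push_cast; ring
  have h1 : sinQ 1 = √2 / 2 := by rw [sinQ, mul_one, Real.sin_pi_div_four]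
  have h2 : (√2 : ℂ) * √2 = 2 := by
    rw [← ofReal_mul, Real.mul_self_sqrt (by norm_num)]; norm_num
  have h3 : (√2 : ℂ) ≠ 0 := by intro h; simp [h] at h2
  rw [qint, h, h, h1]
  push_cast
  field_simp
  linear_combination (-(sinQ x : ℂ)) * h2

theorem sinQ_add_one (α : ℝ) : √2 * sinQ (α + 1) = sinQ α + cosQ α := by
  have : Real.pi * (α + 1) / 4 = Real.pi * α / 4 + Real.pi / 4 := by ring
  rw [sinQ, this, Real.sin_add, Real.sin_pi_div_four, Real.cos_pi_div_four, ← sinQ, ← cosQ]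
  have h2 : √2 * √2 = 2 := Real.mul_self_sqrt (by norm_num)
  linear_combination ((sinQ α + cosQ α) / 2) * h2

theorem sinQ_sub_one (α : ℝ) : √2 * sinQ (α - 1) = sinQ α - cosQ α := by
  have : Real.pi * (α - 1) / 4 = Real.pi * α / 4 - Real.pi / 4 := by ring
  rw [sinQ, this, Real.sin_sub, Real.sin_pi_div_four, Real.cos_pi_div_four, ← sinQ, ← cosQ]
  have h2 : √2 * √2 = 2 := Real.mul_self_sqrt (by norm_num)
  linear_combination ((sinQ α - cosQ α) / 2) * h2

theorem sinQ_add_two (α : ℝ) : sinQ (α + 2) = cosQ α := by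
  have : Real.pi * (α + 2) / 4 = Real.pi * α / 4 + Real.pi / 2 := by ring
  rw [sinQ, this, Real.sin_add_pi_div_two, ← cosQ]

theorem sinQ_sub_two (α : ℝ) : sinQ (α - 2) = -cosQ α := by
  have : Real.pi * (α - 2) / 4 = Real.pi * α / 4 - Real.pi / 2 := by ring
  rw [sinQ, this, Real.sin_sub_pi_div_two, ← cosQ]

/-- The angles for which the computational space is definite and winding is a small rotation. -/
structure IsGoodAngle (α : ℝ) : Prop where
  ne_int : ∀ k : ℤ, α ≠ k
  cos_lt : cosQ α ^ 2 < sinQ α ^ 2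
  small : |2 * sinQ α * cosQ α| < 1 / 2
  cos_ne : cosQ α ≠ 0

/-- With `δ = α - (2 + 4 k)`, the three estimates say `cos (π δ / 2) > 0`, `|sin (π δ / 2)| < 1 / 2`
and `δ ≠ 0`; the first two follow from `|δ| < 1 / 3`. -/
theorem isGoodAngle_of_abs_lt {α : ℝ} (hα : ∀ k : ℤ, α ≠ k)
    (hrange : ∃ k : ℤ, |α - (2 + 4 * k)| < 1 / 3) : IsGoodAngle α := by
  obtain ⟨k, hk⟩ := hrange
  set δ := α - (2 + 4 * k) with hδ
  have hpi := Real.pi_pos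
  obtain ⟨hk1, hk2⟩ := abs_lt.mp hk
  have hdouble : 2 * (Real.pi * α / 4) = Real.pi * δ / 2 + Real.pi + k * (2 * Real.pi) := by
    rw [hδ]; ring
  have hcos : cosQ α ^ 2 - sinQ α ^ 2 = -Real.cos (Real.pi * δ / 2) := by
    rw [cosQ, sinQ, ← Real.cos_two_mul', hdouble, Real.cos_add_int_mul_two_pi, Real.cos_add_pi]
  have hsin : 2 * sinQ α * cosQ α = -Real.sin (Real.pi * δ / 2) := by
    rw [cosQ, sinQ, ← Real.sin_two_mul, hdouble, Real.sin_add_int_mul_two_pi, Real.sin_add_pi]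
  have hpos : 0 < Real.cos (Real.pi * δ / 2) :=
    Real.cos_pos_of_mem_Ioo ⟨by nlinarith, by nlinarith⟩
  refine ⟨hα, by linarith, ?_, ?_⟩
  · rw [hsin, abs_neg, ← Real.sin_pi_div_six, abs_lt, ← Real.sin_neg]
    constructor <;> apply Real.sin_lt_sin_of_lt_of_le_pi_div_two <;> nlinarith
  · intro h0
    rw [cosQ, Real.cos_eq_zero_iff] at h0
    obtain ⟨m, hm⟩ := h0
    refine hα (2 * (2 * m + 1)) ?_
    push_cast
    have : Real.pi * (α - 2 * (2 * m + 1)) = 0 := by linarith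
    rcases mul_eq_zero.mp this with h | h
    · exact absurd h hpi.ne'
    · linarith

namespace IsGoodAngle
variable {α : ℝ} (h : IsGoodAngle α)
include h

theorem sin_ne : sinQ α ≠ 0 := by
  intro h0
  have h1 := h.cos_lt
  rw [h0] at h1
  nlinarith [sq_nonneg (cosQ α)]

theorem sin_add_cos_ne : sinQ α + cosQ α ≠ 0 := fun h0 => by
  have h1 := h.cos_lt
  rw [eq_neg_of_add_eq_zero_left h0, neg_sq] at h1
  exact lt_irrefl _ h1

theorem sin_sub_cos_ne : sinQ α - cosQ α ≠ 0 := fun h0 => by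
  have h1 := h.cos_lt
  rw [sub_eq_zero.mp h0] at h1
  exact lt_irrefl _ h1

end IsGoodAngle

/-- The normalization of `|1⟩` relative to `|0⟩`. -/
def qubitNorm (α : ℝ) : ℝ := √((sinQ α ^ 2 - cosQ α ^ 2) / (2 * sinQ α ^ 2))

theorem qubitNorm_sq {α : ℝ} (h : IsGoodAngle α) :
    qubitNorm α ^ 2 = (sinQ α ^ 2 - cosQ α ^ 2) / (2 * sinQ α ^ 2) := by
  rw [qubitNorm, Real.sq_sqrt]
  have := h.cos_lt
  exact div_nonneg (by linarith) (by positivity)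

theorem qubitNorm_pos {α : ℝ} (h : IsGoodAngle α) : 0 < qubitNorm α := by
  have := h.cos_lt
  have h0 := h.sin_ne
  rw [qubitNorm]
  exact Real.sqrt_pos.mpr (div_pos (by linarith) (by positivity))

theorem sqrt_two_mul_self : (√2 : ℂ) * √2 = 2 := by
  rw [← ofReal_mul, Real.mul_self_sqrt (by norm_num)]; norm_num

theorem qpow_one_eq : qpow 1 = (1 + I) / (√2 : ℝ) := by
  have h2 := sqrt_two_mul_self
  have h3 : (√2 : ℂ) ≠ 0 := by intro h; simp [h] at h2
  rw [qpow_eq, cosQ, sinQ, mul_one, Real.cos_pi_div_four, Real.sin_pi_div_four]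
  push_cast
  field_simp
  linear_combination (1 + I) * h2

theorem qpow_one_inv_eq : (qpow 1)⁻¹ = (1 - I) / (√2 : ℝ) := by
  have h2 := sqrt_two_mul_self
  have h3 : (√2 : ℂ) ≠ 0 := by intro h; simp [h] at h2
  refine inv_eq_of_mul_eq_one_right ?_
  rw [qpow_one_eq]
  field_simp
  linear_combination -h2 - I_mul_I

/-- The relative phase of the two channels when an Ising anyon winds around the pole. -/
def windPhase (α : ℝ) : ℂ := qpow (-2 * α)

theorem norm_qpow (x : ℝ) : ‖qpow x‖ = 1 := by rw [qpow, norm_exp_ofReal_mul_I]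

theorem windPhase_mul_conj (α : ℝ) : windPhase α * conj (windPhase α) = 1 := by
  rw [mul_conj, normSq_eq_norm_sq, windPhase, norm_qpow]; simp

theorem windPhase_im (α : ℝ) : (windPhase α).im = -(2 * sinQ α * cosQ α) := by
  have : sinQ (-2 * α) = -(2 * sinQ α * cosQ α) := by
    rw [sinQ, sinQ, cosQ, ← Real.sin_two_mul, ← Real.sin_neg]; ring_nf
  rw [windPhase, qpow_eq, this]
  simp

theorem windPhase_im_ne_zero {α : ℝ} (h : IsGoodAngle α) : (windPhase α).im ≠ 0 := by
  rw [windPhase_im]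
  have := h.sin_ne
  have := h.cos_ne
  simp_all

theorem norm_windPhase_sq_sub_one {α : ℝ} (h : IsGoodAngle α) : ‖windPhase α ^ 2 - 1‖ < 1 := by
  have e : windPhase α ^ 2 - 1 = windPhase α * (2 * (windPhase α).im * I) := by
    have h1 : windPhase α - conj (windPhase α) = 2 * (windPhase α).im * I := by
      rw [sub_conj]; push_cast; ring
    rw [← h1, mul_sub, windPhase_mul_conj, sq]
  have h2 := h.small
  rw [e, windPhase_im, norm_mul, windPhase, norm_qpow, one_mul, norm_mul, norm_I, mul_one,
    ← ofReal_ofNat, ← ofReal_mul, norm_real, Real.norm_eq_abs, abs_mul, abs_neg]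
  norm_num at h2 ⊢
  linarith

end Angles

/-! ### The action of braids on one qubit -/

section OneQubit
open Complex ComplexConjugate
variable {n : ℕ} {α : ℝ}

theorem compChannels_even (y : Fin n → Fin 2) (j : Fin n) : compChannels y (2 * j) = y j := by
  have h1 : 2 * (j : ℕ) / 2 = j := by omega
  simp [compChannels, h1]

theorem compChannels_odd (y : Fin n → Fin 2) (j : Fin n) :
    compChannels y (2 * j + 1) = 1 - y j := by
  have h1 : (2 * (j : ℕ) + 1) / 2 = j := by omega
  have h2 : (2 * (j : ℕ) + 1) % 2 = 1 := by omega
  simp [compChannels, h1, h2]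

theorem compChannels_update_of_ne (y : Fin n → Fin 2) (j : Fin n) (a : Fin 2) {k : ℕ}
    (h1 : k ≠ 2 * j) (h2 : k ≠ 2 * j + 1) :
    compChannels (Function.update y j a) k = compChannels y k := by
  have h3 : ∀ h : k / 2 < n, (⟨k / 2, h⟩ : Fin n) ≠ j := by
    intro h h'
    have := congrArg Fin.val h'
    simp only at this
    omega
  rw [compChannels, compChannels]
  split_ifs with h
  · rw [Function.update_of_ne (h3 h)]
  · rw [Function.update_of_ne (h3 h)]
  · rfl

theorem swaps_compChannels {y : Fin n → Fin 2} {j : Fin n} (hy : y j = 0) :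
    Swaps (2 * j) (compChannels y) (compChannels (Function.update y j 1)) where
  fst := by rw [compChannels_even, hy]
  snd := by rw [compChannels_odd, hy]; rfl
  fst' := by rw [compChannels_even, Function.update_self]
  snd' := by rw [compChannels_odd, Function.update_self]; rfl
  other k h1 h2 := compChannels_update_of_ne y j 1 h1 h2

theorem charge_compChannels (y : Fin n → Fin 2) (j : Fin n) :
    charge α (compChannels y) (2 * j) = α := charge_comp α y j j.2.le

/-- The normalization of the computational basis vector `|x⟩`: each qubit in the state `1`
contributes `qubitNorm α`. -/
def compWeight (α : ℝ) (x : Fin n → Fin 2) : ℂ := ∏ j, if x j = 0 then 1 else (qubitNorm α : ℂ)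

/-- The normalized computational basis vectors. -/
def normKet (α : ℝ) (x : Fin n → Fin 2) : Matrix (Idx (2 * n)) (Fin 4) ℂ :=
  compWeight α x • ket α (compChannels x) (2 * n)

theorem compWeight_update_one {y : Fin n → Fin 2} {j : Fin n} (hy : y j = 0) :
    compWeight α (Function.update y j 1) = qubitNorm α * compWeight α y := by
  rw [compWeight, compWeight, ← Finset.mul_prod_erase _ _ (Finset.mem_univ j),
    ← Finset.mul_prod_erase _ _ (Finset.mem_univ j), Function.update_self, hy, if_neg one_ne_zero,
    if_pos rfl, one_mul]
  congr 1
  exact Finset.prod_congr rfl fun k hk => by rw [Function.update_of_ne (Finset.ne_of_mem_erase hk)]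

theorem windMatrix_mul_normKet (h : IsGoodAngle α) (y : Fin n → Fin 2) (j : Fin n) :
    (qpow (-(α + 3)) • windMatrix α (2 * n) (2 * j)) * normKet α y =
      ∑ t, windMat (windPhase α) t (y j) • normKet α (Function.update y j t) := by
  have e : windMatrix α (2 * n) (2 * j) * ket α (compChannels y) (2 * n) =
      windScalar α (y j) • ket α (compChannels y) (2 * n) := by
    have := windMatrix_mul_ket h.ne_int (compChannels y) (2 * j) (m := 2 * n) (by omega)
    rwa [charge_compChannels, compChannels_even] at this
  have hw : qpow (-(α + 3)) * windScalar α (y j) = windMat (windPhase α) (y j) (y j) := by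
    rw [windScalar, windPhase]
    generalize y j = a
    fin_cases a <;> simp only [windMat] <;> simp
    · rw [← qpow_add, ← qpow_zero]; congr 1; ring
    · rw [← qpow_add]; congr 1; ring
  have hne : ∀ t, t ≠ y j → windMat (windPhase α) t (y j) = 0 := by
    generalize y j = a
    intro t ht
    fin_cases a <;> fin_cases t <;> simp [windMat] at ht ⊢
  rw [Finset.sum_eq_single (y j) (fun t _ ht => by rw [hne t ht, zero_smul]) (by simp),
    Function.update_eq_self, ← hw, normKet, Matrix.smul_mul, Matrix.mul_smul, e]
  module

/-- The entries of the elementary braid of a qubit in the normalized basis. -/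
theorem quarterTurn_entries (h : IsGoodAngle α) :
    qpow (-1) * (1 - (qpow 1)⁻¹ * (qint (α + 1) / qint α)) =
      quarterTurn (cosQ α / sinQ α) (-(√2 * qubitNorm α)) 0 0 ∧
    qpow (-1) * (1 - (qpow 1)⁻¹ * (qint (α - 1) / qint α)) =
      quarterTurn (cosQ α / sinQ α) (-(√2 * qubitNorm α)) 1 1 ∧
    qpow (-1) * ((qpow 1)⁻¹ * (qint (α + 1) * qint (α - 1) / qint α ^ 2)) =
      qubitNorm α * quarterTurn (cosQ α / sinQ α) (-(√2 * qubitNorm α)) 1 0 ∧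
    qpow (-1) * (qpow 1)⁻¹ * qubitNorm α =
      quarterTurn (cosQ α / sinQ α) (-(√2 * qubitNorm α)) 0 1 := by
  have h0 : (sinQ α : ℂ) ≠ 0 := ofReal_ne_zero.mpr h.sin_ne
  have h2 := sqrt_two_mul_self
  have h3 : (√2 : ℂ) ≠ 0 := by intro h; simp [h] at h2
  have hI := I_mul_I
  have ep : qint (α + 1) / qint α = (1 + cosQ α / sinQ α : ℝ) / √2 := by
    rw [qint_eq_sinQ, qint_eq_sinQ, sinQ_add_one]
    push_cast
    field_simp
  have em : qint (α - 1) / qint α = (1 - cosQ α / sinQ α : ℝ) / √2 := by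
    rw [qint_eq_sinQ, qint_eq_sinQ, sinQ_sub_one]
    push_cast
    field_simp
  have et : qint (α + 1) * qint (α - 1) / qint α ^ 2 = (qubitNorm α : ℂ) ^ 2 := by
    rw [← ofReal_pow, qubitNorm_sq h, qint_eq_sinQ, qint_eq_sinQ, qint_eq_sinQ, sinQ_add_one,
      sinQ_sub_one]
    push_cast
    field_simp
    linear_combination ((sinQ α : ℂ) ^ 2 - cosQ α ^ 2) * (-h2)
  have e1 : qpow (-1) = (1 - I) / √2 := by rw [qpow_neg, qpow_one_inv_eq]
  rw [ep, em, et, e1, qpow_one_inv_eq]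
  simp only [quarterTurn, su2Group]
  generalize cosQ α / sinQ α = x
  generalize qubitNorm α = τ
  generalize (√2 : ℝ) = r at *
  refine ⟨?_, ?_, ?_, ?_⟩ <;> simp <;> field_simp
  · linear_combination (-I * (1 + x)) * h2 - (1 + x) * hI
  · linear_combination (-I * (1 - x)) * h2 - (1 - x) * hI
  · linear_combination (I * τ ^ 2) * h2 + (τ : ℂ) ^ 2 * hI
  · linear_combination (I * τ) * h2 + (τ : ℂ) * hI

theorem qubitNorm_eq (h : IsGoodAngle α) :
    (cosQ α / sinQ α) ^ 2 + (-(√2 * qubitNorm α)) ^ 2 = 1 := by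
  have h0 := h.sin_ne
  have h2 : √2 ^ 2 = 2 := Real.sq_sqrt (by norm_num)
  rw [neg_sq, mul_pow, qubitNorm_sq h, h2]
  field_simp
  ring

theorem braidMatrix_mul_normKet (h : IsGoodAngle α) (y : Fin n → Fin 2) (j : Fin n) :
    (qpow (-(3 / 2)) • braidMatrix α (2 * n) (2 * j + 1)) * normKet α y =
      ∑ t, quarterTurn (cosQ α / sinQ α) (-(√2 * qubitNorm α)) t (y j) •
        normKet α (Function.update y j t) := by
  obtain ⟨e1, e2, e3, e4⟩ := quarterTurn_entries h
  have hq : qpow (-(3 / 2)) * qpow (1 / 2) = qpow (-1) := by rw [← qpow_add]; norm_num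
  rw [Fin.sum_univ_two]
  by_cases hy : y j = 0
  · have := braidMatrix_mul_ket_upper h.ne_int (swaps_compChannels hy) (charge_compChannels y j)
      (m := 2 * n) (by omega)
    have e0 : Function.update y j 0 = y := by rw [← hy, Function.update_eq_self]
    rw [hy, e0, normKet, normKet, compWeight_update_one hy, Matrix.smul_mul, Matrix.mul_smul, this,
      ← e1]
    simp only [smul_add, smul_smul]
    congr 2
    · linear_combination compWeight α y *
        (1 - (qpow 1)⁻¹ * (qint (α + 1) / qint α)) * hq
    · linear_combination compWeight α y * e3 + compWeight α y *
        ((qpow 1)⁻¹ * (qint (α + 1) * qint (α - 1) / qint α ^ 2)) * hq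
  · have hy1 : y j = 1 := by
      revert hy
      generalize y j = a
      revert a
      decide
    obtain ⟨z, hz⟩ : ∃ z, z = Function.update y j 0 := ⟨_, rfl⟩
    have hz0 : z j = 0 := by rw [hz, Function.update_self]
    have hy' : y = Function.update z j 1 := by rw [hz, Function.update_idem, ← hy1, Function.update_eq_self]
    have := braidMatrix_mul_ket_lower h.ne_int (swaps_compChannels hz0) (charge_compChannels z j)
      (m := 2 * n) (by omega)
    have e0 : Function.update y j 1 = y := by rw [← hy1, Function.update_eq_self]
    rw [hy1, e0, ← hz, normKet, normKet, Matrix.smul_mul, Matrix.mul_smul, hy', this,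
      compWeight_update_one hz0, ← e2]
    simp only [smul_add, smul_smul]
    rw [add_comm]
    congr 2
    · linear_combination compWeight α z * e4 +
        qubitNorm α * compWeight α z * (qpow 1)⁻¹ * hq
    · linear_combination qubitNorm α * compWeight α z *
        (1 - (qpow 1)⁻¹ * (qint (α - 1) / qint α)) * hq

end OneQubit

/-! ### One-qubit gates -/

section SingleQubitGates
open Complex ComplexConjugate
variable {n : ℕ} {α : ℝ}

/-- The one-qubit operator `M` acting on qubit `j`. -/
def qubitEmb (j : Fin n) : Matrix (Fin 2) (Fin 2) ℂ →ₐ[ℂ]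
    Matrix (Fin n → Fin 2) (Fin n → Fin 2) ℂ :=
  AlgHom.ofLinearMap
    { toFun := fun M => (M ⊗ₖ (1 : Matrix ({k // k ≠ j} → Fin 2) ({k // k ≠ j} → Fin 2) ℂ)).submatrix
        (Equiv.funSplitAt j (Fin 2)) (Equiv.funSplitAt j (Fin 2))
      map_add' := fun M N => by rw [Matrix.add_kronecker, Matrix.submatrix_add]; rfl
      map_smul' := fun c M => by rw [Matrix.smul_kronecker, Matrix.submatrix_smul]; rfl }
    (by simp)
    (fun M N => by simp [Matrix.submatrix_mul_equiv, ← Matrix.mul_kronecker_mul])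

theorem qubitEmb_apply (j : Fin n) (M : Matrix (Fin 2) (Fin 2) ℂ) (x y : Fin n → Fin 2) :
    qubitEmb j M x y = if x = Function.update y j (x j) then M (x j) (y j) else 0 := by
  have h : (Equiv.funSplitAt j (Fin 2) x).2 = (Equiv.funSplitAt j (Fin 2) y).2 ↔
      x = Function.update y j (x j) := by
    rw [Function.eq_update_iff, funext_iff]
    simp [Equiv.funSplitAt, Equiv.piSplitAt]
  change (M ⊗ₖ (1 : Matrix ({k // k ≠ j} → Fin 2) ({k // k ≠ j} → Fin 2) ℂ))
    (Equiv.funSplitAt j (Fin 2) x) (Equiv.funSplitAt j (Fin 2) y) = _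
  rw [Matrix.kroneckerMap_apply, Matrix.one_apply]
  simp only [h, mul_ite, mul_one, mul_zero]
  rfl

theorem sum_qubitEmb_smul {W : Type} [AddCommGroup W] [Module ℂ W] (j : Fin n)
    (M : Matrix (Fin 2) (Fin 2) ℂ) (y : Fin n → Fin 2) (v : (Fin n → Fin 2) → W) :
    ∑ x, qubitEmb j M x y • v x = ∑ t, M t (y j) • v (Function.update y j t) := by
  have : ∀ x, qubitEmb j M x y • v x =
      ∑ t, if x = Function.update y j t then M t (y j) • v x else 0 := by
    intro x
    rw [qubitEmb_apply, ite_smul, zero_smul, Finset.sum_eq_single (x j)]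
    · intro t _ ht
      rw [if_neg]
      intro h
      exact ht (by rw [h, Function.update_self])
    · simp
  simp only [this]
  rw [Finset.sum_comm]
  simp

theorem qubitEmb_flip (j : Fin n) : qubitEmb j (su2Mat 0 I) = I • flipMat j := by
  ext x y
  rw [qubitEmb_apply, Matrix.smul_apply, flipMat, Matrix.of_apply, flipBit]
  have hx : (x = Function.update y j (1 - y j)) ↔ (x = Function.update y j (x j) ∧ x j = 1 - y j) := by
    constructor
    · intro h
      have : x j = 1 - y j := by rw [h, Function.update_self]
      exact ⟨by rw [this]; exact h, this⟩
    · rintro ⟨h1, h2⟩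
      rw [← h2, ← h1]
  simp only [hx]
  by_cases h1 : x = Function.update y j (x j)
  · simp only [h1.symm, true_and]
    generalize x j = a
    generalize y j = b
    fin_cases a <;> fin_cases b <;> simp [su2Mat]
  · simp [h1]

theorem qubitEmb_sign (j : Fin n) : qubitEmb j (su2Mat 1 0) = I • realDiag (bitSign j) := by
  ext x y
  rw [qubitEmb_apply, Matrix.smul_apply, realDiag, Matrix.diagonal_apply, bitSign]
  have hx : x = y ↔ (x = Function.update y j (x j) ∧ x j = y j) := by
    constructor
    · rintro rfl; simp
    · rintro ⟨h1, h2⟩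
      rw [h1, h2]; simp
  simp only [hx]
  by_cases h1 : x = Function.update y j (x j)
  · simp only [h1.symm, true_and]
    generalize x j = a
    generalize y j = b
    fin_cases a <;> fin_cases b <;> simp [su2Mat]
  · simp [h1]

theorem map_mem_oneParam {ι κ : Type} [Fintype ι] [DecidableEq ι] [Fintype κ] [DecidableEq κ]
    {G : Submonoid (Matrix ι ι ℂ)} {hG : IsClosed (G : Set (Matrix ι ι ℂ))}
    {K : Submonoid (Matrix κ κ ℂ)} {hK : IsClosed (K : Set (Matrix κ κ ℂ))}
    (f : Matrix ι ι ℂ →ₐ[ℂ] Matrix κ κ ℂ) (hf : ∀ A ∈ G, f A ∈ K) {X : Matrix ι ι ℂ}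
    (hX : X ∈ oneParam G hG) : f X ∈ oneParam K hK := by
  refine (mem_oneParam _ _).mpr fun t => ?_
  have hc : Continuous f := f.toLinearMap.continuous_of_finiteDimensional
  have := hf _ ((mem_oneParam _ _).mp hX t)
  rw [NormedSpace.map_exp f hc] at this
  convert this using 2
  rw [← coe_smul, ← coe_smul, map_smul]

/-- The family of vectors in which qubit `j` runs through its two states, while the others are
arbitrary. -/
def qubitFamily (α : ℝ) (j : Fin n) : Fin 2 → (Fin n → Fin 2) → Matrix (Idx (2 * n)) (Fin 4) ℂ :=
  fun t x => normKet α (Function.update x j t)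

/-- The normalized computational basis. -/
def compFamily (n : ℕ) (α : ℝ) : (Fin n → Fin 2) → Unit → Matrix (Idx (2 * n)) (Fin 4) ℂ :=
  fun x _ => normKet α x

theorem exists_windOperator (α : ℝ) {m k : ℕ} (hk : k < m) {c : ℂ} (hc : ‖c‖ = 1) :
    c • windMatrix α m k ∈ braidOperators α m ∧
      ∃ P' ∈ braidOperators α m, P' * (c • windMatrix α m k) = 1 := by
  obtain ⟨b, hb⟩ := exists_braidAction_eq_windMatrix α hk
  rw [← hb]
  exact exists_inverse_mem_braidOperators hc b

theorem exists_braidOperator (α : ℝ) {m k : ℕ} (hk : k < m) {c : ℂ} (hc : ‖c‖ = 1) :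
    c • braidMatrix α m k ∈ braidOperators α m ∧
      ∃ P' ∈ braidOperators α m, P' * (c • braidMatrix α m k) = 1 := by
  rw [← braidAction_of α hk]
  exact exists_inverse_mem_braidOperators hc _

theorem isUnit_windMat {w : ℂ} (hw : w ≠ 0) : IsUnit (windMat w) := by
  rw [Matrix.isUnit_iff_isUnit_det, isUnit_iff_ne_zero]
  simpa [windMat, Matrix.det_fin_two] using hw

theorem isUnit_quarterTurn {x y : ℝ} (h : x ^ 2 + y ^ 2 = 1) : IsUnit (quarterTurn x y) := by
  rw [Matrix.isUnit_iff_isUnit_det, isUnit_iff_ne_zero]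
  have h2 := sqrt_two_mul_self
  have h3 : (√2 : ℂ) ≠ 0 := by intro h; simp [h] at h2
  have h4 : (x : ℂ) ^ 2 + (y : ℂ) ^ 2 = 1 := by exact_mod_cast h
  have : (quarterTurn x y).det = 1 := by
    simp only [quarterTurn, su2Group, Matrix.det_fin_two]
    simp
    field_simp
    linear_combination h4 - h2 - ((x : ℂ) ^ 2 + (y : ℂ) ^ 2) * I_mul_I
  rw [this]
  exact one_ne_zero

theorem windPhase_ne_zero (α : ℝ) : windPhase α ≠ 0 := qpow_ne_zero _

/-- The braids of the two anyons of a qubit generate all its special unitary gates. -/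
theorem qubitEmb_su2Mat_mem (h : IsGoodAngle α) (j : Fin n) (z : ℝ) (b : ℂ) :
    qubitEmb j (su2Mat z b) ∈
      oneParam (reach (braidOperators α (2 * n)) (compFamily n α)) (isClosed_reach _ _) := by
  have htr : ∀ A ∈ reach (braidOperators α (2 * n)) (qubitFamily α j),
      qubitEmb j A ∈ reach (braidOperators α (2 * n)) (compFamily n α) := by
    intro A hA
    refine mem_reach_of_context hA (fun x => x j) (fun x _ => x) (fun y _ => ?_) (fun y _ => ?_)
    · simp [compFamily, qubitFamily]
    · simp only [compFamily, qubitFamily, sum_qubitEmb_smul]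
  refine map_mem_oneParam (hG := isClosed_reach _ (qubitFamily α j)) (qubitEmb j) htr ?_
  obtain ⟨J, hJ⟩ := isUnit_windMat (windPhase_ne_zero α)
  obtain ⟨S, hS⟩ := isUnit_quarterTurn (qubitNorm_eq h)
  obtain ⟨hP, P', hP', hPP⟩ := exists_windOperator α (m := 2 * n) (k := 2 * j) (by omega)
    (norm_qpow (-(α + 3)))
  obtain ⟨hQ, Q', hQ', hQQ⟩ := exists_braidOperator α (m := 2 * n) (k := 2 * j + 1) (by omega)
    (norm_qpow (-(3 / 2)))
  have hJG : J ∈ invertibleIn (reach (braidOperators α (2 * n)) (qubitFamily α j)) := by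
    refine mem_invertibleIn_reach hP hP' hPP fun t x => ?_
    simp only [qubitFamily, windMatrix_mul_normKet h, hJ, Function.update_idem, Function.update_self]
  have hSG : S ∈ invertibleIn (reach (braidOperators α (2 * n)) (qubitFamily α j)) := by
    refine mem_invertibleIn_reach hQ hQ' hQQ fun t x => ?_
    simp only [qubitFamily, braidMatrix_mul_normKet h, hS, Function.update_idem, Function.update_self]
  have hy : -(√2 * qubitNorm α) ≠ 0 := by
    have := qubitNorm_pos h
    have h2 : 0 < √2 := by positivity
    exact neg_ne_zero.mpr (by positivity)
  exact su2_mem_oneParam _ (isClosed_reach _ _) (NonUnitalAlgHom.id ℂ _) Function.injective_id hJG hSG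
    (windPhase_mul_conj α) (windPhase_im_ne_zero h) (norm_windPhase_sq_sub_one h) (qubitNorm_eq h) hy
    (fun B => by rw [hJ]; rfl) (fun B => by rw [hJ]; rfl) (fun B => by rw [hS]; rfl)
    (fun B => by rw [hS]; rfl) (by rw [hJ, hS]; rfl) z b

theorem mem_oneParam_of_diagonal {ι : Type} [Fintype ι] [DecidableEq ι]
    {G : Submonoid (Matrix ι ι ℂ)} {hG : IsClosed (G : Set (Matrix ι ι ℂ))} {f : ι → ℝ}
    (h : ∀ t : ℝ, (Matrix.diagonal fun x => exp ((t * f x : ℝ) * I)) ∈ G) :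
    I • (Matrix.diagonal fun x => (f x : ℂ)) ∈ oneParam G hG := by
  refine (mem_oneParam _ _).mpr fun t => ?_
  have e : t • I • (Matrix.diagonal fun x => (f x : ℂ)) =
      Matrix.diagonal fun x => ((t * f x : ℝ) : ℂ) * I := by
    ext x y
    by_cases hxy : x = y
    · subst hxy; simp; ring
    · simp [hxy]
  have e2 : NormedSpace.exp (fun x => ((t * f x : ℝ) : ℂ) * I) =
      fun x => exp ((t * f x : ℝ) * I) := by
    funext x
    rw [Pi.coe_exp, Complex.exp_eq_exp_ℂ]
  have h1 := Matrix.exp_diagonal (fun x => ((t * f x : ℝ) : ℂ) * I)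
  rw [e2] at h1
  rw [e]
  exact (congrArg (· ∈ G) h1).mpr (h t)

theorem I_smul_one_mem_oneParam (α : ℝ) (n : ℕ) :
    I • (1 : Matrix (Fin n → Fin 2) (Fin n → Fin 2) ℂ) ∈
      oneParam (reach (braidOperators α (2 * n)) (compFamily n α)) (isClosed_reach _ _) := by
  have e : (1 : Matrix (Fin n → Fin 2) (Fin n → Fin 2) ℂ) = Matrix.diagonal fun _ => ((1 : ℝ) : ℂ) := by
    simp
  rw [e]
  refine mem_oneParam_of_diagonal fun t => ?_
  have hP : exp (t * I) • (1 : Matrix (Idx (2 * n)) (Idx (2 * n)) ℂ) ∈ braidOperators α (2 * n) :=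
    ⟨_, norm_exp_ofReal_mul_I t, 1, by simp⟩
  refine mem_reach_of_acts hP fun y _ => ?_
  simp [Matrix.diagonal_apply, ite_smul]

end SingleQubitGates

/-! ### Leakage of two neighbouring qubits -/

section TwoQubits
open Complex ComplexConjugate
variable {n : ℕ} {α : ℝ}

/-- The path with the channels of the steps `i` and `i + 1` exchanged. -/
def exchange (i : ℕ) (s : ℕ → Fin 2) (k : ℕ) : Fin 2 :=
  if k = i then s (i + 1) else if k = i + 1 then s i else s k

theorem exchange_fst (i : ℕ) (s : ℕ → Fin 2) : exchange i s i = s (i + 1) := if_pos rfl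

theorem exchange_snd (i : ℕ) (s : ℕ → Fin 2) : exchange i s (i + 1) = s i := by
  simp [exchange]

theorem exchange_other (s : ℕ → Fin 2) {i k : ℕ} (h1 : k ≠ i) (h2 : k ≠ i + 1) :
    exchange i s k = s k := by
  simp [exchange, h1, h2]

theorem swaps_exchange {i : ℕ} {s : ℕ → Fin 2} (h1 : s i = 0) (h2 : s (i + 1) = 1) :
    Swaps i s (exchange i s) :=
  ⟨h1, h2, by rw [exchange_fst, h2], by rw [exchange_snd, h1], fun _ => exchange_other s⟩

theorem swaps_exchange' {i : ℕ} {s : ℕ → Fin 2} (h1 : s i = 1) (h2 : s (i + 1) = 0) :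
    Swaps i (exchange i s) s :=
  ⟨by rw [exchange_fst, h2], by rw [exchange_snd, h1], h1, h2,
    fun _ h h' => (exchange_other s h h').symm⟩

/-- The vector outside of the computational subspace to which `|y⟩` leaks when the second anyon of
qubit `j` is braided with the first anyon of qubit `j + 1`. -/
def leakKet (α : ℝ) (j : Fin n) (y : Fin n → Fin 2) : Matrix (Idx (2 * n)) (Fin 4) ℂ :=
  compWeight α y • ket α (exchange (2 * j + 1) (compChannels y)) (2 * n)

section Actions
variable (h : IsGoodAngle α) {j k : Fin n} (hjk : (j : ℕ) + 1 = k) {y : Fin n → Fin 2}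
include h hjk

/-- The gates of single qubits act on leakage states by scalars. -/
theorem windMatrix_mul_leakKet_fst :
    (qpow (-(α + 3)) • windMatrix α (2 * n) (2 * j)) * leakKet α j y =
      (qpow (-(α + 3)) * windScalar α (y j)) • leakKet α j y := by
  have e1 : charge α (exchange (2 * j + 1) (compChannels y)) (2 * j) = α :=
    (charge_congr fun k hk => exchange_other _ (by omega) (by omega)).trans
      (charge_compChannels y j)
  have := windMatrix_mul_ket h.ne_int (exchange (2 * j + 1) (compChannels y)) (2 * j) (m := 2 * n)
    (by omega)
  rw [e1, exchange_other _ (by omega) (by omega), compChannels_even] at this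
  rw [leakKet, Matrix.smul_mul, Matrix.mul_smul, this]
  module

theorem braidMatrix_mul_leakKet_fst (hy : y j = y k) :
    (qpow (-(3 / 2)) • braidMatrix α (2 * n) (2 * j + 1)) * leakKet α j y =
      qpow (-1) • leakKet α j y := by
  have hk : 2 * (j : ℕ) + 1 + 1 = 2 * k := by omega
  have e : exchange (2 * j + 1) (compChannels y) (2 * j) =
      exchange (2 * j + 1) (compChannels y) (2 * j + 1) := by
    rw [exchange_fst, exchange_other _ (by omega) (by omega), hk, compChannels_even, compChannels_even,
      hy]
  have := braidMatrix_mul_ket_self h.ne_int e (m := 2 * n) (by omega)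
  rw [leakKet, Matrix.smul_mul, Matrix.mul_smul, this, smul_smul, smul_smul, smul_smul]
  congr 1
  rw [show (-1 : ℝ) = -(3 / 2) + 1 / 2 by norm_num, qpow_add]
  ring

theorem windMatrix_mul_leakKet_snd (hy : y j = y k) :
    (qpow (-(α + 3)) • windMatrix α (2 * n) (2 * k)) * leakKet α j y =
      (qpow (-(α + 3)) * windScalar (α + ising.wt (y j) + ising.wt (y j)) (1 - y j)) •
        leakKet α j y := by
  have hk : 2 * (k : ℕ) = 2 * j + 1 + 1 := by omega
  have e1 : charge α (exchange (2 * j + 1) (compChannels y)) (2 * j) = α := by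
    exact (charge_congr fun k hk => exchange_other _ (by omega) (by omega)).trans
      (charge_compChannels y j)
  have e2 : charge α (exchange (2 * j + 1) (compChannels y)) (2 * k) =
      α + ising.wt (y j) + ising.wt (y j) := by
    rw [hk, charge, charge, e1, exchange_fst, exchange_other _ (by omega) (by omega), ← hk,
      compChannels_even, compChannels_even, hy]
  have := windMatrix_mul_ket h.ne_int (exchange (2 * j + 1) (compChannels y)) (2 * k) (m := 2 * n)
    (by omega)
  rw [e2] at this
  have e3 : exchange (2 * j + 1) (compChannels y) (2 * k) = 1 - y j := by
    rw [hk, exchange_snd, compChannels_odd]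
  rw [e3] at this
  rw [leakKet, Matrix.smul_mul, Matrix.mul_smul, this]
  module

theorem braidMatrix_mul_leakKet_snd (hy : y j = y k) :
    (qpow (-(3 / 2)) • braidMatrix α (2 * n) (2 * k + 1)) * leakKet α j y =
      qpow (-1) • leakKet α j y := by
  have hk : 2 * (k : ℕ) = 2 * j + 1 + 1 := by omega
  have e : exchange (2 * j + 1) (compChannels y) (2 * k) =
      exchange (2 * j + 1) (compChannels y) (2 * k + 1) := by
    rw [exchange_other _ (k := 2 * k + 1) (by omega) (by omega), compChannels_odd, hk, exchange_snd,
      compChannels_odd, hy]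
  have := braidMatrix_mul_ket_self h.ne_int e (m := 2 * n) (by omega)
  rw [leakKet, Matrix.smul_mul, Matrix.mul_smul, this, smul_smul, smul_smul, smul_smul]
  congr 1
  rw [show (-1 : ℝ) = -(3 / 2) + 1 / 2 by norm_num, qpow_add]
  ring

/-- The middle anyons of `|01⟩` and of `|10⟩` fuse through two equal channels, so there is no
leakage. -/
theorem middle_mul_normKet_of_ne (hy : y j ≠ y k) :
    (qpow (-(1 / 2)) • braidMatrix α (2 * n) (2 * j + 1 + 1)) * normKet α y = normKet α y := by
  have hk : 2 * (j : ℕ) + 1 + 1 = 2 * k := by omega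
  have e : compChannels y (2 * j + 1) = compChannels y (2 * j + 1 + 1) := by
    rw [hk, compChannels_odd, compChannels_even]
    revert hy
    generalize y j = a
    generalize y k = b
    revert a b
    decide
  have := braidMatrix_mul_ket_self h.ne_int e (m := 2 * n) (by omega)
  rw [normKet, Matrix.smul_mul, Matrix.mul_smul, this, smul_smul, smul_smul]
  have hq : qpow (-(1 / 2)) * qpow (1 / 2) = 1 := by rw [← qpow_add, neg_add_cancel, qpow_zero]
  congr 1
  linear_combination compWeight α y * hq

/-- The middle anyons of `|00⟩` have the channels `- +`, starting from the charge `α + 1`. -/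
theorem middle_mul_zero (hj : y j = 0) (hk0 : y k = 0) :
    (qpow (-(1 / 2)) • braidMatrix α (2 * n) (2 * j + 1 + 1)) * normKet α y =
        (1 - (qpow 1)⁻¹ * (qint α / qint (α + 1))) • normKet α y + (qpow 1)⁻¹ • leakKet α j y ∧
    (qpow (-(1 / 2)) • braidMatrix α (2 * n) (2 * j + 1 + 1)) * leakKet α j y =
        (1 - (qpow 1)⁻¹ * (qint (α + 2) / qint (α + 1))) • leakKet α j y +
        ((qpow 1)⁻¹ * (qint (α + 2) * qint α / qint (α + 1) ^ 2)) • normKet α y := by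
  have hk : 2 * (j : ℕ) + 1 + 1 = 2 * k := by omega
  have hs : Swaps (2 * j + 1) (exchange (2 * j + 1) (compChannels y)) (compChannels y) :=
    swaps_exchange' (by rw [compChannels_odd, hj]; rfl) (by rw [hk, compChannels_even, hk0])
  have hc : charge α (exchange (2 * j + 1) (compChannels y)) (2 * j + 1) = α + 1 := by
    rw [charge_congr (s' := compChannels y) fun k hk => exchange_other _ (by omega) (by omega), charge,
      charge_compChannels, compChannels_even, hj, ising_wt_zero]
  have hq : qpow (-(1 / 2)) * qpow (1 / 2) = 1 := by rw [← qpow_add, neg_add_cancel, qpow_zero]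
  have e1 : α + 1 + 1 = α + 2 := by ring
  have e2 : α + 1 - 1 = α := by ring
  have a1 := braidMatrix_mul_ket_upper h.ne_int hs hc (m := 2 * n) (by omega)
  have a2 := braidMatrix_mul_ket_lower h.ne_int hs hc (m := 2 * n) (by omega)
  rw [e1, e2] at a1
  rw [e2] at a2
  constructor
  · rw [normKet, Matrix.smul_mul, Matrix.mul_smul, a2, leakKet]
    simp only [smul_add, smul_smul]
    congr 2
    · linear_combination compWeight α y * (1 - (qpow 1)⁻¹ * (qint α / qint (α + 1))) * hq
    · linear_combination compWeight α y * (qpow 1)⁻¹ * hq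
  · rw [leakKet, Matrix.smul_mul, Matrix.mul_smul, a1, normKet]
    simp only [smul_add, smul_smul]
    congr 2
    · linear_combination compWeight α y * (1 - (qpow 1)⁻¹ * (qint (α + 2) / qint (α + 1))) * hq
    · linear_combination compWeight α y *
        ((qpow 1)⁻¹ * (qint (α + 2) * qint α / qint (α + 1) ^ 2)) * hq

/-- The middle anyons of `|11⟩` have the channels `+ -`, starting from the charge `α - 1`. -/
theorem middle_mul_one (hj : y j = 1) (hk0 : y k = 1) :
    (qpow (-(1 / 2)) • braidMatrix α (2 * n) (2 * j + 1 + 1)) * normKet α y =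
        (1 - (qpow 1)⁻¹ * (qint α / qint (α - 1))) • normKet α y +
        ((qpow 1)⁻¹ * (qint α * qint (α - 2) / qint (α - 1) ^ 2)) • leakKet α j y ∧
    (qpow (-(1 / 2)) • braidMatrix α (2 * n) (2 * j + 1 + 1)) * leakKet α j y =
        (1 - (qpow 1)⁻¹ * (qint (α - 2) / qint (α - 1))) • leakKet α j y +
        (qpow 1)⁻¹ • normKet α y := by
  have hk : 2 * (j : ℕ) + 1 + 1 = 2 * k := by omega
  have hs : Swaps (2 * j + 1) (compChannels y) (exchange (2 * j + 1) (compChannels y)) :=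
    swaps_exchange (by rw [compChannels_odd, hj]; rfl) (by rw [hk, compChannels_even, hk0])
  have hc : charge α (compChannels y) (2 * j + 1) = α - 1 := by
    rw [charge, charge_compChannels, compChannels_even, hj, ising_wt_one, sub_eq_add_neg]
  have hq : qpow (-(1 / 2)) * qpow (1 / 2) = 1 := by rw [← qpow_add, neg_add_cancel, qpow_zero]
  have e1 : α - 1 - 1 = α - 2 := by ring
  have e2 : α - 1 + 1 = α := by ring
  have a1 := braidMatrix_mul_ket_upper h.ne_int hs hc (m := 2 * n) (by omega)
  have a2 := braidMatrix_mul_ket_lower h.ne_int hs hc (m := 2 * n) (by omega)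
  rw [e1, e2] at a1
  rw [e1] at a2
  constructor
  · rw [normKet, Matrix.smul_mul, Matrix.mul_smul, a1, leakKet]
    simp only [smul_add, smul_smul]
    congr 2
    · linear_combination compWeight α y * (1 - (qpow 1)⁻¹ * (qint α / qint (α - 1))) * hq
    · linear_combination compWeight α y *
        ((qpow 1)⁻¹ * (qint α * qint (α - 2) / qint (α - 1) ^ 2)) * hq
  · rw [leakKet, Matrix.smul_mul, Matrix.mul_smul, a2, normKet]
    simp only [smul_add, smul_smul]
    congr 2
    · linear_combination compWeight α y * (1 - (qpow 1)⁻¹ * (qint (α - 2) / qint (α - 1))) * hq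
    · linear_combination compWeight α y * (qpow 1)⁻¹ * hq

end Actions

/-- The labels of the paths of two neighbouring qubits that occur in the argument: the four
computational states, and the states to which `|00⟩` and `|11⟩` leak. -/
abbrev PairLabel : Type := (Fin 2 × Fin 2) ⊕ Fin 2

/-- The family of vectors in which the qubits `j` and `k` run through the states `PairLabel`, while
the others are arbitrary. -/
def pairFamily (α : ℝ) (j k : Fin n) : PairLabel → (Fin n → Fin 2) → Matrix (Idx (2 * n)) (Fin 4) ℂ
  | .inl p, x => normKet α (Function.update (Function.update x j p.1) k p.2)
  | .inr e, x => leakKet α j (Function.update (Function.update x j e) k e)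

/-- An action on the computational states of two qubits, extended by zero to the leakage states. -/
def cornerEmb (φ : Matrix (Fin 2) (Fin 2) ℂ →ₐ[ℂ] Matrix (Fin 2 × Fin 2) (Fin 2 × Fin 2) ℂ) :
    Matrix (Fin 2) (Fin 2) ℂ →ₙₐ[ℂ] Matrix PairLabel PairLabel ℂ where
  toFun B := Matrix.fromBlocks (φ B) 0 0 0
  map_smul' c B := by simp [Matrix.fromBlocks_smul]
  map_zero' := by simp
  map_add' A B := by simp [Matrix.fromBlocks_add]
  map_mul' A B := by simp [Matrix.fromBlocks_multiply]

/-- A one-qubit operator acting on the first of two qubits. -/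
def actFst : Matrix (Fin 2) (Fin 2) ℂ →ₐ[ℂ] Matrix (Fin 2 × Fin 2) (Fin 2 × Fin 2) ℂ :=
  AlgHom.ofLinearMap
    { toFun := fun M => M ⊗ₖ (1 : Matrix (Fin 2) (Fin 2) ℂ)
      map_add' := fun M N => Matrix.add_kronecker ..
      map_smul' := fun c M => Matrix.smul_kronecker .. }
    (by simp) (fun M N => by simp [← Matrix.mul_kronecker_mul])

/-- A one-qubit operator acting on the second of two qubits. -/
def actSnd : Matrix (Fin 2) (Fin 2) ℂ →ₐ[ℂ] Matrix (Fin 2 × Fin 2) (Fin 2 × Fin 2) ℂ :=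
  AlgHom.ofLinearMap
    { toFun := fun M => (1 : Matrix (Fin 2) (Fin 2) ℂ) ⊗ₖ M
      map_add' := fun M N => Matrix.kronecker_add ..
      map_smul' := fun c M => Matrix.kronecker_smul .. }
    (by simp) (fun M N => by simp [← Matrix.mul_kronecker_mul])

theorem actFst_apply (M : Matrix (Fin 2) (Fin 2) ℂ) (p p' : Fin 2 × Fin 2) :
    actFst M p p' = M p.1 p'.1 * (1 : Matrix (Fin 2) (Fin 2) ℂ) p.2 p'.2 := rfl

theorem actSnd_apply (M : Matrix (Fin 2) (Fin 2) ℂ) (p p' : Fin 2 × Fin 2) :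
    actSnd M p p' = (1 : Matrix (Fin 2) (Fin 2) ℂ) p.1 p'.1 * M p.2 p'.2 := rfl

theorem cornerEmb_su2Mat_mem (h : IsGoodAngle α) {j k : Fin n}
    {φ : Matrix (Fin 2) (Fin 2) ℂ →ₐ[ℂ] Matrix (Fin 2 × Fin 2) (Fin 2 × Fin 2) ℂ}
    (hφ : Function.Injective φ) {P P' Q Q' : Matrix (Idx (2 * n)) (Idx (2 * n)) ℂ}
    (hP : P ∈ braidOperators α (2 * n)) (hP' : P' ∈ braidOperators α (2 * n)) (hPP : P' * P = 1)
    (hQ : Q ∈ braidOperators α (2 * n)) (hQ' : Q' ∈ braidOperators α (2 * n)) (hQQ : Q' * Q = 1)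
    {d : Fin 2 → ℂ} (hd : ∀ e, d e ≠ 0)
    (hPl : ∀ p x, P * pairFamily α j k (.inl p) x =
      ∑ p', φ (windMat (windPhase α)) p' p • pairFamily α j k (.inl p') x)
    (hPr : ∀ e x, P * pairFamily α j k (.inr e) x = d e • pairFamily α j k (.inr e) x)
    (hQl : ∀ p x, Q * pairFamily α j k (.inl p) x =
      ∑ p', φ (quarterTurn (cosQ α / sinQ α) (-(√2 * qubitNorm α))) p' p •
        pairFamily α j k (.inl p') x)
    (hQr : ∀ e x, Q * pairFamily α j k (.inr e) x = qpow (-1) • pairFamily α j k (.inr e) x)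
    (z : ℝ) (b : ℂ) : cornerEmb φ (su2Mat z b) ∈
      oneParam (reach (braidOperators α (2 * n)) (pairFamily α j k)) (isClosed_reach _ _) := by
  have hblock : ∀ {M : Matrix (Fin 2) (Fin 2) ℂ} {d : Fin 2 → ℂ}
      {R : Matrix (Idx (2 * n)) (Idx (2 * n)) ℂ},
      (∀ p x, R * pairFamily α j k (.inl p) x = ∑ p', φ M p' p • pairFamily α j k (.inl p') x) →
      (∀ e x, R * pairFamily α j k (.inr e) x = d e • pairFamily α j k (.inr e) x) →
      ∀ t x, R * pairFamily α j k t x =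
        ∑ t', Matrix.fromBlocks (φ M) 0 0 (Matrix.diagonal d) t' t • pairFamily α j k t' x := by
    intro M d R h1 h2 t x
    rw [Fintype.sum_sum_type]
    rcases t with p | e
    · simp [h1]
    · simp [h2, Matrix.diagonal_apply, ite_smul]
  have hdiag : ∀ {d : Fin 2 → ℂ}, (∀ e, d e ≠ 0) → IsUnit (Matrix.diagonal d) := by
    intro d hd
    rw [Matrix.isUnit_iff_isUnit_det, Matrix.det_diagonal, isUnit_iff_ne_zero]
    exact Finset.prod_ne_zero_iff.mpr fun e _ => hd e
  have hwu := isUnit_windMat (windPhase_ne_zero α)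
  have hqu := isUnit_quarterTurn (qubitNorm_eq h)
  obtain ⟨J, hJ⟩ : IsUnit (Matrix.fromBlocks (φ (windMat (windPhase α))) 0 0 (Matrix.diagonal d)) :=
    Matrix.isUnit_fromBlocks_zero₂₁.mpr ⟨hwu.map φ, hdiag hd⟩
  obtain ⟨S, hS⟩ : IsUnit (Matrix.fromBlocks
      (φ (quarterTurn (cosQ α / sinQ α) (-(√2 * qubitNorm α)))) 0 0
      (Matrix.diagonal fun _ : Fin 2 => qpow (-1))) :=
    Matrix.isUnit_fromBlocks_zero₂₁.mpr ⟨hqu.map φ, hdiag fun _ => qpow_ne_zero _⟩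
  have hJG : J ∈ invertibleIn (reach (braidOperators α (2 * n)) (pairFamily α j k)) :=
    mem_invertibleIn_reach hP hP' hPP (by rw [hJ]; exact hblock hPl hPr)
  have hSG : S ∈ invertibleIn (reach (braidOperators α (2 * n)) (pairFamily α j k)) :=
    mem_invertibleIn_reach hQ hQ' hQQ (by rw [hS]; exact hblock hQl hQr)
  have hy : -(√2 * qubitNorm α) ≠ 0 := by
    have := qubitNorm_pos h
    have h2 : 0 < √2 := by positivity
    exact neg_ne_zero.mpr (by positivity)
  have he : Function.Injective (cornerEmb φ) := by
    intro A B hAB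
    have := congrArg Matrix.toBlocks₁₁ hAB
    exact hφ this
  have hval : ∀ B, cornerEmb φ B = Matrix.fromBlocks (φ B) 0 0 0 := fun _ => rfl
  refine su2_mem_oneParam _ (isClosed_reach _ _) (cornerEmb φ) he hJG hSG
    (windPhase_mul_conj α) (windPhase_im_ne_zero h) (norm_windPhase_sq_sub_one h) (qubitNorm_eq h) hy
    ?_ ?_ ?_ ?_ ?_ z b
  · intro B; rw [hJ, hval, hval, Matrix.fromBlocks_multiply]; simp
  · intro B; rw [hJ, hval, hval, Matrix.fromBlocks_multiply]; simp
  · intro B; rw [hS, hval, hval, Matrix.fromBlocks_multiply]; simp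
  · intro B; rw [hS, hval, hval, Matrix.fromBlocks_multiply]; simp
  · rw [hJ, hS, hval, Matrix.fromBlocks_multiply, Matrix.fromBlocks_multiply, sub_eq_iff_eq_add,
      Matrix.fromBlocks_add]
    congr 1
    · simp
    · simp
    · simp
    · simp [mul_comm]

end TwoQubits

/-! ### Controlled phases -/

section Planes
variable {ι : Type} [Fintype ι] [DecidableEq ι]

/-- A `2 × 2` matrix acting on the coordinates `p 0` and `p 1`. -/
def planeEmb (p : Fin 2 → ι) (hp : Function.Injective p) :
    Matrix (Fin 2) (Fin 2) ℂ →ₙₐ[ℂ] Matrix ι ι ℂ where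
  toFun B := (1 : Matrix ι ι ℂ).submatrix id p * B * (1 : Matrix ι ι ℂ).submatrix p id
  map_smul' c B := by simp
  map_zero' := by simp
  map_add' A B := by simp [Matrix.mul_add, Matrix.add_mul]
  map_mul' A B := by
    have : (1 : Matrix ι ι ℂ).submatrix p id * (1 : Matrix ι ι ℂ).submatrix id p = 1 := by
      rw [← Matrix.submatrix_mul _ _ _ _ _ Function.bijective_id, mul_one, Matrix.submatrix_one _ hp]
    rw [show A * B = A * (1 * B) by rw [one_mul], ← this]
    simp only [Matrix.mul_assoc]

theorem planeEmb_apply {p : Fin 2 → ι} (hp : Function.Injective p) (B : Matrix (Fin 2) (Fin 2) ℂ)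
    (i j : ι) : planeEmb p hp B i j =
      ∑ b, (∑ a, (if i = p a then B a b else 0)) * (if p b = j then 1 else 0) := by
  change ((1 : Matrix ι ι ℂ).submatrix id p * B * (1 : Matrix ι ι ℂ).submatrix p id) i j = _
  simp [Matrix.mul_apply, Matrix.one_apply]

theorem planeEmb_mul_planeEmb {p p' : Fin 2 → ι} (hp : Function.Injective p)
    (hp' : Function.Injective p') (h : ∀ a b, p a ≠ p' b) (B B' : Matrix (Fin 2) (Fin 2) ℂ) :
    planeEmb p hp B * planeEmb p' hp' B' = 0 := by
  have : (1 : Matrix ι ι ℂ).submatrix p id * (1 : Matrix ι ι ℂ).submatrix id p' = 0 := by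
    rw [← Matrix.submatrix_mul _ _ _ _ _ Function.bijective_id, mul_one]
    ext a b
    simp [h a b]
  change ((1 : Matrix ι ι ℂ).submatrix id p * B * (1 : Matrix ι ι ℂ).submatrix p id) *
    ((1 : Matrix ι ι ℂ).submatrix id p' * B' * (1 : Matrix ι ι ℂ).submatrix p' id) = 0
  calc _ = (1 : Matrix ι ι ℂ).submatrix id p * B * ((1 : Matrix ι ι ℂ).submatrix p id *
            (1 : Matrix ι ι ℂ).submatrix id p') * B' * (1 : Matrix ι ι ℂ).submatrix p' id := by
            simp only [Matrix.mul_assoc]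
    _ = 0 := by rw [this]; simp

variable (η₁ η₂ : Matrix (Fin 2) (Fin 2) ℂ →ₙₐ[ℂ] Matrix ι ι ℂ)

/-- The operator that acts by `M` and `N` on two orthogonal blocks, and trivially elsewhere. -/
def twoBlocks (M N : Matrix (Fin 2) (Fin 2) ℂ) : Matrix ι ι ℂ := 1 + η₁ (M - 1) + η₂ (N - 1)

theorem twoBlocks_one : twoBlocks η₁ η₂ 1 1 = 1 := by simp [twoBlocks]

variable {η₁ η₂} (h12 : ∀ M N, η₁ M * η₂ N = 0) (h21 : ∀ M N, η₂ M * η₁ N = 0)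
include h12 h21

theorem twoBlocks_mul_twoBlocks (M N M' N' : Matrix (Fin 2) (Fin 2) ℂ) :
    twoBlocks η₁ η₂ M N * twoBlocks η₁ η₂ M' N' = twoBlocks η₁ η₂ (M * M') (N * N') := by
  simp only [twoBlocks, add_mul, mul_add, h12, h21, ← map_mul, one_mul, mul_one, add_zero]
  have e1 : M * M' - 1 = (M - 1) + (M' - 1) + (M - 1) * (M' - 1) := by noncomm_ring
  have e2 : N * N' - 1 = (N - 1) + (N' - 1) + (N - 1) * (N' - 1) := by noncomm_ring
  rw [e1, e2]
  simp only [map_add]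
  abel

theorem twoBlocks_mul_add (M N B B' : Matrix (Fin 2) (Fin 2) ℂ) :
    twoBlocks η₁ η₂ M N * (η₁ B + η₂ B') = η₁ (M * B) + η₂ (N * B') := by
  simp only [twoBlocks, add_mul, mul_add, h12, h21, ← map_mul, one_mul, sub_mul, map_sub]
  abel

theorem add_mul_twoBlocks (M N B B' : Matrix (Fin 2) (Fin 2) ℂ) :
    (η₁ B + η₂ B') * twoBlocks η₁ η₂ M N = η₁ (B * M) + η₂ (B' * N) := by
  simp only [twoBlocks, add_mul, mul_add, h12, h21, ← map_mul, mul_one, mul_sub, map_sub,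
    add_zero]
  abel

end Planes

section ControlledPhase
open Complex ComplexConjugate
variable {n : ℕ} {α : ℝ}

/-- The computational state `|ee⟩` and the state to which it leaks. -/
def leakPlane (e : Fin 2) : Fin 2 → PairLabel := ![.inl (e, e), .inr e]

theorem leakPlane_injective (e : Fin 2) : Function.Injective (leakPlane e) := by
  revert e; decide

theorem leakPlane_ne {e e' : Fin 2} (h : e ≠ e') : ∀ a b, leakPlane e a ≠ leakPlane e' b := by
  revert e e'; decide

/-- The action of a `2 × 2` matrix on `|ee⟩` and its leakage state. -/
abbrev leakEmb (e : Fin 2) : Matrix (Fin 2) (Fin 2) ℂ →ₙₐ[ℂ] Matrix PairLabel PairLabel ℂ :=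
  planeEmb (leakPlane e) (leakPlane_injective e)

theorem leakEmb_mul {e e' : Fin 2} (h : e ≠ e') (M N : Matrix (Fin 2) (Fin 2) ℂ) :
    leakEmb e M * leakEmb e' N = 0 :=
  planeEmb_mul_planeEmb _ _ (leakPlane_ne h) M N

theorem sum_leakEmb_smul_self {W : Type} [AddCommGroup W] [Module ℂ W] (e : Fin 2)
    (B : Matrix (Fin 2) (Fin 2) ℂ) (v : PairLabel → W) (b : Fin 2) :
    ∑ t, leakEmb e B t (leakPlane e b) • v t =
      B 0 b • v (.inl (e, e)) + B 1 b • v (.inr e) := by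
  have : ∀ t, leakEmb e B t (leakPlane e b) = ∑ a, if t = leakPlane e a then B a b else 0 := by
    intro t
    rw [planeEmb_apply, Finset.sum_eq_single b]
    · simp
    · intro b' _ hb
      rw [if_neg fun h => hb (leakPlane_injective e h), mul_zero]
    · simp
  simp only [this, Finset.sum_smul, ite_smul, zero_smul]
  rw [Finset.sum_comm]
  simp only [Finset.sum_ite_eq', Finset.mem_univ, if_true, Fin.sum_univ_two]
  rfl

theorem sum_leakEmb_smul_other {W : Type} [AddCommGroup W] [Module ℂ W] (e : Fin 2)
    (B : Matrix (Fin 2) (Fin 2) ℂ) (v : PairLabel → W) {t₀ : PairLabel}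
    (ht : ∀ b, leakPlane e b ≠ t₀) : ∑ t, leakEmb e B t t₀ • v t = 0 :=
  Finset.sum_eq_zero fun t _ => by simp [planeEmb_apply, ht]

/-- The idempotent with entries `a`, `b`, `c`, `1 - a`, where `b c = a (1 - a)`. -/
def projMat (a b c : ℂ) : Matrix (Fin 2) (Fin 2) ℂ := !![a, b; c, 1 - a]

/-- The braiding of two Ising anyons is, up to a phase, `1 - (1 - i) P` for an idempotent `P`, and its
square is the reflection `1 - 2 P`. -/
theorem one_sub_smul_projMat_sq {a b c : ℂ} (h : b * c = a * (1 - a)) :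
    (1 - (1 - I) • projMat a b c) * (1 - (1 - I) • projMat a b c) = reflMat (1 - 2 * a) b c := by
  have hI := I_mul_I
  ext i j
  fin_cases i <;> fin_cases j <;> simp [projMat, reflMat, Matrix.mul_apply, Fin.sum_univ_two]
  · linear_combination (1 - I) ^ 2 * h + a * hI
  · linear_combination b * hI
  · linear_combination c * hI
  · linear_combination (1 - I) ^ 2 * h + (1 - a) * hI

theorem reflMat_sq {a b c : ℂ} (h : b * c = a * (1 - a)) :
    reflMat (1 - 2 * a) b c * reflMat (1 - 2 * a) b c = 1 := by
  ext i j
  fin_cases i <;> fin_cases j <;> simp [reflMat, Matrix.mul_apply, Fin.sum_univ_two]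
  · linear_combination 4 * h
  · ring
  · ring
  · linear_combination 4 * h

/-- The channel projector of the two middle anyons of `|00⟩` and its leakage state. -/
def projZero (α : ℝ) : Matrix (Fin 2) (Fin 2) ℂ :=
  projMat (sinQ α / (sinQ α + cosQ α)) (-(√2 * sinQ α * cosQ α / (sinQ α + cosQ α) ^ 2)) (-(√2 : ℂ)⁻¹)

/-- The channel projector of the two middle anyons of `|11⟩` and its leakage state. -/
def projOne (α : ℝ) : Matrix (Fin 2) (Fin 2) ℂ :=
  projMat (sinQ α / (sinQ α - cosQ α)) (-(√2 : ℂ)⁻¹) (√2 * sinQ α * cosQ α / (sinQ α - cosQ α) ^ 2)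

theorem middle_mul_leakPlane_zero (h : IsGoodAngle α) {j k : Fin n} (hjk : (j : ℕ) + 1 = k)
    (b : Fin 2) (x : Fin n → Fin 2) :
    (qpow (-(1 / 2)) • braidMatrix α (2 * n) (2 * j + 1 + 1)) * pairFamily α j k (leakPlane 0 b) x =
      (1 - (1 - I) • projZero α) 0 b • pairFamily α j k (.inl (0, 0)) x +
      (1 - (1 - I) • projZero α) 1 b • pairFamily α j k (.inr 0) x := by
  have hne : j ≠ k := fun h => by rw [h] at hjk; omega
  obtain ⟨a1, a2⟩ := middle_mul_zero h hjk
    (y := Function.update (Function.update x j 0) k 0) (by simp [hne]) (by simp)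
  have h0 : (sinQ α + cosQ α : ℂ) ≠ 0 := by exact_mod_cast h.sin_add_cos_ne
  have h2 := sqrt_two_mul_self
  have h3 : (√2 : ℂ) ≠ 0 := by intro h; simp [h] at h2
  have e1 : qint (α + 1) = sinQ α + cosQ α := by rw [qint_eq_sinQ, sinQ_add_one]; push_cast; rfl
  rw [qpow_one_inv_eq, e1, qint_eq_sinQ α] at a1 a2
  rw [qint_eq_sinQ, sinQ_add_two] at a2
  push_cast at a1 a2
  fin_cases b
  · refine a1.trans ?_
    simp only [pairFamily]
    congr 2
    · simp [projZero, projMat]; field_simp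
    · simp [projZero, projMat]; field_simp
  · refine a2.trans ?_
    rw [add_comm]
    simp only [pairFamily]
    congr 2
    · simp [projZero, projMat]; field_simp
    · simp [projZero, projMat]; field_simp; ring

theorem middle_mul_leakPlane_one (h : IsGoodAngle α) {j k : Fin n} (hjk : (j : ℕ) + 1 = k)
    (b : Fin 2) (x : Fin n → Fin 2) :
    (qpow (-(1 / 2)) • braidMatrix α (2 * n) (2 * j + 1 + 1)) * pairFamily α j k (leakPlane 1 b) x =
      (1 - (1 - I) • projOne α) 0 b • pairFamily α j k (.inl (1, 1)) x +
      (1 - (1 - I) • projOne α) 1 b • pairFamily α j k (.inr 1) x := by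
  have hne : j ≠ k := fun h => by rw [h] at hjk; omega
  obtain ⟨a1, a2⟩ := middle_mul_one h hjk
    (y := Function.update (Function.update x j 1) k 1) (by simp [hne]) (by simp)
  have h0 : (sinQ α - cosQ α : ℂ) ≠ 0 := by exact_mod_cast h.sin_sub_cos_ne
  have h2 := sqrt_two_mul_self
  have h3 : (√2 : ℂ) ≠ 0 := by intro h; simp [h] at h2
  have e1 : qint (α - 1) = sinQ α - cosQ α := by rw [qint_eq_sinQ, sinQ_sub_one]; push_cast; rfl
  rw [qpow_one_inv_eq, e1] at a1 a2
  rw [qint_eq_sinQ α] at a1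
  rw [qint_eq_sinQ (α - 2), sinQ_sub_two] at a1 a2
  push_cast at a1 a2
  fin_cases b
  · refine a1.trans ?_
    simp only [pairFamily]
    congr 2
    · simp [projOne, projMat]; field_simp
    · simp [projOne, projMat]; field_simp
  · refine a2.trans ?_
    rw [add_comm]
    simp only [pairFamily]
    congr 2
    · simp [projOne, projMat]; field_simp
    · simp [projOne, projMat]; field_simp; ring

/-- The braid of the two middle anyons of two neighbouring qubits. -/
def middleMat (α : ℝ) : Matrix PairLabel PairLabel ℂ :=
  twoBlocks (leakEmb 0) (leakEmb 1) (1 - (1 - I) • projZero α) (1 - (1 - I) • projOne α)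

theorem middleMat_mem (h : IsGoodAngle α) {j k : Fin n} (hjk : (j : ℕ) + 1 = k) :
    middleMat α ∈ reach (braidOperators α (2 * n)) (pairFamily α j k) := by
  have hne : j ≠ k := fun h => by rw [h] at hjk; omega
  have hP := (exists_braidOperator α (m := 2 * n) (k := 2 * j + 1 + 1) (by omega)
    (norm_qpow (-(1 / 2)))).1
  refine mem_reach_of_acts hP fun t x => ?_
  have hone : ∀ t, ∑ t', (1 : Matrix PairLabel PairLabel ℂ) t' t • pairFamily α j k t' x =
      pairFamily α j k t x := by
    intro t; simp [Matrix.one_apply, ite_smul, -Fintype.sum_sum_type]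
  simp only [middleMat, twoBlocks, Matrix.add_apply, add_smul, Finset.sum_add_distrib, hone]
  have h01 := leakPlane_ne (e := 0) (e' := 1) (by decide)
  have h10 := leakPlane_ne (e := 1) (e' := 0) (by decide)
  have hcase : (∃ b, t = leakPlane 0 b) ∨ (∃ b, t = leakPlane 1 b) ∨
      ∃ p : Fin 2 × Fin 2, p.1 ≠ p.2 ∧ t = .inl p ∧ (∀ e b, leakPlane e b ≠ t) := by
    revert t; decide
  rcases hcase with ⟨b, rfl⟩ | ⟨b, rfl⟩ | ⟨p, hp, rfl, h'⟩
  · rw [middle_mul_leakPlane_zero h hjk, sum_leakEmb_smul_self,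
      sum_leakEmb_smul_other 1 _ _ fun c => h10 c b, add_zero]
    fin_cases b
    · simp [leakPlane]; module
    · simp [leakPlane]; module
  · rw [middle_mul_leakPlane_one h hjk, sum_leakEmb_smul_self,
      sum_leakEmb_smul_other 0 _ _ fun c => h01 c b, add_zero]
    fin_cases b
    · simp [leakPlane]; module
    · simp [leakPlane]; module
  · rw [sum_leakEmb_smul_other 0 _ _ (h' 0), sum_leakEmb_smul_other 1 _ _ (h' 1), add_zero, add_zero]
    exact middle_mul_normKet_of_ne h hjk (by simpa [hne] using hp)

theorem actFst_injective : Function.Injective actFst := by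
  intro A B h
  ext a b
  simpa [actFst_apply] using congrFun (congrFun h (a, 0)) (b, 0)

theorem actSnd_injective : Function.Injective actSnd := by
  intro A B h
  ext a b
  simpa [actSnd_apply] using congrFun (congrFun h (0, a)) (0, b)

theorem windScalar_ne_zero (β : ℝ) (s : Fin 2) : windScalar β s ≠ 0 := by
  rw [windScalar]; split_ifs <;> exact qpow_ne_zero _

theorem sum_actFst_smul {W : Type} [AddCommGroup W] [Module ℂ W] (M : Matrix (Fin 2) (Fin 2) ℂ)
    (v : Fin 2 × Fin 2 → W) (p : Fin 2 × Fin 2) :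
    ∑ p', actFst M p' p • v p' = ∑ t, M t p.1 • v (t, p.2) := by
  simp [Fintype.sum_prod_type, actFst_apply, Matrix.one_apply, ite_smul]

theorem sum_actSnd_smul {W : Type} [AddCommGroup W] [Module ℂ W] (M : Matrix (Fin 2) (Fin 2) ℂ)
    (v : Fin 2 × Fin 2 → W) (p : Fin 2 × Fin 2) :
    ∑ p', actSnd M p' p • v p' = ∑ t, M t p.2 • v (p.1, t) := by
  rw [Fintype.sum_prod_type, Finset.sum_comm]
  simp [actSnd_apply, Matrix.one_apply, ite_smul]

theorem cornerEmb_actFst_mem (h : IsGoodAngle α) {j k : Fin n} (hjk : (j : ℕ) + 1 = k)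
    (z : ℝ) (b : ℂ) : cornerEmb actFst (su2Mat z b) ∈
      oneParam (reach (braidOperators α (2 * n)) (pairFamily α j k)) (isClosed_reach _ _) := by
  have hne : j ≠ k := fun h => by rw [h] at hjk; omega
  obtain ⟨hP, P', hP', hPP⟩ := exists_windOperator α (m := 2 * n) (k := 2 * j) (by omega)
    (norm_qpow (-(α + 3)))
  obtain ⟨hQ, Q', hQ', hQQ⟩ := exists_braidOperator α (m := 2 * n) (k := 2 * j + 1) (by omega)
    (norm_qpow (-(3 / 2)))
  have hu : ∀ (p : Fin 2 × Fin 2) (x : Fin n → Fin 2) t,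
      Function.update (Function.update (Function.update x j p.1) k p.2) j t =
        Function.update (Function.update x j t) k p.2 := by
    intro p x t
    rw [Function.update_comm hne, Function.update_idem, Function.update_comm hne.symm]
  refine cornerEmb_su2Mat_mem h actFst_injective hP hP' hPP hQ hQ' hQQ
    (d := fun e => qpow (-(α + 3)) * windScalar α e)
    (fun e => mul_ne_zero (qpow_ne_zero _) (windScalar_ne_zero _ _)) ?_ ?_ ?_ ?_ z b
  · intro p x
    rw [sum_actFst_smul]
    simp only [pairFamily, windMatrix_mul_normKet h, hu]
    simp [hne]
  · intro e x
    simp only [pairFamily]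
    rw [windMatrix_mul_leakKet_fst h hjk]
    simp [hne]
  · intro p x
    rw [sum_actFst_smul]
    simp only [pairFamily, braidMatrix_mul_normKet h, hu]
    simp [hne]
  · intro e x
    simp only [pairFamily]
    rw [braidMatrix_mul_leakKet_fst h hjk (by simp [hne])]

theorem cornerEmb_actSnd_mem (h : IsGoodAngle α) {j k : Fin n} (hjk : (j : ℕ) + 1 = k)
    (z : ℝ) (b : ℂ) : cornerEmb actSnd (su2Mat z b) ∈
      oneParam (reach (braidOperators α (2 * n)) (pairFamily α j k)) (isClosed_reach _ _) := by
  have hne : j ≠ k := fun h => by rw [h] at hjk; omega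
  obtain ⟨hP, P', hP', hPP⟩ := exists_windOperator α (m := 2 * n) (k := 2 * k) (by omega)
    (norm_qpow (-(α + 3)))
  obtain ⟨hQ, Q', hQ', hQQ⟩ := exists_braidOperator α (m := 2 * n) (k := 2 * k + 1) (by omega)
    (norm_qpow (-(3 / 2)))
  refine cornerEmb_su2Mat_mem h actSnd_injective hP hP' hPP hQ hQ' hQQ
    (d := fun e => qpow (-(α + 3)) * windScalar (α + ising.wt e + ising.wt e) (1 - e))
    (fun e => mul_ne_zero (qpow_ne_zero _) (windScalar_ne_zero _ _)) ?_ ?_ ?_ ?_ z b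
  · intro p x
    rw [sum_actSnd_smul]
    simp only [pairFamily, windMatrix_mul_normKet h, Function.update_idem, Function.update_self]
  · intro e x
    simp only [pairFamily]
    rw [windMatrix_mul_leakKet_snd h hjk (by simp [hne])]
    simp [hne]
  · intro p x
    rw [sum_actSnd_smul]
    simp only [pairFamily, braidMatrix_mul_normKet h, Function.update_idem, Function.update_self]
  · intro e x
    simp only [pairFamily]
    rw [braidMatrix_mul_leakKet_snd h hjk (by simp [hne])]

/-- Half the sum of the one-qubit rotations `i Z` of the two qubits acts by `± i` on `|00⟩` and
`|11⟩`, and by zero on the other states. -/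
theorem leakEmb_corner_mem (h : IsGoodAngle α) {j k : Fin n} (hjk : (j : ℕ) + 1 = k) :
    leakEmb 0 (I • cornerMat) + leakEmb 1 (-I • cornerMat) ∈
      oneParam (reach (braidOperators α (2 * n)) (pairFamily α j k)) (isClosed_reach _ _) := by
  have := (oneParam _ (isClosed_reach _ (pairFamily α j k))).smul_mem (1 / 2 : ℝ)
    ((oneParam _ (isClosed_reach _ (pairFamily α j k))).add_mem
      (cornerEmb_actFst_mem h hjk 1 0) (cornerEmb_actSnd_mem h hjk 1 0))
  convert this using 1
  have hval : ∀ φ B, cornerEmb φ B = Matrix.fromBlocks (φ B) 0 0 0 := fun _ _ => rfl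
  rw [hval, hval]
  ext (⟨a, b⟩ | e) (⟨a', b'⟩ | e')
  · fin_cases a <;> fin_cases b <;> fin_cases a' <;> fin_cases b' <;>
      simp [planeEmb_apply, leakPlane, cornerMat, actFst_apply, actSnd_apply, su2Mat,
        Fin.sum_univ_two] <;> ring
  · fin_cases a <;> fin_cases b <;> fin_cases e' <;>
      simp [planeEmb_apply, leakPlane, cornerMat, Fin.sum_univ_two]
  · fin_cases e <;> fin_cases a' <;> fin_cases b' <;>
      simp [planeEmb_apply, leakPlane, cornerMat, Fin.sum_univ_two]
  · fin_cases e <;> fin_cases e' <;>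
      simp [planeEmb_apply, leakPlane, cornerMat, Fin.sum_univ_two]

/-- Conjugation by the square of the middle braid, which is a reflection in both leaking planes,
separates the rotation of `|00⟩` from that of `|11⟩`. -/
theorem leakEmb_diagMat_mem (h : IsGoodAngle α) {j k : Fin n} (hjk : (j : ℕ) + 1 = k) :
    leakEmb 0 (diagMat I) ∈
      oneParam (reach (braidOperators α (2 * n)) (pairFamily α j k)) (isClosed_reach _ _) := by
  have hp : (sinQ α + cosQ α : ℂ) ≠ 0 := by exact_mod_cast h.sin_add_cos_ne
  have hm : (sinQ α - cosQ α : ℂ) ≠ 0 := by exact_mod_cast h.sin_sub_cos_ne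
  have hp' := h.sin_add_cos_ne
  have hm' := h.sin_sub_cos_ne
  have h2 := sqrt_two_mul_self
  have h3 : (√2 : ℂ) ≠ 0 := by intro h; simp [h] at h2
  have h01 : ∀ M N, leakEmb 0 M * leakEmb 1 N = 0 := leakEmb_mul (by decide)
  have h10 : ∀ M N, leakEmb 1 M * leakEmb 0 N = 0 := leakEmb_mul (by decide)
  have i0 : (-(√2 * sinQ α * cosQ α / (sinQ α + cosQ α) ^ 2) : ℂ) * (-(√2 : ℂ)⁻¹) =
      (sinQ α / (sinQ α + cosQ α)) * (1 - sinQ α / (sinQ α + cosQ α)) := by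
    field_simp
    ring
  have i1 : (-(√2 : ℂ)⁻¹) * (√2 * sinQ α * cosQ α / (sinQ α - cosQ α) ^ 2) =
      (sinQ α / (sinQ α - cosQ α)) * (1 - sinQ α / (sinQ α - cosQ α)) := by
    field_simp
    ring
  obtain ⟨R, hR⟩ : ∃ R, R = middleMat α * middleMat α := ⟨_, rfl⟩
  have hRmem : R ∈ reach (braidOperators α (2 * n)) (pairFamily α j k) :=
    hR ▸ mul_mem (middleMat_mem h hjk) (middleMat_mem h hjk)
  rw [middleMat, twoBlocks_mul_twoBlocks h01 h10, projZero, projOne, one_sub_smul_projMat_sq i0,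
    one_sub_smul_projMat_sq i1] at hR
  have hR2 : R * R = 1 := by
    rw [hR, twoBlocks_mul_twoBlocks h01 h10, reflMat_sq i0, reflMat_sq i1, twoBlocks_one]
  have hX := leakEmb_corner_mem h hjk
  have hY := conj_mem_oneParam _ (isClosed_reach _ (pairFamily α j k)) ⟨R, R, hR2, hR2⟩ hRmem hRmem hX
  change R * _ * R ∈ _ at hY
  rw [hR, twoBlocks_mul_add h01 h10, add_mul_twoBlocks h01 h10] at hY
  simp only [Matrix.mul_smul, Matrix.smul_mul] at hY
  have hsc := mul_ne_zero h.sin_ne h.cos_ne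
  refine rotation_mem_of_two_blocks _ (leakEmb 0) (leakEmb 1) h01 h10
    (κ₁ := (cosQ α - sinQ α) ^ 2 * (sinQ α * cosQ α) / (sinQ α + cosQ α) ^ 4)
    (κ₂ := -((sinQ α + cosQ α) ^ 2 * (sinQ α * cosQ α) / (sinQ α - cosQ α) ^ 4)) ?_ ?_ ?_ ?_ hX hY
  · rw [i0]
    push_cast
    field_simp
    ring
  · rw [i1]
    push_cast
    field_simp
    ring
  · refine div_ne_zero (mul_ne_zero (pow_ne_zero _ ?_) hsc) (pow_ne_zero _ hp')
    rw [← neg_sub]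
    exact neg_ne_zero.mpr hm'
  · -- the two sides have opposite signs
    have hlt : 0 < (cosQ α - sinQ α) ^ 2 / (sinQ α + cosQ α) ^ 4 +
        (sinQ α + cosQ α) ^ 2 / (sinQ α - cosQ α) ^ 4 := by positivity
    intro he
    have : (sinQ α * cosQ α) * ((cosQ α - sinQ α) ^ 2 / (sinQ α + cosQ α) ^ 4 +
        (sinQ α + cosQ α) ^ 2 / (sinQ α - cosQ α) ^ 4) = 0 := by
      linear_combination he
    exact mul_ne_zero hsc hlt.ne' this

/-- The braids generate the phase gates controlled by two neighbouring qubits. -/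
theorem controlledPhase_mem (h : IsGoodAngle α) {j k : Fin n} (hjk : (j : ℕ) + 1 = k) :
    I • realDiag (fun x : Fin n → Fin 2 => if x j = 0 ∧ x k = 0 then 1 else 0) ∈
      oneParam (reach (braidOperators α (2 * n)) (compFamily n α)) (isClosed_reach _ _) := by
  have hne : j ≠ k := fun h => by rw [h] at hjk; omega
  refine mem_oneParam_of_diagonal fun t => ?_
  have hD : leakEmb 0 (diagMat I) = Matrix.diagonal
      (Sum.elim (fun p => if p = (0, 0) then I else 0) fun e => if e = 0 then -I else 0) := by
    ext (⟨a, b⟩ | e) (⟨a', b'⟩ | e')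
    · fin_cases a <;> fin_cases b <;> fin_cases a' <;> fin_cases b' <;>
        simp [planeEmb_apply, leakPlane, diagMat, Fin.sum_univ_two]
    · fin_cases a <;> fin_cases b <;> fin_cases e' <;>
        simp [planeEmb_apply, leakPlane, diagMat, Fin.sum_univ_two]
    · fin_cases e <;> fin_cases a' <;> fin_cases b' <;>
        simp [planeEmb_apply, leakPlane, diagMat, Fin.sum_univ_two]
    · fin_cases e <;> fin_cases e' <;>
        simp [planeEmb_apply, leakPlane, diagMat, Fin.sum_univ_two]
  have hexp := (mem_oneParam _ _).mp (leakEmb_diagMat_mem h hjk) t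
  obtain ⟨g, hg⟩ : ∃ g : PairLabel → ℂ, g = NormedSpace.exp (t • Sum.elim
      (fun p : Fin 2 × Fin 2 => if p = (0, 0) then I else 0) fun e : Fin 2 => if e = 0 then -I else 0) :=
    ⟨_, rfl⟩
  have hdiag : Matrix.diagonal g ∈ reach (braidOperators α (2 * n)) (pairFamily α j k) := by
    rw [hD, ← Matrix.diagonal_smul] at hexp
    have h1 := Matrix.exp_diagonal (t • Sum.elim
      (fun p : Fin 2 × Fin 2 => if p = (0, 0) then I else 0) fun e : Fin 2 => if e = 0 then -I else 0)
    rw [hg]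
    exact (congrArg (· ∈ reach (braidOperators α (2 * n)) (pairFamily α j k)) h1).mp hexp
  refine mem_reach_of_context hdiag (fun x => .inl (x j, x k)) (fun x _ => x) (fun y _ => ?_)
    fun y _ => ?_
  · simp [compFamily, pairFamily]
  · have e : g (.inl (y j, y k)) = exp ((t * (if y j = 0 ∧ y k = 0 then 1 else 0) : ℝ) * I) := by
      rw [hg, Pi.coe_exp, ← Complex.exp_eq_exp_ℂ]
      by_cases hy : y j = 0 ∧ y k = 0
      · simp [hy.1, hy.2]
      · simp [hy]
    simp [Matrix.diagonal_apply, ite_smul, -Fintype.sum_sum_type, compFamily, pairFamily, e]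

end ControlledPhase

/-! ### The braiding of `V_β` with `S_1` -/

section Braiding
open Complex ComplexConjugate
variable {ι : Type} [Fintype ι] [DecidableEq ι]

theorem swap_tensor_F (A : QModule ι) : (ising.tensor A).F.submatrix Prod.swap Prod.swap =
    A.F ⊗ₖ ising.Kinv + (1 : Matrix ι ι ℂ) ⊗ₖ ising.F := by
  ext ⟨a, b⟩ ⟨c, d⟩
  simp only [Matrix.submatrix_apply, Prod.swap_prod_mk, QModule.tensor, Matrix.add_apply,
    Matrix.kroneckerMap_apply]
  ring

theorem rMatrix_comm_F {A : QModule ι} (hA : IsGraded A) (cA : HasComm A) :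
    A.rMatrix ising * (A.tensor ising).F =
      (A.F ⊗ₖ ising.Kinv + (1 : Matrix ι ι ℂ) ⊗ₖ ising.F) * A.rMatrix ising := by
  have hB := isGraded_ising
  rw [rMatrix_of_nil _ _ (Or.inr ising_F_sq)]
  set P := Matrix.diagonal fun x : ι × Fin 2 => qpow (A.wt x.1 * ising.wt x.2 / 2) with hP
  have e1 : (A.F ⊗ₖ ising.Kinv) * P = P * (A.F ⊗ₖ (1 : Matrix (Fin 2) (Fin 2) ℂ)) := by
    ext ⟨a, b⟩ ⟨c, d⟩
    rw [hP, Matrix.mul_diagonal, Matrix.diagonal_mul, Matrix.kroneckerMap_apply,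
      Matrix.kroneckerMap_apply]
    by_cases hF : A.F a c = 0
    · simp [hF]
    by_cases hbd : b = d
    · subst hbd
      simp only [QModule.Kinv, Matrix.diagonal_apply_eq, Matrix.one_apply_eq, hA.2 a c hF]
      rw [mul_assoc, ← qpow_add, mul_one, mul_comm]
      congr 2
      ring
    · simp [QModule.Kinv, hbd]
  have e2 : ((1 : Matrix ι ι ℂ) ⊗ₖ ising.F) * P = P * (A.K ⊗ₖ ising.F) := by
    ext ⟨a, b⟩ ⟨c, d⟩
    rw [hP, Matrix.mul_diagonal, Matrix.diagonal_mul, Matrix.kroneckerMap_apply,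
      Matrix.kroneckerMap_apply]
    by_cases hF : ising.F b d = 0
    · simp [hF]
    by_cases hac : a = c
    · subst hac
      simp only [QModule.K, Matrix.diagonal_apply_eq, Matrix.one_apply_eq, hB.2 b d hF]
      rw [← mul_assoc, ← qpow_add, one_mul, mul_comm]
      congr 2
      ring
    · simp [QModule.K, hac]
  have ht := qbr_one_ne_zero
  rw [HasComm] at cA
  rw [← Matrix.mul_assoc, Matrix.add_mul, e1, e2, ← Matrix.mul_add, Matrix.mul_assoc,
    Matrix.mul_assoc]
  congr 1
  simp only [QModule.tensor, mul_add, add_mul, Matrix.smul_mul, Matrix.mul_smul,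
    ← Matrix.mul_kronecker_mul, mul_one, one_mul, ising_F_sq, Matrix.kronecker_zero, smul_zero,
    add_zero, cA, kron_add, kron_smul, kron_sub, smul_add, smul_smul, mul_inv_cancel₀ ht, one_smul]
  abel

/-- The braiding of a module with `S_1` commutes with `F`. -/
theorem braiding_comm_F {A : QModule ι} (hA : IsGraded A) (cA : HasComm A) :
    A.braiding ising * (A.tensor ising).F = (ising.tensor A).F * A.braiding ising := by
  have h := congrArg (fun M => M.submatrix Prod.swap id) (rMatrix_comm_F hA cA)
  simp only at h
  rw [← swap_tensor_F] at h
  have e1 := Matrix.submatrix_mul_equiv ((ising.tensor A).F.submatrix Prod.swap Prod.swap)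
    (A.rMatrix ising) Prod.swap (Equiv.refl _) id
  have e2 := Matrix.submatrix_mul_equiv (A.rMatrix ising) ((A.tensor ising).F) Prod.swap
    (Equiv.refl _) id
  have e3 := Matrix.submatrix_mul_equiv (ising.tensor A).F ((A.rMatrix ising).submatrix Prod.swap id)
    id (Equiv.prodComm ι (Fin 2)) id
  rw [← e2] at h
  refine h.trans (e1.symm.trans (Eq.trans ?_ e3))
  congr 1

theorem hwMap_mulVec_eq {κ : Type} [Fintype κ] [DecidableEq κ] {A : QModule ι} {B : QModule κ}
    {c : Matrix κ ι ℂ} (h : c * A.F = B.F * c) (w : ι → ℂ) :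
    hwMap B (c *ᵥ w) = c * hwMap A w := by
  refine Matrix.ext_of_mulVec_single fun j => ?_
  rw [← Matrix.mulVec_mulVec, hwMap_mulVec, hwMap_mulVec]
  induction (j : ℕ) with
  | zero => simp
  | succ k ih =>
    rw [pow_succ', ← Matrix.mulVec_mulVec, ih, Matrix.mulVec_mulVec, ← h, pow_succ',
      ← Matrix.mulVec_mulVec, ← Matrix.mulVec_mulVec]

theorem hwMap_smul (A : QModule ι) (c : ℂ) (w : ι → ℂ) : hwMap A (c • w) = c • hwMap A w := by
  ext i j
  simp [hwMap, Matrix.mulVec_smul]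

/-- The module `S_1 ⊗ V_β` contains `V_(β ± 1)` by the images of the highest weight vectors. -/
def vertexSwap (β : ℝ) (s : Fin 2) : Matrix (Fin 2 × Fin 4) (Fin 4) ℂ :=
  hwMap (ising.tensor (typical β)) (hwVecSwap β s)

/-- The scalar that relates the highest weight vectors of `S_1 ⊗ V_β` to the braided highest weight
vectors of `V_β ⊗ S_1`. -/
def braidScalar (β : ℝ) (s : Fin 2) : ℂ :=
  if s = 0 then qpow ((β + 3) / 2) else -(lowerCoeff β * qpow ((β + 1) / 2))

theorem braiding_mul_vertex {β : ℝ} (hβ : ∀ k : ℤ, β ≠ k) (s : Fin 2) :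
    (typical β).braiding ising * vertex β s = braidScalar β s • vertexSwap β s := by
  rw [vertex, ← hwMap_mulVec_eq (braiding_comm_F (isGraded_typical β) (hasComm_typical β)),
    vertexSwap, ← hwMap_smul]
  congr 1
  have h0 : qint (1 - β) ≠ 0 := qint_ne_zero (fun k hk => hβ (1 - k) (by push_cast; linarith))
  have h1 : qint 1 = 1 := div_self qbr_one_ne_zero
  have hq := qpow_ne_zero 1
  have hr : ∀ x : Fin 4 × Fin 2 → ℂ, ∀ b a, ((typical β).braiding ising *ᵥ x) (b, a) =
      qpow ((typical β).wt a * ising.wt b / 2) * (((1 : Matrix (Fin 4 × Fin 2) (Fin 4 × Fin 2) ℂ) +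
        qbr 1 • ((typical β).E ⊗ₖ ising.F)) *ᵥ x) (a, b) := by
    intro x b a
    rw [braiding, rMatrix_of_nil _ _ (Or.inr ising_F_sq)]
    change (((Matrix.diagonal _ * _) : Matrix _ _ ℂ) *ᵥ x) (a, b) = _
    rw [← Matrix.mulVec_mulVec, Matrix.mulVec_diagonal]
  funext y
  obtain ⟨b, a⟩ := y
  rw [hr]
  fin_cases s
  · fin_cases a <;> fin_cases b <;>
      simp [hwVec, hwVecSwap, braidScalar, typical, ising]
  · have e1 : β + 3 - 2 = β + 1 := by ring
    have e2 : qpow ((β + 3) * (1 - 2) / 2) * (1 - qbr 1 * (lowerCoeff β * qint (1 - β))) =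
        lowerCoeff β * qpow ((β + 1) / 2) * (qint (1 - β) * qpow (-β - 3)) := by
      rw [lowerCoeff, qbr, div_mul_cancel₀ _ h0]
      have e3 : qpow ((β + 3) * (1 - 2) / 2) = qpow (-2) * qpow 1 * qpow ((β + 1) / 2) *
          qpow (-β - 1) := by
        simp only [← qpow_add]; congr 1; ring
      have e4 : qpow (-β - 3) = qpow (-2) * qpow (-β - 1) := by
        simp only [← qpow_add]; congr 1; ring
      rw [e3, e4, qpow_neg 1]
      field_simp
      ring
    fin_cases a <;> fin_cases b <;>
      simp [hwVec_one, hwVecSwap, braidScalar, typical, ising, Matrix.mulVec_sub, Matrix.mulVec_smul, h1, e1]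
    · linear_combination e2
    · exact mul_comm _ _

end Braiding

/-! ### The invariant forms and the dual vertices -/

section Forms
open Complex ComplexConjugate

theorem conj_qpow (x : ℝ) : conj (qpow x) = qpow (-x) := by
  rw [qpow, qpow, ← Complex.exp_conj, map_mul, conj_ofReal, conj_I]
  congr 1
  push_cast
  ring

theorem conj_qint (x : ℝ) : conj (qint x) = qint x := by rw [qint_eq_sinQ, conj_ofReal]

theorem conjTranspose_K {ι : Type} [DecidableEq ι] (A : QModule ι) : A.Kᴴ = A.Kinv := by
  rw [QModule.K, QModule.Kinv, Matrix.diagonal_conjTranspose]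
  congr 1
  funext i
  exact conj_qpow _

theorem conjTranspose_ising_E : ising.Eᴴ = ising.F := by
  ext i j
  simp [ising, apply_ite]

theorem qint_succ_ne_zero {k : ℕ} (hk : k < 3) : qint (k + 1) ≠ 0 := by
  rw [qint_eq_sinQ, ofReal_ne_zero]
  refine mul_ne_zero (by positivity) (Real.sin_pos_of_pos_of_lt_pi (by positivity) ?_).ne'
  have : (k : ℝ) < 3 := by exact_mod_cast hk
  have hpi := Real.pi_pos
  rw [div_lt_iff₀ (by norm_num)]
  exact mul_lt_mul_of_pos_left (by linarith) hpi

theorem normSq_ne_zero {β : ℝ} (hβ : ∀ k : ℤ, β ≠ k) (i : Fin 4) : normSq β i ≠ 0 := by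
  refine Finset.prod_ne_zero_iff.mpr fun k hk => mul_ne_zero (qint_succ_ne_zero ?_)
    (qint_ne_zero fun m hm => hβ (k + 1 - m) (by push_cast; linarith))
  have := Finset.mem_range.mp hk
  have := i.2
  omega

theorem normSq_succ (β : ℝ) {i j : Fin 4} (h : (i : ℕ) = j + 1) :
    normSq β i = normSq β j * (qint i * qint (i - β)) := by
  rw [normSq, h, Finset.prod_range_succ, normSq]
  push_cast
  rfl

/-- The generators `E` and `F` are adjoint for the invariant Hermitian form. -/
theorem conjTranspose_typical_E (β : ℝ) :
    (typical β).Eᴴ * Matrix.diagonal (normSq β) = Matrix.diagonal (normSq β) * (typical β).F := by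
  ext i j
  rw [Matrix.mul_diagonal, Matrix.diagonal_mul, Matrix.conjTranspose_apply]
  simp only [typical, Matrix.of_apply]
  split_ifs with h
  · rw [normSq_succ β h, star_mul']
    change conj _ * conj _ * _ = _
    rw [conj_qint, conj_qint]
    ring
  · simp

theorem inv_normSq_mul_conjTranspose_E {β : ℝ} (hβ : ∀ k : ℤ, β ≠ k) :
    Matrix.diagonal (fun i => (normSq β i)⁻¹) * (typical β).Eᴴ =
      (typical β).F * Matrix.diagonal fun i => (normSq β i)⁻¹ := by
  have h1 : Matrix.diagonal (fun i => (normSq β i)⁻¹) * Matrix.diagonal (normSq β) = 1 := by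
    rw [Matrix.diagonal_mul_diagonal, ← Matrix.diagonal_one]
    congr 1; funext i; exact inv_mul_cancel₀ (normSq_ne_zero hβ i)
  have h2 := mul_eq_one_comm.mp h1
  calc _ = Matrix.diagonal (fun i => (normSq β i)⁻¹) * ((typical β).Eᴴ * Matrix.diagonal (normSq β)) *
          Matrix.diagonal (fun i => (normSq β i)⁻¹) := by
        rw [Matrix.mul_assoc, Matrix.mul_assoc, h2, Matrix.mul_one]
    _ = _ := by
        rw [conjTranspose_typical_E, ← Matrix.mul_assoc, h1, Matrix.one_mul]

/-- The product form on `V_β ⊗ S_1`. -/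
def productForm (β : ℝ) : Matrix (Fin 4 × Fin 2) (Fin 4 × Fin 2) ℂ :=
  Matrix.diagonal fun x => normSq β x.1

theorem conjTranspose_tensor_E (β : ℝ) :
    ((typical β).tensor ising).Eᴴ * productForm β =
      productForm β * ((ising.tensor (typical β)).F.submatrix Prod.swap Prod.swap) := by
  have e : productForm β = Matrix.diagonal (normSq β) ⊗ₖ (1 : Matrix (Fin 2) (Fin 2) ℂ) := by
    rw [← Matrix.diagonal_one, Matrix.diagonal_kronecker_diagonal, productForm]
    simp
  rw [swap_tensor_F, e, QModule.tensor]
  simp only [Matrix.conjTranspose_add, Matrix.conjTranspose_kronecker, conjTranspose_K,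
    conjTranspose_ising_E, Matrix.conjTranspose_one, Matrix.add_mul, Matrix.mul_add,
    ← Matrix.mul_kronecker_mul, Matrix.mul_one, Matrix.one_mul, conjTranspose_typical_E]
  abel

theorem vertexSwap_comm_F {β : ℝ} (hβ : ∀ k : ℤ, β ≠ k) (s : Fin 2) (γ : ℝ) :
    vertexSwap β s * (typical γ).F = (ising.tensor (typical β)).F * vertexSwap β s := by
  have h0 : braidScalar β s ≠ 0 := by
    have h1 : qint (1 - β) ≠ 0 := qint_ne_zero (fun k hk => hβ (1 - k) (by push_cast; linarith))
    rw [braidScalar]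
    split_ifs
    · exact qpow_ne_zero _
    · exact neg_ne_zero.mpr (mul_ne_zero (div_ne_zero (qpow_ne_zero _) h1) (qpow_ne_zero _))
  have e : vertexSwap β s = (braidScalar β s)⁻¹ • ((typical β).braiding ising * vertex β s) := by
    rw [braiding_mul_vertex hβ, inv_smul_smul₀ h0]
  have e2 : vertex β s * (typical γ).F = ((typical β).tensor ising).F * vertex β s :=
    (isHom_vertex β hβ s).2.1
  rw [e, Matrix.smul_mul, Matrix.mul_smul, Matrix.mul_assoc, e2, ← Matrix.mul_assoc,
    braiding_comm_F (isGraded_typical β) (hasComm_typical β), Matrix.mul_assoc]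

/-- The value of the pairing of the highest weight vectors of `V_β ⊗ S_1` and `S_1 ⊗ V_β`. -/
def pairScalar (β : ℝ) (s : Fin 2) : ℂ := if s = 0 then 1 else -(qpow (2 - β) * qint β)

theorem vertex_apply_eq_zero {β : ℝ} (hβ : ∀ k : ℤ, β ≠ k) (s : Fin 2) {x : Fin 4 × Fin 2}
    {i : Fin 4} (h : (β + 3 - 2 * x.1) + (1 - 2 * x.2) ≠ β + ising.wt s + 3 - 2 * i) :
    vertex β s x i = 0 := by
  have h4 := congrFun (congrFun (isHom_vertex β hβ s).2.2 x) i
  simp only [QModule.H, Matrix.mul_diagonal, Matrix.diagonal_mul] at h4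
  by_contra hf
  rw [mul_comm] at h4
  exact h (ofReal_inj.mp (mul_right_cancel₀ hf h4)).symm

/-- By Schur's lemma, the adjoint vertices are dual to the vertices of `S_1 ⊗ V_β`. -/
theorem vertex_conjTranspose_mul {β : ℝ} (hβ : ∀ k : ℤ, β ≠ k) (s s' : Fin 2) :
    Matrix.diagonal (fun i => (normSq (β + ising.wt s) i)⁻¹) * (vertex β s)ᴴ *
        (productForm β * (vertexSwap β s').submatrix Prod.swap id) =
      if s = s' then pairScalar β s • 1 else 0 := by
  have hγ : ∀ k : ℤ, β + ising.wt s ≠ k := by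
    fin_cases s
    · simpa [ising] using shift_ne_int hβ 1
    · convert shift_ne_int hβ (-1) using 3
      simp [ising]; norm_num
  have hcomm : (Matrix.diagonal (fun i => (normSq (β + ising.wt s) i)⁻¹) * (vertex β s)ᴴ *
        (productForm β * (vertexSwap β s').submatrix Prod.swap id)) * (typical (β + ising.wt s)).F =
      (typical (β + ising.wt s)).F * (Matrix.diagonal (fun i => (normSq (β + ising.wt s) i)⁻¹) *
        (vertex β s)ᴴ * (productForm β * (vertexSwap β s').submatrix Prod.swap id)) := by
    have e1 : (vertexSwap β s').submatrix Prod.swap id * (typical (β + ising.wt s)).F =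
        ((ising.tensor (typical β)).F.submatrix Prod.swap Prod.swap) *
          (vertexSwap β s').submatrix Prod.swap id := by
      have e2 := Matrix.submatrix_mul_equiv (ising.tensor (typical β)).F (vertexSwap β s')
        Prod.swap (Equiv.prodComm (Fin 4) (Fin 2)) id
      have e3 := Matrix.submatrix_mul_equiv (vertexSwap β s') (typical (β + ising.wt s)).F Prod.swap
        (Equiv.refl _) id
      refine e3.trans (Eq.trans ?_ e2.symm)
      rw [vertexSwap_comm_F hβ]
    have e4 : (vertex β s)ᴴ * ((typical β).tensor ising).Eᴴ =
        (typical (β + ising.wt s)).Eᴴ * (vertex β s)ᴴ := by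
      rw [← Matrix.conjTranspose_mul, ← Matrix.conjTranspose_mul, (isHom_vertex β hβ s).1]
    calc _ = Matrix.diagonal (fun i => (normSq (β + ising.wt s) i)⁻¹) * ((vertex β s)ᴴ *
            ((productForm β * ((ising.tensor (typical β)).F.submatrix Prod.swap Prod.swap)) *
              (vertexSwap β s').submatrix Prod.swap id)) := by
          simp only [Matrix.mul_assoc, e1]
      _ = Matrix.diagonal (fun i => (normSq (β + ising.wt s) i)⁻¹) *
            (((vertex β s)ᴴ * ((typical β).tensor ising).Eᴴ) *
              (productForm β * (vertexSwap β s').submatrix Prod.swap id)) := by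
          rw [← conjTranspose_tensor_E]
          simp only [Matrix.mul_assoc]
      _ = _ := by
          rw [e4, Matrix.mul_assoc, ← Matrix.mul_assoc _ (typical (β + ising.wt s)).Eᴴ,
            inv_normSq_mul_conjTranspose_E hγ]
          simp only [Matrix.mul_assoc]
  have hcol : ∀ i, (Matrix.diagonal (fun i => (normSq (β + ising.wt s) i)⁻¹) * (vertex β s)ᴴ *
        (productForm β * (vertexSwap β s').submatrix Prod.swap id)) i 0 =
      (normSq (β + ising.wt s) i)⁻¹ * ∑ x : Fin 4 × Fin 2,
        conj (vertex β s x i) * (normSq β x.1 * hwVecSwap β s' x.swap) := by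
    intro i
    rw [Matrix.mul_assoc, Matrix.diagonal_mul, Matrix.mul_apply]
    congr 1
    refine Finset.sum_congr rfl fun x _ => ?_
    rw [productForm, Matrix.diagonal_mul, Matrix.submatrix_apply, id, vertexSwap, hwMap_apply_zero]
    rfl
  have hn0 : ∀ γ, normSq γ 0 = 1 := fun γ => by simp [normSq]
  have h1 : qint 1 = 1 := div_self qbr_one_ne_zero
  have hn1 : normSq β 1 = qint (1 - β) := by simp [normSq, h1]
  have hz2 : ∀ x : Fin 4 × Fin 2, (x = (0, 0) ∨ x = (0, 1) ∨ x = (1, 0)) →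
      vertex β s x 2 = 0 ∧ vertex β s x 3 = 0 := by
    rintro x (rfl | rfl | rfl) <;> refine ⟨vertex_apply_eq_zero hβ s ?_, vertex_apply_eq_zero hβ s ?_⟩ <;>
      fin_cases s <;> simp [ising] <;> intro h <;> linarith
  have v0 : ∀ x, vertex β s x 0 = hwVec β s x := fun x => hwMap_apply_zero _ _ x
  have v1 : ∀ x, vertex β s x 1 = hwVecF β s x := fun x => by
    rw [vertex, hwMap_apply_one, F_mulVec_hwVec]
  have h0 : qint (1 - β) ≠ 0 := qint_ne_zero (fun k hk => hβ (1 - k) (by push_cast; linarith))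
  refine IsHom.ext_typical (A := typical (β + ising.wt s)) (β := β + ising.wt s) hcomm ?_ fun i => ?_
  · split_ifs <;> simp
  rw [hcol]
  have hsum : ∀ g : Fin 4 × Fin 2 → ℂ, (∑ x : Fin 4 × Fin 2,
      g x * (normSq β x.1 * hwVecSwap β s' x.swap)) =
      if s' = 0 then g (0, 0) else
        g (1, 0) * qint (1 - β) - g (0, 1) * (qint (1 - β) * qpow (-β - 3)) := by
    intro g
    fin_cases s' <;>
      simp [Fintype.sum_prod_type, Fin.sum_univ_four, hwVecSwap, hn0, hn1, Pi.single_apply]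
    ring
  rw [hsum]
  obtain ⟨z1, z1'⟩ := hz2 (0, 0) (by simp)
  obtain ⟨z2, z2'⟩ := hz2 (0, 1) (by simp)
  obtain ⟨z3, z3'⟩ := hz2 (1, 0) (by simp)
  have hlast : -(conj (lowerCoeff β) * qint (1 - β)) - qint (1 - β) * qpow (-β - 3) =
      -(qpow (2 - β) * qint β) := by
    have hq := qpow_ne_zero 1
    have hQ := qpow_ne_zero β
    have e1 : conj (lowerCoeff β) * qint (1 - β) = qpow 1 := by
      rw [lowerCoeff, map_div₀, conj_qint, conj_qpow, neg_neg, div_mul_cancel₀ _ h0]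
    have e2 : qpow (-β - 3) = -(qpow 1 * (qpow β)⁻¹) := by
      rw [sub_eq_add_neg, qpow_add, qpow_neg, qpow_neg, qpow_three]
      field_simp
    have e3 : qpow (2 - β) = qpow 1 ^ 2 * (qpow β)⁻¹ := by
      rw [sub_eq_add_neg, qpow_add, qpow_neg, show (2 : ℝ) = (2 : ℕ) * 1 by norm_num, qpow_nat_mul]
    have h3 := sq_qpow_one_sub_one_ne_zero
    rw [e1, e2, e3, (qint_one_sub_eq hβ).1, qint_eq_div]
    field_simp
    ring
  have hF : conj (qpow (-(β + 3))) * (qint (1 - β) * qpow (-β - 3)) = qint (1 - β) := by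
    rw [conj_qpow, neg_neg, mul_left_comm, ← qpow_add, show β + 3 + (-β - 3) = 0 by ring, qpow_zero,
      mul_one]
  fin_cases i <;> simp only [Fin.zero_eta, Fin.mk_one, Fin.reduceFinMk, v0, v1, z1, z1', z2, z2', z3,
    z3', hn0] <;> fin_cases s <;> fin_cases s' <;>
    simp [hwVec_zero, hwVec_one, hwVecF, pairScalar, hlast, hF, -neg_add_rev]

end Forms

/-! ### The Hermitian form and the density of the braids -/

section Gram
open Complex ComplexConjugate
variable {n : ℕ} {α β : ℝ}

theorem pairScalar_ne_zero (hβ : ∀ k : ℤ, β ≠ k) (s : Fin 2) : pairScalar β s ≠ 0 := by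
  rw [pairScalar]
  split_ifs
  · exact one_ne_zero
  · exact neg_ne_zero.mpr (mul_ne_zero (qpow_ne_zero _) (qint_ne_zero hβ))

/-- The dual vertices form a left inverse of the decomposition of `S_1 ⊗ V_β`, up to scalars. -/
theorem isUnit_decomp (hβ : ∀ k : ℤ, β ≠ k) : IsUnit (decomp β) := by
  obtain ⟨L, hL⟩ : ∃ L : Matrix (Fin 2 × Fin 4) (Fin 2 × Fin 4) ℂ, L = Matrix.of fun x y =>
      (Matrix.diagonal (fun i => (normSq (β + ising.wt x.1) i)⁻¹) * (vertex β x.1)ᴴ *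
        productForm β) x.2 y.swap := ⟨_, rfl⟩
  have h : L * decomp β = Matrix.diagonal fun x => pairScalar β x.1 := by
    ext ⟨s, i⟩ ⟨s', j⟩
    have e := congrFun (congrFun (vertex_conjTranspose_mul hβ s s') i) j
    rw [← Matrix.mul_assoc, Matrix.mul_apply, ← (Equiv.prodComm (Fin 2) (Fin 4)).sum_comp] at e
    rw [Matrix.mul_apply]
    refine Eq.trans (Finset.sum_congr rfl fun y _ => ?_) (e.trans ?_)
    · rw [hL]; rfl
    · by_cases hs : s = s'
      · subst hs
        by_cases hij : i = j
        · subst hij; simp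
        · simp [hij]
      · simp [hs]
  have hd : IsUnit (L * decomp β).det := by
    rw [h, Matrix.det_diagonal, isUnit_iff_ne_zero]
    exact Finset.prod_ne_zero_iff.mpr fun x _ => pairScalar_ne_zero hβ x.1
  rw [Matrix.isUnit_iff_isUnit_det]
  rw [Matrix.det_mul] at hd
  exact isUnit_of_mul_isUnit_right hd

theorem sqrtTwist_ne_zero (β : ℝ) : sqrtTwist β ≠ 0 := qpow_ne_zero _

theorem sqrtTwistTensor_inv_mul (hβ : ∀ k : ℤ, β ≠ k) (s : Fin 2) :
    (sqrtTwistTensor β)⁻¹ * vertexSwap β s =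
      (sqrtTwist (β + ising.wt s))⁻¹ • vertexSwap β s := by
  have hD := (Matrix.isUnit_iff_isUnit_det _).mp (isUnit_decomp hβ)
  have hdiag : (Matrix.diagonal fun y : Fin 2 × Fin 4 => sqrtTwist (β + ising.wt y.1)).det ≠ 0 := by
    rw [Matrix.det_diagonal]
    exact Finset.prod_ne_zero_iff.mpr fun x _ => sqrtTwist_ne_zero _
  have hS : IsUnit (sqrtTwistTensor β).det := by
    rw [sqrtTwistTensor, Matrix.det_mul, Matrix.det_mul]
    exact (hD.mul (isUnit_iff_ne_zero.mpr hdiag)).mul (Matrix.isUnit_nonsing_inv_det _ hD)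
  have h1 : sqrtTwistTensor β * decomp β =
      decomp β * Matrix.diagonal fun y : Fin 2 × Fin 4 => sqrtTwist (β + ising.wt y.1) := by
    rw [sqrtTwistTensor, Matrix.mul_assoc, Matrix.nonsing_inv_mul _ hD, Matrix.mul_one]
  have h2 : sqrtTwistTensor β * vertexSwap β s = sqrtTwist (β + ising.wt s) • vertexSwap β s := by
    ext x j
    have e := congrFun (congrFun h1 x) (s, j)
    rw [Matrix.mul_diagonal, Matrix.mul_apply] at e
    rw [Matrix.mul_apply, Matrix.smul_apply, smul_eq_mul, mul_comm]
    exact e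
  have h3 := congrArg (fun M => (sqrtTwistTensor β)⁻¹ * M) h2
  simp only [← Matrix.mul_assoc, Matrix.nonsing_inv_mul _ hS, Matrix.one_mul, Matrix.mul_smul] at h3
  exact (eq_inv_smul_iff₀ (sqrtTwist_ne_zero _)).mpr h3.symm

/-- The norms of the vertices. -/
def vertexNorm (β : ℝ) (s : Fin 2) : ℂ := if s = 0 then 1 else -(qint β / qint (β - 1))

theorem vertexNorm_eq (hβ : ∀ k : ℤ, β ≠ k) (s : Fin 2) :
    sqrtTwist β * qpow (-5 / 4) * (braidScalar β s * (sqrtTwist (β + ising.wt s))⁻¹) *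
      pairScalar β s = vertexNorm β s := by
  rw [sqrtTwist, sqrtTwist, ← qpow_neg]
  fin_cases s
  · simp only [Fin.zero_eta, braidScalar, pairScalar, vertexNorm, if_true, ising_wt_zero,
      ← qpow_add, mul_one]
    rw [← qpow_zero]
    congr 1
    ring
  · have h0 : qint (1 - β) ≠ 0 := qint_ne_zero (fun k hk => hβ (1 - k) (by push_cast; linarith))
    have e : qint (β - 1) = -qint (1 - β) := by rw [← qint_neg, neg_sub]
    have e2 : qpow ((β ^ 2 - 9) / 4) * qpow (-5 / 4) * (qpow (-1) * qpow ((β + 1) / 2) *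
        qpow (-(((β + -1) ^ 2 - 9) / 4))) * qpow (2 - β) = 1 := by
      simp only [← qpow_add]
      rw [← qpow_zero]
      congr 1
      ring
    simp only [Fin.mk_one, braidScalar, pairScalar, vertexNorm, one_ne_zero, if_false, ising_wt_one,
      lowerCoeff, e]
    generalize qpow (-5 / 4) = u at e2 ⊢
    generalize qpow (-(((β + -1) ^ 2 - 9) / 4)) = v at e2 ⊢
    field_simp
    linear_combination qint β * e2

/-- The vertices are orthogonal. -/
theorem vertexAdj_mul_vertex (hβ : ∀ k : ℤ, β ≠ k) (s s' : Fin 2) :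
    vertexAdj β s * vertex β s' = if s = s' then vertexNorm β s • 1 else 0 := by
  have h1 : tensorForm β * vertex β s' =
      (sqrtTwist β * qpow (-5 / 4) * (braidScalar β s' * (sqrtTwist (β + ising.wt s'))⁻¹)) •
        (productForm β * (vertexSwap β s').submatrix Prod.swap id) := by
    have e1 : ((sqrtTwistTensor β)⁻¹ * (typical β).braiding ising *
        Matrix.diagonal (fun _ : Fin 4 × Fin 2 => sqrtTwist β * qpow (-5 / 4))) * vertex β s' =
        (sqrtTwist β * qpow (-5 / 4) * (braidScalar β s' * (sqrtTwist (β + ising.wt s'))⁻¹)) •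
          vertexSwap β s' := by
      rw [← Matrix.smul_one_eq_diagonal, Matrix.mul_smul, Matrix.mul_one, Matrix.smul_mul,
        Matrix.mul_assoc, braiding_mul_vertex hβ, Matrix.mul_smul, sqrtTwistTensor_inv_mul hβ,
        smul_smul, smul_smul, mul_assoc (sqrtTwist β * qpow (-5 / 4))]
    have e2 := Matrix.submatrix_mul_equiv ((sqrtTwistTensor β)⁻¹ * (typical β).braiding ising *
        Matrix.diagonal (fun _ : Fin 4 × Fin 2 => sqrtTwist β * qpow (-5 / 4))) (vertex β s')
        Prod.swap (Equiv.refl _) id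
    rw [e1] at e2
    rw [tensorForm, Matrix.mul_assoc, productForm]
    refine (congrArg _ e2).trans ?_
    rw [← Matrix.mul_smul]
    rfl
  rw [vertexAdj, Matrix.mul_assoc, h1, Matrix.mul_smul, vertex_conjTranspose_mul hβ]
  split_ifs with hs
  · subst hs
    rw [smul_smul, vertexNorm_eq hβ]
  · rw [smul_zero]

theorem bra_mul_ket (hα : ∀ k : ℤ, α ≠ k) (s s' : ℕ → Fin 2) : ∀ m : ℕ,
    bra α s m * ket α s' m =
      if ∀ k < m, s k = s' k then
        (∏ k ∈ Finset.range m, vertexNorm (charge α s k) (s k)) • (1 : Matrix (Fin 4) (Fin 4) ℂ)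
      else 0
  | 0 => by
    simp only [bra, ket]
    simp
  | m + 1 => by
    have e : bra α s (m + 1) * ket α s' (m + 1) = vertexAdj (charge α s m) (s m) *
        (((bra α s m * ket α s' m) ⊗ₖ (1 : Matrix (Fin 2) (Fin 2) ℂ)) *
          vertex (charge α s' m) (s' m)) := by
      have := Matrix.mul_kronecker_mul (bra α s m) (ket α s' m) (1 : Matrix (Fin 2) (Fin 2) ℂ)
        (1 : Matrix (Fin 2) (Fin 2) ℂ)
      rw [Matrix.one_mul] at this
      rw [this, bra, ket]
      exact (Matrix.mul_assoc _ _ _).trans (congrArg _ (Matrix.mul_assoc _ _ _).symm)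
    rw [e, bra_mul_ket hα s s' m]
    by_cases h : ∀ k < m, s k = s' k
    · rw [if_pos h, Matrix.smul_kronecker, Matrix.one_kronecker_one, Matrix.smul_mul, Matrix.one_mul,
        ← charge_congr h, Matrix.mul_smul, vertexAdj_mul_vertex (charge_ne_int α hα s m)]
      by_cases hm : s m = s' m
      · rw [if_pos hm, if_pos (fun k hk => by
          rcases Nat.lt_succ_iff_lt_or_eq.mp hk with h' | rfl
          · exact h k h'
          · exact hm), Finset.prod_range_succ, smul_smul]
      · rw [if_neg hm, if_neg (fun h' => hm (h' m (by omega))), smul_zero]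
    · rw [if_neg h, if_neg (fun h' => h fun k hk => h' k (by omega)), Matrix.zero_kronecker,
        Matrix.zero_mul, Matrix.mul_zero]

theorem compChannels_injective {x y : Fin n → Fin 2}
    (h : ∀ k < 2 * n, compChannels x k = compChannels y k) : x = y := by
  funext j
  rw [← compChannels_even x j, ← compChannels_even y j]
  exact h _ (by omega)

theorem prod_range_two_mul {M : Type} [CommMonoid M] (f : ℕ → M) : ∀ n : ℕ,
    ∏ k ∈ Finset.range (2 * n), f k = ∏ j : Fin n, f (2 * j) * f (2 * j + 1)
  | 0 => by simp
  | n + 1 => by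
    rw [Nat.mul_succ, Finset.prod_range_succ, Finset.prod_range_succ, prod_range_two_mul f n,
      Fin.prod_univ_castSucc, mul_assoc]
    rfl

/-- The factor that a qubit in the state `0` contributes to the form; it is `-[α + 1] / [α]`. -/
def gramFactor (α : ℝ) : ℝ := -((sinQ α + cosQ α) / (√2 * sinQ α))

theorem vertexNorm_pair (h : IsGoodAngle α) (x : Fin n → Fin 2) (j : Fin n) :
    vertexNorm (charge α (compChannels x) (2 * j)) (compChannels x (2 * j)) *
      vertexNorm (charge α (compChannels x) (2 * j + 1)) (compChannels x (2 * j + 1)) =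
      gramFactor α * ((if x j = 0 then 1 else (qubitNorm α : ℂ)) ^ 2)⁻¹ := by
  have h0 : (sinQ α : ℂ) ≠ 0 := ofReal_ne_zero.mpr h.sin_ne
  have hm : (sinQ α - cosQ α : ℂ) ≠ 0 := by exact_mod_cast h.sin_sub_cos_ne
  have hp : (sinQ α + cosQ α : ℂ) ≠ 0 := by exact_mod_cast h.sin_add_cos_ne
  have h2 := sqrt_two_mul_self
  have h3 : (√2 : ℂ) ≠ 0 := by intro h; simp [h] at h2
  rw [charge, charge_compChannels, compChannels_even, compChannels_odd]
  generalize x j = a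
  fin_cases a
  · simp only [vertexNorm, Fin.zero_eta, if_true, ising_wt_zero]
    have e1 : qint (α + 1) = sinQ α + cosQ α := by rw [qint_eq_sinQ, sinQ_add_one]; push_cast; rfl
    rw [sub_zero, if_neg one_ne_zero, add_sub_cancel_right, e1, qint_eq_sinQ, gramFactor]
    push_cast
    ring
  · have e1 : qint (α - 1) = sinQ α - cosQ α := by rw [qint_eq_sinQ, sinQ_sub_one]; push_cast; rfl
    have e2 : (qubitNorm α : ℂ) ^ 2 = (sinQ α ^ 2 - cosQ α ^ 2) / (2 * sinQ α ^ 2) := by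
      rw [← ofReal_pow, qubitNorm_sq h]; push_cast; rfl
    have e3 : ((sinQ α : ℂ) ^ 2 - cosQ α ^ 2) ≠ 0 := by
      rw [sq_sub_sq]; exact mul_ne_zero hp hm
    simp only [vertexNorm, Fin.mk_one, one_ne_zero, if_false, sub_self, if_true, mul_one]
    rw [e1, e2, qint_eq_sinQ, gramFactor]
    push_cast
    field_simp
    linear_combination -(((sinQ α : ℂ) ^ 2 - cosQ α ^ 2)) * h2

/-- The form is diagonal in the computational basis, and becomes a real multiple of the standard
form in the normalized basis. -/
theorem gram_eq (h : IsGoodAngle α) (n : ℕ) : gram n α =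
    (modDim α * gramFactor α ^ n) • Matrix.diagonal fun x => (compWeight α x ^ 2)⁻¹ := by
  ext x y
  rw [gram, Matrix.of_apply, modTrace, bra_mul_ket h.ne_int, Matrix.smul_apply,
    Matrix.diagonal_apply, smul_eq_mul]
  by_cases hxy : x = y
  · subst hxy
    rw [if_pos fun _ _ => rfl, if_pos rfl, Matrix.smul_apply, Matrix.one_apply_eq, smul_eq_mul,
      mul_one, prod_range_two_mul, Finset.prod_congr rfl fun j _ => vertexNorm_pair h x j,
      Finset.prod_mul_distrib, Finset.prod_const, Finset.card_univ, Fintype.card_fin, compWeight,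
      ← Finset.prod_pow, Finset.prod_inv_distrib, mul_assoc]
  · rw [if_neg fun h' => hxy (compChannels_injective h'), if_neg hxy]
    simp

theorem compWeight_eq_ofReal (h : IsGoodAngle α) (x : Fin n → Fin 2) :
    ∃ w : ℝ, 0 < w ∧ compWeight α x = w := by
  refine ⟨∏ j, if x j = 0 then 1 else qubitNorm α, Finset.prod_pos fun j _ => ?_, ?_⟩
  · split_ifs
    · exact one_pos
    · exact qubitNorm_pos h
  · rw [compWeight]
    push_cast
    exact Finset.prod_congr rfl fun j _ => by split_ifs <;> simp

theorem gram_scalar_eq_ofReal (h : IsGoodAngle α) (n : ℕ) :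
    ∃ g : ℝ, g ≠ 0 ∧ modDim α * gramFactor α ^ n = g := by
  have hs4 : sinQ (4 * α) ≠ 0 := by
    rw [sinQ, show Real.pi * (4 * α) / 4 = α * Real.pi by ring, Real.sin_ne_zero_iff]
    intro k hk
    exact h.ne_int k (mul_right_cancel₀ Real.pi_ne_zero hk).symm
  have hbr : ∀ x, qbr x = 2 * sinQ x * I := by
    intro x
    rw [qbr, qpow_eq, qpow_eq, sinQ, sinQ, cosQ, cosQ, mul_neg, neg_div, Real.sin_neg, Real.cos_neg]
    push_cast
    ring
  refine ⟨-4 * sinQ α / sinQ (4 * α) * gramFactor α ^ n, ?_, ?_⟩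
  · refine mul_ne_zero (div_ne_zero (mul_ne_zero (by norm_num) h.sin_ne) hs4) (pow_ne_zero _ ?_)
    exact neg_ne_zero.mpr (div_ne_zero h.sin_add_cos_ne (mul_ne_zero (by positivity) h.sin_ne))
  · have hs4' : (sinQ (4 * α) : ℂ) ≠ 0 := ofReal_ne_zero.mpr hs4
    rw [modDim, hbr, hbr]
    push_cast
    field_simp

theorem formDefinite (h : IsGoodAngle α) (n : ℕ) : FormDefinite n α := by
  obtain ⟨g, hg0, hg⟩ := gram_scalar_eq_ofReal h n
  have hpos : (Matrix.diagonal fun x : Fin n → Fin 2 => (compWeight α x ^ 2)⁻¹).PosDef := by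
    refine Matrix.PosDef.diagonal fun x => ?_
    obtain ⟨w, hw, e⟩ := compWeight_eq_ofReal h x
    rw [e]
    have : 0 < (w ^ 2)⁻¹ := by positivity
    exact_mod_cast this
  rw [FormDefinite, gram_eq h, hg]
  rcases lt_or_gt_of_ne hg0 with hlt | hgt
  · right
    rw [← neg_smul]
    refine hpos.smul ?_
    exact_mod_cast neg_pos.mpr hlt
  · left
    refine hpos.smul ?_
    exact_mod_cast hgt

end Gram

section Density
open scoped Pointwise
open Complex ComplexConjugate
variable {n : ℕ} {α : ℝ}

/-- Every unitary gate in the normalized basis is a limit of braids, up to phases. -/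
theorem mem_reach_of_unitary (h : IsGoodAngle α) {U : Matrix (Fin n → Fin 2) (Fin n → Fin 2) ℂ}
    (hU : Uᴴ * U = 1) : U ∈ reach (braidOperators α (2 * n)) (compFamily n α) := by
  obtain ⟨z, hz, H, hH, rfl⟩ := exists_phase_smul_exp hU
  have hmem := I_smul_mem_of_qubits (I_smul_one_mem_oneParam α n)
    (fun j => qubitEmb_sign j ▸ qubitEmb_su2Mat_mem h j 1 0)
    (fun j => qubitEmb_flip j ▸ qubitEmb_su2Mat_mem h j 0 I)
    (fun j k hjk => controlledPhase_mem h hjk) hH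
  have h1 := (mem_oneParam _ _).mp hmem 1
  rw [one_smul] at h1
  have hP : z • (1 : Matrix (Idx (2 * n)) (Idx (2 * n)) ℂ) ∈ braidOperators α (2 * n) :=
    ⟨z, hz, 1, by simp⟩
  have h2 : z • (1 : Matrix (Fin n → Fin 2) (Fin n → Fin 2) ℂ) ∈
      reach (braidOperators α (2 * n)) (compFamily n α) := by
    refine mem_reach_of_acts hP fun y _ => ?_
    simp [Matrix.one_apply, ite_smul]
  have h3 := mul_mem h2 h1
  rw [smul_mul_assoc, one_mul] at h3
  exact h3

/-- As the unit circle is compact, the phases of the approximating operators can be collected into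
one phase. -/
theorem exists_phase_of_mem_closure {V : Type} [AddCommGroup V] [Module ℂ V] [TopologicalSpace V]
    [ContinuousSMul ℂ V] {S : Set V} {v : V}
    (hv : v ∈ closure {w | ∃ c : ℂ, ‖c‖ = 1 ∧ ∃ f ∈ S, w = c • f}) :
    ∃ c : ℂ, ‖c‖ = 1 ∧ c • v ∈ closure S := by
  have hclosed : IsClosed ((Set.univ : Set Circle) • closure S) :=
    isClosed_closure.smul_left_of_isCompact isCompact_univ
  have hsub : {w | ∃ c : ℂ, ‖c‖ = 1 ∧ ∃ f ∈ S, w = c • f} ⊆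
      (Set.univ : Set Circle) • closure S := by
    rintro _ ⟨c, hc, f, hf, rfl⟩
    exact ⟨⟨c, mem_sphere_zero_iff_norm.mpr hc⟩, Set.mem_univ _, f, subset_closure hf, rfl⟩
  obtain ⟨c, -, f, hf, rfl⟩ := closure_minimal hsub hclosed hv
  refine ⟨((c⁻¹ : Circle) : ℂ), Circle.norm_coe _, ?_⟩
  have : ((c⁻¹ : Circle) : ℂ) • (c • f) = c⁻¹ • c • f := rfl
  simp only [this, inv_smul_smul]
  exact hf

theorem recombine_mem_closure (h : IsGoodAngle α) {U : Matrix (Fin n → Fin 2) (Fin n → Fin 2) ℂ}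
    (hU : U ∈ compSU n α) : ∃ c : ℂ, ‖c‖ = 1 ∧
      (fun y : Fin n → Fin 2 => c • ∑ x, U x y • ket α (compChannels x) (2 * n)) ∈
        closure (Set.range fun (b : AffineBraidGroup (2 * n)) (y : Fin n → Fin 2) =>
          (braidAction α (2 * n) b : Matrix (Idx (2 * n)) (Idx (2 * n)) ℂ) *
            ket α (compChannels y) (2 * n)) := by
  obtain ⟨g, hg0, hg⟩ := gram_scalar_eq_ofReal h n
  choose w hw hwe using compWeight_eq_ofReal (n := n) h
  have hw0 : ∀ x, (w x : ℂ) ≠ 0 := fun x => ofReal_ne_zero.mpr (hw x).ne'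
  have hUd : Uᴴ * (Matrix.diagonal fun x => ((w x : ℂ) ^ 2)⁻¹) * U =
      Matrix.diagonal fun x => ((w x : ℂ) ^ 2)⁻¹ := by
    have h1 := hU.1
    simp only [gram_eq h, hg, hwe, Matrix.mul_smul, Matrix.smul_mul] at h1
    exact smul_right_injective _ (ofReal_ne_zero.mpr hg0) h1
  have hV : (Matrix.of fun x y => (w x : ℂ)⁻¹ * U x y * w y)ᴴ *
      (Matrix.of fun x y => (w x : ℂ)⁻¹ * U x y * w y) = 1 := by
    ext x y
    have h1 := congrFun (congrFun hUd x) y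
    rw [Matrix.mul_assoc, Matrix.mul_apply] at h1
    rw [Matrix.mul_apply]
    have h2 : ∀ z, (Matrix.of fun x y => (w x : ℂ)⁻¹ * U x y * w y)ᴴ x z *
        (Matrix.of fun x y => (w x : ℂ)⁻¹ * U x y * w y) z y =
        w x * w y * (Uᴴ x z * ((Matrix.diagonal fun x => ((w x : ℂ) ^ 2)⁻¹) * U) z y) := by
      intro z
      have e : Uᴴ x z = conj (U z x) := rfl
      have e' : (Matrix.of fun x y => (w x : ℂ)⁻¹ * U x y * w y)ᴴ x z =
          conj ((w z : ℂ)⁻¹ * U z x * w x) := rfl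
      rw [Matrix.diagonal_mul, e, e', Matrix.of_apply, map_mul, map_mul, map_inv₀, conj_ofReal,
        conj_ofReal]
      ring
    simp only [h2, ← Finset.mul_sum, h1]
    by_cases hxy : x = y
    · subst hxy
      have := hw0 x
      simp only [Matrix.diagonal_apply_eq, Matrix.one_apply_eq]
      field_simp
    · simp [hxy]
  refine exists_phase_of_mem_closure (S := Set.range _)
    (v := fun y : Fin n → Fin 2 => ∑ x, U x y • ket α (compChannels x) (2 * n)) ?_
  -- undo the normalization
  have hcont : Continuous fun (f : (Fin n → Fin 2) → Unit → Matrix (Idx (2 * n)) (Fin 4) ℂ) y =>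
      (w y : ℂ)⁻¹ • f y () := by
    fun_prop
  have := map_mem_closure hcont (mem_reach.mp (mem_reach_of_unitary h hV))
    (t := {f | ∃ c : ℂ, ‖c‖ = 1 ∧ ∃ f' ∈ (Set.range fun (b : AffineBraidGroup (2 * n))
      (y : Fin n → Fin 2) => (braidAction α (2 * n) b : Matrix (Idx (2 * n)) (Idx (2 * n)) ℂ) *
        ket α (compChannels y) (2 * n)), f = c • f'}) (by
    rintro _ ⟨_, ⟨c, hc, b, rfl⟩, rfl⟩
    refine ⟨c, hc, _, ⟨b, rfl⟩, ?_⟩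
    funext y
    simp only [compFamily, normKet, hwe, Matrix.mul_smul, Matrix.smul_mul, Pi.smul_apply]
    rw [inv_smul_smul₀ (hw0 y)])
  convert this using 2 with y
  simp only [recombine, compFamily, normKet, hwe, Finset.smul_sum, smul_smul, Matrix.of_apply]
  refine Finset.sum_congr rfl fun x _ => ?_
  congr 1
  have h1 := hw0 x
  have h2 := hw0 y
  field_simp

end Density

end

end Neglecton

theorem mainTheorem5 (n : ℕ) (α : ℝ) (hα : ∀ k : ℤ, α ≠ k)
    (hrange : ∃ k : ℤ, |α - (2 + 4 * k)| < 1 / 3) :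
    Neglecton.FormDefinite n α ∧
    ∀ U ∈ Neglecton.compSU n α, ∃ c : ℂ, ‖c‖ = 1 ∧
      (fun y : Fin n → Fin 2 => c • ∑ x, U x y • Neglecton.compKet hα x) ∈
        closure (Set.range fun (b : Neglecton.AffineBraidGroup (2 * n)) (y : Fin n → Fin 2) =>
          Neglecton.braidRep n α b (Neglecton.compKet hα y)) := by
  have h := Neglecton.isGoodAngle_of_abs_lt hα hrange
  refine ⟨Neglecton.formDefinite h n, fun U hU => ?_⟩
  obtain ⟨c, hc, hmem⟩ := Neglecton.recombine_mem_closure h hU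
  refine ⟨c, hc, ?_⟩
  have hind : Topology.IsInducing fun (f : (Fin n → Fin 2) → Neglecton.qubitSpace n α)
      (y : Fin n → Fin 2) => (f y : Matrix (Neglecton.Idx (2 * n)) (Fin 4) ℂ) :=
    Topology.IsInducing.piMap fun _ => Topology.IsInducing.subtypeVal
  rw [hind.closure_eq_preimage_closure_image, Set.mem_preimage, ← Set.range_comp]
  convert hmem using 2 with y
  · rfl
  · change ((c • ∑ x, U x y • Neglecton.compKet hα x : Neglecton.qubitSpace n α) :
      Matrix (Neglecton.Idx (2 * n)) (Fin 4) ℂ) = _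
    simp [Neglecton.compKet]
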